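/- Let $k$ be a field with $\operatorname{char} k\neq 2$ and let $\lambda\in k$. Let $T(2)$ be the Sweedler Hopf algebra over $k$: it is generated by $g,x$ with relations $g^2=1$, $x^2=0$, $gx+xg=0$, and $\Delta(g)=g\otimes g$, $\Delta(x)=x\otimes 1+g\otimes x$, $\varepsilon(g)=1$, $\varepsilon(x)=0$, $S(g)=g$, $S(x)=-gx$. Equip it with the universal $R$-matrix $$R_\lambda=\tfrac12(1\otimes 1+1\otimes g+g\otimes 1-g\otimes g)+\tfrac{\lambda}{2}(x\otimes x+x\otimes gx+gx\otimes gx-gx\otimes x),$$ and the category of $T(2)$-modules with the braiding $c_{M,N}(m\otimes n)=R_\lambda\cdot(n\otimes m)$. Let $A=k[u,v]$, which is a $T(2)$-module algebra via $g\cdot u=u$, $g\cdot v=-v$, $x\cdot u=0$, $x\cdot v=u$. Let $A^{op_c}$ be the vector space $A$ with multiplication $m_A\circ c_{A,A}$ and the original $T(2)$-action; let $A\otimes^cA^{op_c}$ be the vector space $A\otimes A$ with multiplication $(m_A\otimes m_{A^{op_c}})\circ(\mathrm{id}\otimes c_{A^{op_c},A}\otimes\mathrm{id})$ and the diagonal $T(2)$-action.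 Write $u=u\otimes 1$, $v=v\otimes 1$, $u'=1\otimes u$, $v'=1\otimes v$ for elements of $A\otimes^cA^{op_c}$. In the free algebra $k\langle u,v,u',v'\rangle$ put $$r_1=uv-vu,\quad r_2=u'v'-v'u',\quad r_3=uv'-v'u,$$ $$r_4=vv'+v'v-\lambda uu',\quad r_5=uu'-u'u,\quad r_6=vu'-u'v,$$ and let $I$ be the linear span of $r_1,\dots,r_6$. The algebra $T(2)$ acts on $k\langle u,v,u',v'\rangle$ by $g\cdot u=u$, $g\cdot v=-v$, $x\cdot u=0$, $x\cdot v=u$ and the same formulas for $u',v'$, making it a $T(2)$-module algebra. For a linear map $\kappa:I\to T(2)$ let $$\mathcal D_\kappa=\frac{k\langle u,v,u',v'\rangle\#T(2)}{(r-\kappa(r)\mid r\in I)},$$ filtered by placing $u,v,u',v'$ in degree $1$ and $T(2)$ in degree $0$. We say that $\mathcal D_\kappa$ is a PBW deformation of $(A\otimes^cA^{op_c})\#T(2)$ if its associated graded algebra is isomorphic, as an $\mathbb N$-graded algebra, to $(A\otimes^cA^{op_c})\#T(2)$, graded by total polynomial degree with $T(2)$ in degree $0$. **Proposition 4.1.**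 1. The algebra $A\otimes^cA^{op_c}$ is presented by the generators $u,v,u',v'$ and the relations $r_1=\dots=r_6=0$. 2. For a linear map $\kappa:I\to T(2)$, the algebra $\mathcal D_\kappa$ is a PBW deformation of $(A\otimes^cA^{op_c})\#T(2)$ if and only if there is an $\alpha\in k$ with $\kappa(r_4)=\alpha$ and $\kappa(r_i)=0$ for all $i\neq 4$. 3. For every $\alpha\in k$ there is exactly one such $\kappa$, so that these deformations are parametrized by $k$. -/

import Mathlib

open scoped TensorProduct

noncomputable section

namespace SweedlerPBW

section Twisted

variable {k A B : Type*} [Field k] [Ring A] [Algebra k A] [Ring B] [Algebra k B]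

/-- For `τ : B ⊗ A → A ⊗ B` and `b ∈ B`, the map `a ⊗ b' ↦ τ (b ⊗ a) b'`,
i.e. `(id ⊗ m_B) ∘ (τ ⊗ id)` evaluated at `b ⊗ (a ⊗ b')`. -/
def passLeft (τ : B ⊗[k] A →ₗ[k] A ⊗[k] B) (b : B) : A ⊗[k] B →ₗ[k] A ⊗[k] B :=
  (LinearMap.mul' k B).lTensor A ∘ₗ (TensorProduct.assoc k A B B).toLinearMap ∘ₗ
    (τ ∘ₗ TensorProduct.mk k B A b).rTensor B

/-- For `τ : B ⊗ A → A ⊗ B` and `a ∈ A`, the map `a' ⊗ b ↦ a' τ (b ⊗ a)`,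
i.e. `(m_A ⊗ id) ∘ (id ⊗ τ)` evaluated at `(a' ⊗ b) ⊗ a`. -/
def passRight (τ : B ⊗[k] A →ₗ[k] A ⊗[k] B) (a : A) : A ⊗[k] B →ₗ[k] A ⊗[k] B :=
  (LinearMap.mul' k A).rTensor B ∘ₗ (TensorProduct.assoc k A A B).symm.toLinearMap ∘ₗ
    (τ ∘ₗ (TensorProduct.mk k B A).flip a).lTensor A

variable (k A B) in
/-- A twisting map `τ : B ⊗ A → A ⊗ B` of two algebras: it is compatible with the units and with
the multiplications of `A` and `B`. -/
structure TwistingMap where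
  toMap : B ⊗[k] A →ₗ[k] A ⊗[k] B
  one_left : ∀ a : A, toMap (1 ⊗ₜ a) = a ⊗ₜ 1
  one_right : ∀ b : B, toMap (b ⊗ₜ 1) = 1 ⊗ₜ b
  mul_left : ∀ (b b' : B) (a : A), toMap ((b * b') ⊗ₜ a) = passLeft toMap b (toMap (b' ⊗ₜ a))
  mul_right : ∀ (b : B) (a a' : A), toMap (b ⊗ₜ (a * a')) = passRight toMap a' (toMap (b ⊗ₜ a))

/-- The multiplication `(m_A ⊗ m_B) ∘ (id ⊗ τ ⊗ id)` on `A ⊗ B`. -/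
def twistedMul (τ : B ⊗[k] A →ₗ[k] A ⊗[k] B) :
    (A ⊗[k] B) ⊗[k] (A ⊗[k] B) →ₗ[k] A ⊗[k] B :=
  TensorProduct.map (LinearMap.mul' k A) (LinearMap.mul' k B) ∘ₗ
    (TensorProduct.assoc k A A (B ⊗[k] B)).symm.toLinearMap ∘ₗ
    ((TensorProduct.assoc k A B B).toLinearMap ∘ₗ τ.rTensor B ∘ₗ
      (TensorProduct.assoc k B A B).symm.toLinearMap).lTensor A ∘ₗ
    (TensorProduct.assoc k A B (A ⊗[k] B)).toLinearMap

/-- The twisted tensor product algebra `A ⊗^τ B`: the space `A ⊗ B` with multiplication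
`(m_A ⊗ m_B) ∘ (id ⊗ τ ⊗ id)`. -/
def TwistedTensor (_τ : TwistingMap k A B) : Type _ := A ⊗[k] B

namespace TwistedTensor

variable (τ : TwistingMap k A B)

instance : AddCommGroup (TwistedTensor τ) := inferInstanceAs (AddCommGroup (A ⊗[k] B))
instance : Module k (TwistedTensor τ) := inferInstanceAs (Module k (A ⊗[k] B))

/-- The identification of vector spaces `A ⊗ B = A ⊗^τ B`. -/
def of : A ⊗[k] B ≃ₗ[k] TwistedTensor τ := LinearEquiv.refl k _

/-- Left multiplication by `a ∈ A`, on the first tensor factor. -/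
def lA (a : A) : A ⊗[k] B →ₗ[k] A ⊗[k] B := (LinearMap.mulLeft k a).rTensor B
/-- Right multiplication by `b ∈ B`, on the second tensor factor. -/
def rB (b : B) : A ⊗[k] B →ₗ[k] A ⊗[k] B := (LinearMap.mulRight k b).lTensor A

@[simp] lemma lA_tmul (a a' : A) (b : B) : lA (k := k) a (a' ⊗ₜ b) = (a * a') ⊗ₜ b := by simp [lA]
@[simp] lemma rB_tmul (b b' : B) (a : A) : rB (k := k) b (a ⊗ₜ b') = a ⊗ₜ (b' * b) := by simp [rB]

lemma twistedMul_tmul (t : B ⊗[k] A →ₗ[k] A ⊗[k] B) (a a' : A) (b b' : B) :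
    twistedMul t ((a ⊗ₜ b) ⊗ₜ (a' ⊗ₜ b')) = lA a (rB b' (t (b ⊗ₜ a'))) := by
  simp only [twistedMul, LinearMap.comp_apply, LinearEquiv.coe_coe, TensorProduct.assoc_tmul,
    LinearMap.lTensor_tmul, TensorProduct.assoc_symm_tmul, LinearMap.rTensor_tmul]
  generalize t (b ⊗ₜ a') = z
  induction z with
  | zero => simp
  | tmul x y => simp
  | add x y hx hy => simp only [TensorProduct.add_tmul, TensorProduct.tmul_add, map_add, hx, hy]

lemma passLeft_tmul (t : B ⊗[k] A →ₗ[k] A ⊗[k] B) (b b' : B) (a : A) :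
    passLeft t b (a ⊗ₜ b') = rB b' (t (b ⊗ₜ a)) := by
  simp only [passLeft, LinearMap.comp_apply, LinearEquiv.coe_coe, LinearMap.rTensor_tmul,
    TensorProduct.mk_apply]
  generalize t (b ⊗ₜ a) = z
  induction z with
  | zero => simp
  | tmul x y => simp
  | add x y hx hy => simp only [TensorProduct.add_tmul, map_add, hx, hy]

lemma passRight_tmul (t : B ⊗[k] A →ₗ[k] A ⊗[k] B) (a a' : A) (b : B) :
    passRight t a (a' ⊗ₜ b) = lA a' (t (b ⊗ₜ a)) := by
  simp only [passRight, LinearMap.comp_apply, LinearEquiv.coe_coe, LinearMap.lTensor_tmul,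
    TensorProduct.mk_apply, LinearMap.flip_apply]
  generalize t (b ⊗ₜ a) = z
  induction z with
  | zero => simp
  | tmul x y => simp
  | add x y hx hy => simp only [TensorProduct.tmul_add, map_add, hx, hy]

instance : Mul (TwistedTensor τ) := ⟨fun x y => of τ (twistedMul τ.toMap ((of τ).symm x ⊗ₜ (of τ).symm y))⟩
instance : One (TwistedTensor τ) := ⟨of τ (1 ⊗ₜ 1)⟩

lemma mul_def (x y : TwistedTensor τ) :
    x * y = of τ (twistedMul τ.toMap ((of τ).symm x ⊗ₜ (of τ).symm y)) := rfl
lemma one_def : (1 : TwistedTensor τ) = of τ (1 ⊗ₜ 1) := rfl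

lemma of_mul_of (a a' : A) (b b' : B) :
    of τ (a ⊗ₜ b) * of τ (a' ⊗ₜ b') = of τ (lA a (rB b' (τ.toMap (b ⊗ₜ a')))) :=
  congrArg (of τ) (twistedMul_tmul _ _ _ _ _)

protected lemma add_mul' (x y z : TwistedTensor τ) : (x + y) * z = x * z + y * z := by
  simp only [mul_def, map_add, TensorProduct.add_tmul]
protected lemma mul_add' (x y z : TwistedTensor τ) : x * (y + z) = x * y + x * z := by
  simp only [mul_def, map_add, TensorProduct.tmul_add]
protected lemma smul_mul' (c : k) (x y : TwistedTensor τ) : (c • x) * y = c • (x * y) := by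
  simp only [mul_def, map_smul, ← TensorProduct.smul_tmul']
protected lemma mul_smul' (c : k) (x y : TwistedTensor τ) : x * (c • y) = c • (x * y) := by
  simp only [mul_def, map_smul, TensorProduct.tmul_smul]
protected lemma zero_mul' (x : TwistedTensor τ) : 0 * x = 0 := by
  simpa using TwistedTensor.smul_mul' τ 0 0 x
protected lemma mul_zero' (x : TwistedTensor τ) : x * 0 = 0 := by
  simpa using TwistedTensor.mul_smul' τ 0 x 0

@[elab_as_elim]
lemma ind {P : TwistedTensor τ → Prop} (x : TwistedTensor τ) (h0 : P 0)
    (ht : ∀ a b, P (of τ (a ⊗ₜ b))) (ha : ∀ x y, P x → P y → P (x + y)) : P x :=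
  TensorProduct.induction_on (motive := P) x h0 ht ha

protected lemma one_mul' (x : TwistedTensor τ) : 1 * x = x := by
  induction x using ind with
  | h0 => exact TwistedTensor.mul_zero' τ _
  | ht a b => rw [one_def, of_mul_of, τ.one_left]; simp
  | ha x y hx hy => rw [TwistedTensor.mul_add', hx, hy]

protected lemma mul_one' (x : TwistedTensor τ) : x * 1 = x := by
  induction x using ind with
  | h0 => exact TwistedTensor.zero_mul' τ _
  | ht a b => rw [one_def, of_mul_of, τ.one_right]; simp
  | ha x y hx hy => rw [TwistedTensor.add_mul', hx, hy]

lemma of_lA_mul (a : A) (z : A ⊗[k] B) (y : TwistedTensor τ) :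
    of τ (lA a z) * y = of τ (lA a ((of τ).symm (of τ z * y))) := by
  induction y using ind with
  | h0 => simp [TwistedTensor.mul_zero']
  | ha x y hx hy => simp only [TwistedTensor.mul_add', hx, hy, map_add]
  | ht a' b' =>
    induction z with
    | zero => simp [TwistedTensor.zero_mul']
    | add x y hx hy => simp only [map_add, TwistedTensor.add_mul', hx, hy]
    | tmul p q =>
      rw [lA_tmul, of_mul_of, of_mul_of, LinearEquiv.symm_apply_apply]
      congr 1
      generalize (rB b') (τ.toMap (q ⊗ₜ[k] a')) = w
      induction w with
      | zero => simp
      | tmul x y => simp [mul_assoc]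
      | add x y hx hy => simp only [map_add, hx, hy]

lemma mul_of_rB (b : B) (z : A ⊗[k] B) (y : TwistedTensor τ) :
    y * of τ (rB b z) = of τ (rB b ((of τ).symm (y * of τ z))) := by
  induction y using ind with
  | h0 => simp [TwistedTensor.zero_mul']
  | ha x y hx hy => simp only [TwistedTensor.add_mul', hx, hy, map_add]
  | ht a' b' =>
    induction z with
    | zero => simp [TwistedTensor.mul_zero']
    | add x y hx hy => simp only [map_add, TwistedTensor.mul_add', hx, hy]
    | tmul p q =>
      rw [rB_tmul, of_mul_of, of_mul_of, LinearEquiv.symm_apply_apply]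
      congr 1
      generalize (τ.toMap (b' ⊗ₜ[k] p)) = w
      induction w with
      | zero => simp
      | tmul x y => simp [mul_assoc]
      | add x y hx hy => simp only [map_add, hx, hy]

lemma rB_mul (b : B) (z : A ⊗[k] B) (a : A) :
    of τ (rB b z) * of τ (a ⊗ₜ 1) = of τ z * of τ (τ.toMap (b ⊗ₜ a)) := by
  induction z with
  | zero => simp [TwistedTensor.zero_mul']
  | add x y hx hy => simp only [map_add, TwistedTensor.add_mul', hx, hy]
  | tmul p q =>
    rw [rB_tmul, of_mul_of, τ.mul_left]
    generalize τ.toMap (b ⊗ₜ a) = w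
    induction w with
    | zero => simp [TwistedTensor.mul_zero']
    | add x y hx hy => simp only [map_add, TwistedTensor.mul_add', ← hx, ← hy]
    | tmul x y =>
      rw [passLeft_tmul, of_mul_of]
      congr 2
      generalize (τ.toMap (q ⊗ₜ x)) = w
      induction w with
      | zero => simp
      | tmul x y => simp
      | add x y hx hy => simp only [map_add, hx, hy]

lemma mul_lA (b : B) (z : A ⊗[k] B) (a : A) :
    of τ (1 ⊗ₜ b) * of τ (lA a z) = of τ (τ.toMap (b ⊗ₜ a)) * of τ z := by
  induction z with
  | zero => simp [TwistedTensor.mul_zero']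
  | add x y hx hy => simp only [map_add, TwistedTensor.mul_add', hx, hy]
  | tmul p q =>
    rw [lA_tmul, of_mul_of, τ.mul_right]
    generalize τ.toMap (b ⊗ₜ a) = w
    induction w with
    | zero => simp [TwistedTensor.zero_mul']
    | add x y hx hy => simp only [map_add, TwistedTensor.add_mul', ← hx, ← hy]
    | tmul x y =>
      rw [passRight_tmul, of_mul_of]
      congr 1
      generalize (τ.toMap (y ⊗ₜ p)) = w
      induction w with
      | zero => simp
      | tmul x y => simp
      | add x y hx hy => simp only [map_add, hx, hy]

protected lemma mul_assoc' (x y z : TwistedTensor τ) : x * y * z = x * (y * z) := by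
  induction x using ind with
  | h0 => simp [TwistedTensor.zero_mul']
  | ha x y hx hy => simp only [TwistedTensor.add_mul', hx, hy]
  | ht a b =>
  induction z using ind with
  | h0 => simp [TwistedTensor.mul_zero']
  | ha x y hx hy => simp only [TwistedTensor.mul_add', hx, hy]
  | ht a'' b'' =>
  induction y using ind with
  | h0 => simp [TwistedTensor.zero_mul', TwistedTensor.mul_zero']
  | ha x y hx hy => simp only [TwistedTensor.mul_add', TwistedTensor.add_mul', hx, hy]
  | ht a' b' =>
  have e1 : a'' ⊗ₜ[k] b'' = rB (A := A) b'' (a'' ⊗ₜ[k] (1 : B)) := by simp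
  have e2 : a ⊗ₜ[k] b = lA (B := B) a ((1 : A) ⊗ₜ[k] b) := by simp
  have h1 : of τ (a ⊗ₜ b) * of τ (a' ⊗ₜ b') * of τ (a'' ⊗ₜ b'') =
      of τ (lA a (rB b'' (τ.toMap (b ⊗ₜ a') |> fun t =>
        (of τ).symm (of τ t * of τ (τ.toMap (b' ⊗ₜ a'')))))) := by
    rw [of_mul_of, of_lA_mul, e1, mul_of_rB, rB_mul]; rfl
  have h2 : of τ (a ⊗ₜ b) * (of τ (a' ⊗ₜ b') * of τ (a'' ⊗ₜ b'')) =
      of τ (lA a (rB b'' (τ.toMap (b ⊗ₜ a') |> fun t =>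
        (of τ).symm (of τ t * of τ (τ.toMap (b' ⊗ₜ a'')))))) := by
    rw [of_mul_of]
    have : lA a' (rB b'' (τ.toMap (b' ⊗ₜ a''))) = rB b'' (lA a' (τ.toMap (b' ⊗ₜ a''))) := by
      generalize (τ.toMap (b' ⊗ₜ a'')) = w
      induction w with
      | zero => simp
      | tmul x y => simp
      | add x y hx hy => simp only [map_add, hx, hy]
    rw [this, mul_of_rB, e2, of_lA_mul, mul_lA]
    simp only [LinearEquiv.symm_apply_apply]
    generalize (of τ).symm (of τ (τ.toMap (b ⊗ₜ[k] a')) * of τ (τ.toMap (b' ⊗ₜ[k] a''))) = w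
    congr 1
    induction w with
    | zero => simp
    | tmul x y => simp
    | add x y hx hy => simp only [map_add, hx, hy]
  rw [h1, h2]

instance : Ring (TwistedTensor τ) :=
  { (inferInstance : AddCommGroup (TwistedTensor τ)) with
    mul := (· * ·)
    one := 1
    left_distrib := TwistedTensor.mul_add' τ
    right_distrib := TwistedTensor.add_mul' τ
    zero_mul := TwistedTensor.zero_mul' τ
    mul_zero := TwistedTensor.mul_zero' τ
    mul_assoc := TwistedTensor.mul_assoc' τ
    one_mul := TwistedTensor.one_mul' τ
    mul_one := TwistedTensor.mul_one' τ }

instance : Algebra k (TwistedTensor τ) :=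
  Algebra.ofModule (TwistedTensor.smul_mul' τ) (TwistedTensor.mul_smul' τ)

end TwistedTensor

end Twisted

section HopfActions

open Coalgebra

variable (k H : Type*) [Field k] [Ring H] [Bialgebra k H]

variable {k H} in
/-- The action of `H ⊗ H` on `M ⊗ N`, for two representations `M`, `N` of `H`. -/
def tensorAct {M N : Type*} [AddCommGroup M] [Module k M] [AddCommGroup N] [Module k N]
    (ρ : H →ₐ[k] Module.End k M) (σ : H →ₐ[k] Module.End k N) :
    H ⊗[k] H →ₐ[k] Module.End k (M ⊗[k] N) :=
  (Module.endTensorEndAlgHom (R := k) (S := k) (A := k) (M := M) (N := N)).comp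
    (Algebra.TensorProduct.map ρ σ)

/-- A (left) `H`-module algebra: an algebra `A` with a representation `act` of `H` on the vector
space `A` such that `h · 1 = ε(h) 1` and `h · (a a') = ∑ (h₁ · a) (h₂ · a')`. -/
class HModuleAlgebra (A : Type*) [Ring A] [Algebra k A] where
  act : H →ₐ[k] Module.End k A
  act_one : ∀ h : H, act h 1 = algebraMap k A (counit h)
  act_mul : ∀ (h : H) (a a' : A), act h (a * a') =
    LinearMap.mul' k A (tensorAct act act (comul h) (a ⊗ₜ a'))

/-- The action of `H` on an `H`-module algebra. -/
def hact (A : Type*) [Ring A] [Algebra k A] [HModuleAlgebra k H A] : H →ₐ[k] Module.End k A :=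
  HModuleAlgebra.act

variable {k H}

/-- The action map `h ↦ h · m`. -/
def ev {M : Type*} [AddCommGroup M] [Module k M] (ρ : H →ₐ[k] Module.End k M) (m : M) :
    H →ₗ[k] M :=
  LinearMap.applyₗ m ∘ₗ ρ.toLinearMap

section
variable {M N : Type*} [AddCommGroup M] [Module k M] [AddCommGroup N] [Module k N]
    (ρ : H →ₐ[k] Module.End k M) (σ : H →ₐ[k] Module.End k N)

@[simp] lemma ev_apply (m : M) (h : H) : ev ρ m h = ρ h m := rfl

@[simp] lemma tensorAct_tmul (h h' : H) (m : M) (n : N) :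
    tensorAct ρ σ (h ⊗ₜ h') (m ⊗ₜ n) = ρ h m ⊗ₜ σ h' n := rfl

lemma tensorAct_apply (t : H ⊗[k] H) (m : M) (n : N) :
    tensorAct ρ σ t (m ⊗ₜ n) = TensorProduct.map (ev ρ m) (ev σ n) t := by
  induction t with
  | zero => simp
  | tmul x y => simp
  | add x y hx hy => simp only [map_add, LinearMap.add_apply, hx, hy]

end

variable (k H) in
/-- A universal `R`-matrix of the bialgebra `H`, in the convention for which
`c_{M,N}(m ⊗ n) = R · (n ⊗ m)` is a braiding of the category of `H`-modules: `mul_comul_swap` says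
that `c_{M,N}` is `H`-linear, `val_isUnit` that it is invertible, and the last two fields are the
two hexagon axioms `(id ⊗ Δ)(R) = R₁₂ R₁₃` and `(Δ ⊗ id)(R) = R₂₃ R₁₃` in `H ⊗ (H ⊗ H)`. -/
structure RMatrix where
  val : H ⊗[k] H
  val_isUnit : IsUnit val
  mul_comul_swap : ∀ h : H, val * TensorProduct.comm k H H (comul h) = comul h * val
  hexagon_right : (comul (R := k) (A := H)).lTensor H val =
    Algebra.TensorProduct.map (AlgHom.id k H) Algebra.TensorProduct.includeLeft val *
      Algebra.TensorProduct.map (AlgHom.id k H) Algebra.TensorProduct.includeRight val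
  hexagon_left : TensorProduct.assoc k H H H ((comul (R := k) (A := H)).rTensor H val) =
    (Algebra.TensorProduct.includeRight : H ⊗[k] H →ₐ[k] H ⊗[k] (H ⊗[k] H)) val *
      Algebra.TensorProduct.map (AlgHom.id k H) Algebra.TensorProduct.includeRight val

/-- The braiding `c_{M,N} = R ∘ σ : M ⊗ N → N ⊗ M`, where `σ` is the flip. -/
def braiding (R : RMatrix k H) {M N : Type*} [AddCommGroup M] [Module k M] [AddCommGroup N]
    [Module k N] (ρ : H →ₐ[k] Module.End k M) (σ : H →ₐ[k] Module.End k N) :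
    M ⊗[k] N →ₗ[k] N ⊗[k] M :=
  tensorAct σ ρ R.val ∘ₗ (TensorProduct.comm k M N).toLinearMap

section lemmas

variable {A : Type*} [Ring A] [Algebra k A] [HModuleAlgebra k H A]
variable {B : Type*} [Ring B] [Algebra k B] [HModuleAlgebra k H B]

lemma hact_one (h : H) : hact k H A h 1 = algebraMap k A (counit h) := HModuleAlgebra.act_one h

lemma hact_mul (h : H) (a a' : A) : hact k H A h (a * a') =
    LinearMap.mul' k A (tensorAct (hact k H A) (hact k H A) (comul h) (a ⊗ₜ a')) :=
  HModuleAlgebra.act_mul h a a'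

lemma hact_mul' (h : H) (a a' : A) : hact k H A h (a * a') =
    LinearMap.mul' k A (TensorProduct.map (ev (hact k H A) a) (ev (hact k H A) a') (comul h)) := by
  rw [hact_mul, tensorAct_apply]

lemma hact_mul_repr {ι : Type*} (h : H) (a a' : A) (r : Repr k h ι) : hact k H A h (a * a') =
    ∑ i ∈ r.index, hact k H A (r.left i) a * hact k H A (r.right i) a' := by
  rw [hact_mul', ← r.eq]; simp

lemma RMatrix.exists_sum (R : RMatrix k H) : ∃ S : Finset (H × H), R.val = ∑ i ∈ S, i.1 ⊗ₜ i.2 :=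
  TensorProduct.exists_finset R.val

/-- `(id ⊗ ε)(R) = 1`. -/
lemma RMatrix.lTensor_counit (R : RMatrix k H) :
    (counit (R := k) (A := H)).lTensor H R.val = 1 ⊗ₜ 1 := by
  have h := R.hexagon_right
  set f : H ⊗[k] H →ₐ[k] H := (Algebra.TensorProduct.rid k k H).toAlgHom.comp
    (Algebra.TensorProduct.map (AlgHom.id k H) (Bialgebra.counitAlgHom k H)) with hf
  set F : H ⊗[k] (H ⊗[k] H) →ₐ[k] H ⊗[k] H := Algebra.TensorProduct.map (AlgHom.id k H)
    ((Algebra.TensorProduct.lid k H).toAlgHom.comp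
      (Algebra.TensorProduct.map (Bialgebra.counitAlgHom k H) (AlgHom.id k H))) with hF
  have h1 : ∀ t : H ⊗[k] H, F ((comul (R := k) (A := H)).lTensor H t) = t := by
    intro t
    induction t with
    | zero => simp
    | add x y hx hy => simp only [map_add, hx, hy]
    | tmul x y =>
      have : (Algebra.TensorProduct.lid k H).toAlgHom.comp
        (Algebra.TensorProduct.map (Bialgebra.counitAlgHom k H) (AlgHom.id k H)) (comul y) = y := by
        have := congrArg (TensorProduct.lid k H) (rTensor_counit_comul (R := k) y)
        rw [TensorProduct.lid_tmul, one_smul] at this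
        exact this
      simp only [hF, LinearMap.lTensor_tmul, Algebra.TensorProduct.map_tmul]
      rw [this]; rfl
  have h2 : ∀ t : H ⊗[k] H, F (Algebra.TensorProduct.map (AlgHom.id k H)
      Algebra.TensorProduct.includeRight t) = t := by
    intro t
    induction t with
    | zero => simp
    | add x y hx hy => simp only [map_add, hx, hy]
    | tmul x y => simp [hF]
  have h3 : ∀ t : H ⊗[k] H, F (Algebra.TensorProduct.map (AlgHom.id k H)
      Algebra.TensorProduct.includeLeft t) = f t ⊗ₜ 1 := by
    intro t
    induction t with
    | zero => simp
    | add x y hx hy => simp only [map_add, hx, hy, TensorProduct.add_tmul]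
    | tmul x y => simp [hF, hf, TensorProduct.smul_tmul']
  have h4 := congrArg F h
  rw [map_mul, h1, h2, h3] at h4
  have h5 : f R.val ⊗ₜ[k] (1 : H) = 1 := by
    apply R.val_isUnit.mul_right_cancel
    rw [← h4, one_mul]
  have h6 : f R.val = 1 := by
    have := congrArg f h5
    simpa [hf] using this
  apply (TensorProduct.rid k H).injective
  rw [TensorProduct.rid_tmul, one_smul, ← h6]
  rfl

/-- `(ε ⊗ id)(R) = 1`. -/
lemma RMatrix.rTensor_counit (R : RMatrix k H) :
    (counit (R := k) (A := H)).rTensor H R.val = 1 ⊗ₜ 1 := by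
  have h := R.hexagon_left
  set f : H ⊗[k] H →ₐ[k] H := (Algebra.TensorProduct.lid k H).toAlgHom.comp
    (Algebra.TensorProduct.map (Bialgebra.counitAlgHom k H) (AlgHom.id k H)) with hf
  set F : H ⊗[k] (H ⊗[k] H) →ₐ[k] H ⊗[k] H := Algebra.TensorProduct.map (AlgHom.id k H) f with hF
  have h1 : ∀ t : H ⊗[k] H, F (TensorProduct.assoc k H H H
      ((comul (R := k) (A := H)).rTensor H t)) = t := by
    intro t
    induction t with
    | zero => simp
    | add x y hx hy => simp only [map_add, hx, hy]
    | tmul x y =>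
      have e : ∀ s : H ⊗[k] H, F (TensorProduct.assoc k H H H (s ⊗ₜ y)) =
          TensorProduct.rid k H ((counit (R := k) (A := H)).lTensor H s) ⊗ₜ y := by
        intro s
        induction s with
        | zero => simp
        | add x y hx hy => simp only [map_add, hx, hy, TensorProduct.add_tmul]
        | tmul x z => simp [hF, hf, TensorProduct.smul_tmul']
      rw [LinearMap.rTensor_tmul, e, lTensor_counit_comul]; simp
  have h2 : ∀ t : H ⊗[k] H, F (Algebra.TensorProduct.map (AlgHom.id k H)
      Algebra.TensorProduct.includeRight t) = t := by
    intro t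
    induction t with
    | zero => simp
    | add x y hx hy => simp only [map_add, hx, hy]
    | tmul x y => simp [hF, hf]
  have h3 : ∀ t : H ⊗[k] H, F ((Algebra.TensorProduct.includeRight :
      H ⊗[k] H →ₐ[k] H ⊗[k] (H ⊗[k] H)) t) = 1 ⊗ₜ f t := by
    intro t
    simp [hF]
  have h4 := congrArg F h
  rw [map_mul, h1, h2, h3] at h4
  have h5 : (1 : H) ⊗ₜ[k] f R.val = 1 := by
    apply R.val_isUnit.mul_right_cancel
    rw [← h4, one_mul]
  have h6 : f R.val = 1 := by
    have := congrArg f h5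
    simpa [hf] using this
  apply (TensorProduct.lid k H).injective
  rw [TensorProduct.lid_tmul, one_smul, ← h6]
  rfl

/-- Evaluation of the first hexagon on three vectors. -/
lemma RMatrix.hexagon_right_apply {S : Finset (H × H)} {M : Type*} [AddCommGroup M] [Module k M]
    (R : RMatrix k H) (hS : R.val = ∑ i ∈ S, i.1 ⊗ₜ i.2) (Φ : H ⊗[k] (H ⊗[k] H) →ₗ[k] M) :
    ∑ i ∈ S, Φ (i.1 ⊗ₜ comul i.2) = ∑ i ∈ S, ∑ j ∈ S, Φ ((i.1 * j.1) ⊗ₜ (i.2 ⊗ₜ j.2)) := by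
  have := congrArg Φ R.hexagon_right
  rw [hS] at this
  simpa [Finset.sum_mul_sum] using this

/-- Evaluation of the second hexagon on three vectors. -/
lemma RMatrix.hexagon_left_apply {S : Finset (H × H)} {M : Type*} [AddCommGroup M] [Module k M]
    (R : RMatrix k H) (hS : R.val = ∑ i ∈ S, i.1 ⊗ₜ i.2) (Φ : H ⊗[k] (H ⊗[k] H) →ₗ[k] M) :
    ∑ i ∈ S, Φ (TensorProduct.assoc k H H H (comul i.1 ⊗ₜ i.2)) =
      ∑ i ∈ S, ∑ j ∈ S, Φ (j.1 ⊗ₜ (i.1 ⊗ₜ (i.2 * j.2))) := by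
  have := congrArg Φ R.hexagon_left
  rw [hS] at this
  simpa [Finset.sum_mul_sum] using this

lemma braiding_tmul {S : Finset (H × H)} (R : RMatrix k H) (hS : R.val = ∑ i ∈ S, i.1 ⊗ₜ i.2)
    (b : B) (a : A) :
    braiding R (hact k H B) (hact k H A) (b ⊗ₜ a) =
      ∑ i ∈ S, hact k H A i.1 a ⊗ₜ hact k H B i.2 b := by
  simp [braiding, hS]

end lemmas

section BraidedProduct

variable (R : RMatrix k H) (A B : Type*) [Ring A] [Algebra k A] [HModuleAlgebra k H A]
  [Ring B] [Algebra k B] [HModuleAlgebra k H B]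

/-- The braiding `c_{B,A} : B ⊗ A → A ⊗ B`, as a twisting map. -/
def braidTwist : TwistingMap k A B where
  toMap := braiding R (hact k H B) (hact k H A)
  one_left a := by
    obtain ⟨S, hS⟩ := R.exists_sum
    have h := R.lTensor_counit
    rw [hS] at h
    rw [braiding_tmul R hS]
    have := congrArg (TensorProduct.map (ev (hact k H A) a) (Algebra.linearMap k B)) h
    simpa [hact_one] using this
  one_right b := by
    obtain ⟨S, hS⟩ := R.exists_sum
    have h := R.rTensor_counit
    rw [hS] at h
    rw [braiding_tmul R hS]
    have := congrArg (TensorProduct.map (Algebra.linearMap k A) (ev (hact k H B) b)) h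
    simpa [hact_one] using this
  mul_left b b' a := by
    obtain ⟨S, hS⟩ := R.exists_sum
    have h := R.hexagon_right_apply hS (TensorProduct.map (ev (hact k H A) a)
      (LinearMap.mul' k B ∘ₗ TensorProduct.map (ev (hact k H B) b) (ev (hact k H B) b')))
    simp only [TensorProduct.map_tmul, LinearMap.comp_apply, ev_apply, ← hact_mul',
      LinearMap.mul'_apply] at h
    rw [braiding_tmul R hS, braiding_tmul R hS, h]
    simp only [map_sum, TwistedTensor.passLeft_tmul, braiding_tmul R hS, TwistedTensor.rB_tmul,
      map_mul, Module.End.mul_apply]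
    exact Finset.sum_comm
  mul_right b a a' := by
    obtain ⟨S, hS⟩ := R.exists_sum
    have h := R.hexagon_left_apply hS (TensorProduct.map (LinearMap.mul' k A ∘ₗ
      TensorProduct.map (ev (hact k H A) a) (ev (hact k H A) a')) (ev (hact k H B) b) ∘ₗ
      (TensorProduct.assoc k H H H).symm.toLinearMap)
    simp only [LinearMap.comp_apply, LinearEquiv.coe_coe, LinearEquiv.symm_apply_apply,
      TensorProduct.map_tmul, ev_apply, ← hact_mul', LinearMap.mul'_apply,
      TensorProduct.assoc_symm_tmul] at h
    rw [braiding_tmul R hS, braiding_tmul R hS, h]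
    simp only [map_sum, TwistedTensor.passRight_tmul, braiding_tmul R hS, TwistedTensor.lA_tmul,
      map_mul, Module.End.mul_apply]
    exact Finset.sum_comm

/-- The braided product `A ⊗^c B`: the space `A ⊗ B` with multiplication
`(m_A ⊗ m_B) ∘ (id ⊗ c_{B,A} ⊗ id)`. -/
abbrev BraidedProduct : Type _ := TwistedTensor (braidTwist R A B)

/-- The braided-opposite algebra `A^{op_c}`: the space `A` with multiplication `m_A ∘ c_{A,A}`. -/
def BraidedOpp (_R : RMatrix k H) (A : Type*) [Ring A] [Algebra k A] [HModuleAlgebra k H A] :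
    Type _ := A

end BraidedProduct

namespace BraidedOpp

variable (R : RMatrix k H) (A : Type*) [Ring A] [Algebra k A] [HModuleAlgebra k H A]

instance : AddCommGroup (BraidedOpp R A) := inferInstanceAs (AddCommGroup A)
instance : Module k (BraidedOpp R A) := inferInstanceAs (Module k A)

/-- The identification of vector spaces `A = A^{op_c}`. -/
def of : A ≃ₗ[k] BraidedOpp R A := LinearEquiv.refl k _

/-- The linear map `m_A ∘ c_{A,A}`. -/
def opMul : A ⊗[k] A →ₗ[k] A :=
  LinearMap.mul' k A ∘ₗ braiding R (hact k H A) (hact k H A)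

instance : Mul (BraidedOpp R A) :=
  ⟨fun x y => of R A (opMul R A ((of R A).symm x ⊗ₜ (of R A).symm y))⟩
instance : One (BraidedOpp R A) := ⟨of R A 1⟩

lemma mul_def (x y : BraidedOpp R A) :
    x * y = of R A (opMul R A ((of R A).symm x ⊗ₜ (of R A).symm y)) := rfl

lemma of_mul_of (a b : A) : of R A a * of R A b = of R A (opMul R A (a ⊗ₜ b)) := rfl

lemma opMul_tmul {S : Finset (H × H)} (hS : R.val = ∑ i ∈ S, i.1 ⊗ₜ i.2) (a b : A) :
    opMul R A (a ⊗ₜ b) = ∑ i ∈ S, hact k H A i.1 b * hact k H A i.2 a := by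
  simp [opMul, braiding_tmul R hS]

/-- The Yang-Baxter equation. -/
lemma yangBaxter {S : Finset (H × H)} (hS : R.val = ∑ i ∈ S, i.1 ⊗ₜ i.2)
    {M : Type*} [AddCommGroup M] [Module k M] (Φ : H ⊗[k] (H ⊗[k] H) →ₗ[k] M) :
    ∑ x ∈ S, ∑ y ∈ S, ∑ z ∈ S, Φ ((z.1 * y.1) ⊗ₜ ((z.2 * x.1) ⊗ₜ (y.2 * x.2))) =
    ∑ x ∈ S, ∑ y ∈ S, ∑ z ∈ S, Φ ((y.1 * x.1) ⊗ₜ ((z.1 * x.2) ⊗ₜ (z.2 * y.2))) := by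
  set inR : H ⊗[k] H →ₐ[k] H ⊗[k] (H ⊗[k] H) := Algebra.TensorProduct.includeRight
  set r12 := Algebra.TensorProduct.map (AlgHom.id k H)
    (Algebra.TensorProduct.includeLeft : H →ₐ[k] H ⊗[k] H) R.val with h12
  set r13 := Algebra.TensorProduct.map (AlgHom.id k H)
    (Algebra.TensorProduct.includeRight : H →ₐ[k] H ⊗[k] H) R.val with h13
  set sw : H ⊗[k] (H ⊗[k] H) →ₐ[k] H ⊗[k] (H ⊗[k] H) := Algebra.TensorProduct.map (AlgHom.id k H)
    (Algebra.TensorProduct.comm k H H).toAlgHom with hsw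
  have e1 : (comul (R := k) (A := H)).lTensor H R.val = r12 * r13 := R.hexagon_right
  have e2 : ∀ s : H ⊗[k] H, (comul (R := k) (A := H)).lTensor H s * inR R.val =
      inR R.val * sw ((comul (R := k) (A := H)).lTensor H s) := by
    intro s
    induction s with
    | zero => simp
    | add x y hx hy => simp only [map_add, add_mul, mul_add, hx, hy]
    | tmul x y =>
      have : (Algebra.TensorProduct.comm k H H).toAlgHom (comul y) =
        TensorProduct.comm k H H (comul y) := rfl
      simp [inR, sw, this, R.mul_comul_swap]
  have e3 : sw r12 = r13 := by
    simp only [h12, h13, hS, map_sum]; simp [sw]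
  have e4 : sw r13 = r12 := by
    simp only [h12, h13, hS, map_sum]; simp [sw]
  have e5 : r12 * r13 * inR R.val = inR R.val * (r13 * r12) := by
    rw [← e1, e2, e1, map_mul, e3, e4]
  have e6 := congrArg Φ e5
  simp only [h12, h13, hS, map_sum, Finset.sum_mul, Finset.mul_sum] at e6
  simpa [inR] using e6

protected lemma add_mul' (x y z : BraidedOpp R A) : (x + y) * z = x * z + y * z := by
  simp only [mul_def, map_add, TensorProduct.add_tmul]
protected lemma mul_add' (x y z : BraidedOpp R A) : x * (y + z) = x * y + x * z := by
  simp only [mul_def, map_add, TensorProduct.tmul_add]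
protected lemma smul_mul' (c : k) (x y : BraidedOpp R A) : (c • x) * y = c • (x * y) := by
  simp only [mul_def, map_smul, ← TensorProduct.smul_tmul']
protected lemma mul_smul' (c : k) (x y : BraidedOpp R A) : x * (c • y) = c • (x * y) := by
  simp only [mul_def, map_smul, TensorProduct.tmul_smul]

protected lemma mul_assoc' (x y z : BraidedOpp R A) : x * y * z = x * (y * z) := by
  obtain ⟨S, hS⟩ := R.exists_sum
  obtain ⟨a, rfl⟩ := (of R A).surjective x
  obtain ⟨b, rfl⟩ := (of R A).surjective y
  obtain ⟨c, rfl⟩ := (of R A).surjective z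
  simp only [of_mul_of]
  congr 1
  have h1 : ∀ a' b' : A, opMul R A ((b' * a') ⊗ₜ c) = ∑ i ∈ S, ∑ j ∈ S,
      hact k H A (i.1 * j.1) c * (hact k H A i.2 b' * hact k H A j.2 a') := by
    intro a' b'
    have h := R.hexagon_right_apply hS (LinearMap.mul' k A ∘ₗ TensorProduct.map
      (ev (hact k H A) c) (LinearMap.mul' k A ∘ₗ
        TensorProduct.map (ev (hact k H A) b') (ev (hact k H A) a')))
    simp only [LinearMap.comp_apply, TensorProduct.map_tmul, ev_apply, ← hact_mul',
      LinearMap.mul'_apply] at h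
    rw [opMul_tmul R A hS, h]
  have h2 : ∀ c' b' : A, opMul R A (a ⊗ₜ (c' * b')) = ∑ i ∈ S, ∑ j ∈ S,
      hact k H A j.1 c' * hact k H A i.1 b' * hact k H A (i.2 * j.2) a := by
    intro c' b'
    have h := R.hexagon_left_apply hS (LinearMap.mul' k A ∘ₗ TensorProduct.map
      (LinearMap.mul' k A ∘ₗ TensorProduct.map (ev (hact k H A) c') (ev (hact k H A) b'))
      (ev (hact k H A) a) ∘ₗ (TensorProduct.assoc k H H H).symm.toLinearMap)
    simp only [LinearMap.comp_apply, LinearEquiv.coe_coe, LinearEquiv.symm_apply_apply,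
      TensorProduct.assoc_symm_tmul, TensorProduct.map_tmul, ev_apply, ← hact_mul',
      LinearMap.mul'_apply] at h
    rw [opMul_tmul R A hS, h]
  have h3 := yangBaxter R hS (LinearMap.mul' k A ∘ₗ TensorProduct.map
      (ev (hact k H A) c) (LinearMap.mul' k A ∘ₗ
        TensorProduct.map (ev (hact k H A) b) (ev (hact k H A) a)))
  simp only [LinearMap.comp_apply, TensorProduct.map_tmul, ev_apply, LinearMap.mul'_apply] at h3
  rw [opMul_tmul R A hS a b, opMul_tmul R A hS b c]
  simp only [TensorProduct.sum_tmul, TensorProduct.tmul_sum, map_sum, h1, h2]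
  calc _ = ∑ x ∈ S, ∑ y ∈ S, ∑ z ∈ S, hact k H A (z.1 * y.1) c *
        (hact k H A (z.2 * x.1) b * hact k H A (y.2 * x.2) a) := by
        refine Finset.sum_congr rfl fun x _ => ?_
        rw [Finset.sum_comm]
        simp only [map_mul, Module.End.mul_apply]
    _ = _ := by
        rw [h3]
        refine Finset.sum_congr rfl fun x _ => ?_
        rw [Finset.sum_comm]
        simp only [map_mul, Module.End.mul_apply, mul_assoc]

protected lemma one_mul' (x : BraidedOpp R A) : 1 * x = x := by
  obtain ⟨S, hS⟩ := R.exists_sum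
  obtain ⟨a, rfl⟩ := (of R A).surjective x
  have h := R.lTensor_counit
  rw [hS] at h
  have := congrArg (LinearMap.mul' k A ∘ₗ
    TensorProduct.map (ev (hact k H A) a) (Algebra.linearMap k A)) h
  refine congrArg (of R A) ((opMul_tmul R A hS _ _).trans ?_)
  have e : (of R A).symm 1 = (1 : A) := rfl
  simpa [hact_one, e] using this

protected lemma mul_one' (x : BraidedOpp R A) : x * 1 = x := by
  obtain ⟨S, hS⟩ := R.exists_sum
  obtain ⟨a, rfl⟩ := (of R A).surjective x
  have h := R.rTensor_counit
  rw [hS] at h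
  have := congrArg (LinearMap.mul' k A ∘ₗ
    TensorProduct.map (Algebra.linearMap k A) (ev (hact k H A) a)) h
  refine congrArg (of R A) ((opMul_tmul R A hS _ _).trans ?_)
  have e : (of R A).symm 1 = (1 : A) := rfl
  simpa [hact_one, e] using this

instance : Ring (BraidedOpp R A) :=
  { (inferInstance : AddCommGroup (BraidedOpp R A)) with
    mul := (· * ·)
    one := 1
    left_distrib := BraidedOpp.mul_add' R A
    right_distrib := BraidedOpp.add_mul' R A
    zero_mul := fun x => by simpa using BraidedOpp.smul_mul' R A 0 0 x
    mul_zero := fun x => by simpa using BraidedOpp.mul_smul' R A 0 x 0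
    mul_assoc := BraidedOpp.mul_assoc' R A
    one_mul := BraidedOpp.one_mul' R A
    mul_one := BraidedOpp.mul_one' R A }

instance : Algebra k (BraidedOpp R A) :=
  Algebra.ofModule (BraidedOpp.smul_mul' R A) (BraidedOpp.mul_smul' R A)

/-- `H` acts on `A^{op_c}` by its original action on `A`. -/
instance : HModuleAlgebra k H (BraidedOpp R A) where
  act := show H →ₐ[k] Module.End k (BraidedOpp R A) from hact k H A
  act_one h := by
    have := hact_one (A := A) (k := k) h
    rw [Algebra.algebraMap_eq_smul_one] at this ⊢
    exact this
  act_mul h x y := by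
    obtain ⟨a, rfl⟩ := (of R A).surjective x
    obtain ⟨b, rfl⟩ := (of R A).surjective y
    have e1 : ∀ z : A ⊗[k] A, hact k H A h (LinearMap.mul' k A z) =
        LinearMap.mul' k A (tensorAct (hact k H A) (hact k H A) (comul h) z) := by
      intro z
      induction z with
      | zero => simp
      | tmul p q => exact hact_mul h p q
      | add p q hp hq => simp only [map_add, hp, hq]
    have e2 : ∀ t : H ⊗[k] H, tensorAct (hact k H A) (hact k H A)
        (TensorProduct.comm k H H t) (b ⊗ₜ a) =
        TensorProduct.comm k A A (tensorAct (hact k H A) (hact k H A) t (a ⊗ₜ b)) := by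
      intro t
      induction t with
      | zero => simp
      | tmul p q => simp
      | add p q hp hq => simp only [map_add, LinearMap.add_apply, hp, hq]
    have e3 : hact k H A h (opMul R A (a ⊗ₜ b)) =
        opMul R A (tensorAct (hact k H A) (hact k H A) (comul h) (a ⊗ₜ b)) := by
      simp only [opMul, braiding, LinearMap.comp_apply, LinearEquiv.coe_coe,
        TensorProduct.comm_tmul]
      rw [e1, ← e2, ← Module.End.mul_apply, ← map_mul, ← R.mul_comul_swap, map_mul,
        Module.End.mul_apply]
    refine Eq.trans e3 ?_
    have e4 : ∀ z : A ⊗[k] A, opMul R A z = (LinearMap.mul' k (BraidedOpp R A)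
      (show BraidedOpp R A ⊗[k] BraidedOpp R A from z)) := by
      intro z
      induction z with
      | zero => exact (map_zero _).trans (map_zero _).symm
      | tmul p q => rfl
      | add p q hp hq => exact (map_add _ _ _).trans ((congrArg₂ _ hp hq).trans (map_add _ _ _).symm)
    exact e4 _

end BraidedOpp

namespace BraidedProduct

/-- The two ways of computing the fourfold comultiplication. -/
lemma comul_four (h : H) :
    ((TensorProduct.assoc k H H H).symm.toLinearMap.lTensor H)
      (TensorProduct.assoc k H H (H ⊗[k] H) (TensorProduct.map comul comul (comul (R := k) h))) =
    ((comul (R := k) (A := H)).rTensor H).lTensor H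
      ((comul (R := k) (A := H)).lTensor H (comul h)) := by
  have e1 : ∀ t : H ⊗[k] H, TensorProduct.assoc k H H (H ⊗[k] H) (TensorProduct.map comul comul t) =
      ((comul (R := k) (A := H)).lTensor H).lTensor H
        (TensorProduct.assoc k H H H ((comul (R := k) (A := H)).rTensor H t)) := by
    intro t
    induction t with
    | zero => simp
    | add x y hx hy => simp only [map_add, hx, hy]
    | tmul x y =>
      simp only [TensorProduct.map_tmul, LinearMap.rTensor_tmul]
      generalize comul (R := k) x = s
      induction s with
      | zero => simp
      | add x y hx hy => simp only [map_add, TensorProduct.add_tmul, hx, hy]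
      | tmul x y => simp
  rw [e1, coassoc_apply]
  generalize comul (R := k) h = t
  induction t with
  | zero => simp
  | add x y hx hy => simp only [map_add, hx, hy]
  | tmul x y =>
    simp only [LinearMap.lTensor_tmul]
    congr 1
    rw [← coassoc_apply]; simp

variable (R : RMatrix k H) (A B : Type*) [Ring A] [Algebra k A] [HModuleAlgebra k H A]
  [Ring B] [Algebra k B] [HModuleAlgebra k H B]

/-- `a ⊗ (z ⊗ b) ↦ a z b`. -/
def core : A ⊗[k] ((A ⊗[k] B) ⊗[k] B) →ₗ[k] A ⊗[k] B :=
  TensorProduct.map (LinearMap.mul' k A) (LinearMap.mul' k B) ∘ₗ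
    (TensorProduct.assoc k A A (B ⊗[k] B)).symm.toLinearMap ∘ₗ
    ((TensorProduct.assoc k A B B).toLinearMap).lTensor A

lemma core_tmul (a : A) (b : B) (z : A ⊗[k] B) :
    core A B (a ⊗ₜ (z ⊗ₜ b)) = TwistedTensor.lA a (TwistedTensor.rB b z) := by
  induction z with
  | zero => simp
  | tmul x y => simp [core]
  | add x y hx hy => simp only [TensorProduct.add_tmul, TensorProduct.tmul_add, map_add, hx, hy]

/-- The braiding is `H`-linear. -/
lemma braiding_linear (h : H) (z : B ⊗[k] A) :
    braiding R (hact k H B) (hact k H A) (tensorAct (hact k H B) (hact k H A) (comul h) z) =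
      tensorAct (hact k H A) (hact k H B) (comul h)
        (braiding R (hact k H B) (hact k H A) z) := by
  have e2 : ∀ (t : H ⊗[k] H) (z : B ⊗[k] A), tensorAct (hact k H A) (hact k H B)
      (TensorProduct.comm k H H t) (TensorProduct.comm k B A z) =
      TensorProduct.comm k B A (tensorAct (hact k H B) (hact k H A) t z) := by
    intro t z
    induction t with
    | zero => simp
    | add p q hp hq => simp only [map_add, LinearMap.add_apply, hp, hq]
    | tmul p q =>
      induction z with
      | zero => simp
      | add p q hp hq => simp only [map_add, hp, hq]
      | tmul x y => simp
  simp only [braiding, LinearMap.comp_apply, LinearEquiv.coe_coe]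
  rw [← e2, ← Module.End.mul_apply, ← map_mul, R.mul_comul_swap, map_mul, Module.End.mul_apply]

/-- The diagonal action of `H` on `A ⊗ B`. -/
def diagAct : H →ₐ[k] Module.End k (A ⊗[k] B) :=
  (tensorAct (hact k H A) (hact k H B)).comp (Bialgebra.comulAlgHom k H)

lemma diagAct_apply (h : H) (z : A ⊗[k] B) :
    diagAct A B h z = tensorAct (hact k H A) (hact k H B) (comul h) z := rfl

lemma diagAct_one (h : H) : diagAct A B h (1 ⊗ₜ 1) = counit (R := k) h • (1 ⊗ₜ[k] 1) := by
  have e : ∀ t : H ⊗[k] H, tensorAct (hact k H A) (hact k H B) t (1 ⊗ₜ 1) =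
      TensorProduct.map (Algebra.linearMap k A) ((Algebra.linearMap k B) ∘ₗ counit)
        ((counit (R := k) (A := H)).rTensor H t) := by
    intro t
    induction t with
    | zero => simp
    | add p q hp hq => simp only [map_add, LinearMap.add_apply, hp, hq]
    | tmul p q => simp [hact_one]
  rw [diagAct_apply, e, rTensor_counit_comul]
  simp [Algebra.algebraMap_eq_smul_one]

lemma diagAct_twistedMul (h : H) (x y : A ⊗[k] B) :
    diagAct A B h (twistedMul (braidTwist R A B).toMap (x ⊗ₜ y)) =
      twistedMul (braidTwist R A B).toMap
        (tensorAct (diagAct A B) (diagAct A B) (comul h) (x ⊗ₜ y)) := by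
  induction x with
  | zero => simp
  | add p q hp hq => simp only [map_add, TensorProduct.add_tmul, hp, hq]
  | tmul a b =>
  induction y with
  | zero => simp
  | add p q hp hq => simp only [map_add, TensorProduct.tmul_add, hp, hq]
  | tmul a' b' =>
  set c := (braidTwist R A B).toMap with hc
  set Ψ : (H ⊗[k] H →ₗ[k] A ⊗[k] B) → (H ⊗[k] ((H ⊗[k] H) ⊗[k] H) →ₗ[k] A ⊗[k] B) := fun G =>
    core A B ∘ₗ TensorProduct.map (ev (hact k H A) a) (TensorProduct.map G (ev (hact k H B) b'))
    with hΨ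
  set μ : (H ⊗[k] H) ⊗[k] (H ⊗[k] H) →ₗ[k] H ⊗[k] ((H ⊗[k] H) ⊗[k] H) :=
    ((TensorProduct.assoc k H H H).symm.toLinearMap.lTensor H) ∘ₗ
      (TensorProduct.assoc k H H (H ⊗[k] H)).toLinearMap with hμ
  set G1 : H ⊗[k] H →ₗ[k] A ⊗[k] B := LinearMap.applyₗ (c (b ⊗ₜ a')) ∘ₗ
    (tensorAct (hact k H A) (hact k H B)).toLinearMap with hG1
  set G2 : H ⊗[k] H →ₗ[k] A ⊗[k] B :=
    c ∘ₗ TensorProduct.map (ev (hact k H B) b) (ev (hact k H A) a') with hG2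
  have hG : ∀ h : H, G1 (comul h) = G2 (comul h) := by
    intro h
    have := braiding_linear R A B h (b ⊗ₜ a')
    simp only [hG1, hG2, LinearMap.comp_apply, LinearMap.applyₗ_apply_apply]
    rw [← tensorAct_apply]
    exact this.symm
  have hΨt : ∀ (G : H ⊗[k] H →ₗ[k] A ⊗[k] B) (p q p' q' : H),
      Ψ G (μ ((p ⊗ₜ q) ⊗ₜ (p' ⊗ₜ q'))) = TwistedTensor.lA (hact k H A p a)
        (TwistedTensor.rB (hact k H B q' b') (G (q ⊗ₜ p'))) := by
    intro G p q p' q'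
    simp [hΨ, hμ, core_tmul]
  have hL : diagAct A B h (TwistedTensor.lA a (TwistedTensor.rB b' (c (b ⊗ₜ a')))) =
      Ψ G1 (μ (TensorProduct.map comul comul (comul (R := k) h))) := by
    rw [diagAct_apply]
    generalize comul (R := k) h = t
    induction t with
    | zero => simp
    | add p q hp hq => simp only [map_add, LinearMap.add_apply, hp, hq]
    | tmul x y =>
      have key : ∀ w : A ⊗[k] B, tensorAct (hact k H A) (hact k H B) (x ⊗ₜ y)
          (TwistedTensor.lA a (TwistedTensor.rB b' w)) =
          Ψ (LinearMap.applyₗ w ∘ₗ (tensorAct (hact k H A) (hact k H B)).toLinearMap)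
            (μ (comul x ⊗ₜ comul y)) := by
        intro w
        induction w with
        | zero => simp [hΨ]
        | add p q hp hq =>
          simp only [map_add, hp, hq]
          simp only [hΨ, LinearMap.add_comp, TensorProduct.map_add_left,
            TensorProduct.map_add_right, LinearMap.comp_add, LinearMap.add_apply]
        | tmul p q =>
          simp only [TwistedTensor.rB_tmul, TwistedTensor.lA_tmul, tensorAct_tmul, hact_mul']
          generalize comul (R := k) x = s1
          generalize comul (R := k) y = s2
          induction s1 with
          | zero => simp
          | add p q hp hq => simp only [map_add, TensorProduct.add_tmul, hp, hq]
          | tmul p q =>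
          induction s2 with
          | zero => simp
          | add p q hp hq => simp only [map_add, TensorProduct.tmul_add, hp, hq]
          | tmul p' q' => simp [hΨt]
      exact key _
  have hR : twistedMul c (tensorAct (diagAct A B) (diagAct A B) (comul h)
      ((a ⊗ₜ b) ⊗ₜ (a' ⊗ₜ b'))) = Ψ G2 (μ (TensorProduct.map comul comul (comul (R := k) h))) := by
    generalize comul (R := k) h = t
    induction t with
    | zero => simp
    | add p q hp hq => simp only [map_add, LinearMap.add_apply, hp, hq]
    | tmul x y =>
      simp only [tensorAct_tmul, diagAct_apply, TensorProduct.map_tmul]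
      simp only [tensorAct_apply]
      generalize comul (R := k) x = s1
      generalize comul (R := k) y = s2
      induction s1 with
      | zero => simp
      | add p q hp hq => simp only [map_add, TensorProduct.add_tmul, hp, hq]
      | tmul p q =>
      induction s2 with
      | zero => simp
      | add p q hp hq => simp only [map_add, TensorProduct.tmul_add, hp, hq]
      | tmul p' q' => simp [hΨt, TwistedTensor.twistedMul_tmul, hG2]
  rw [TwistedTensor.twistedMul_tmul, hL, hR]
  have e4 : μ (TensorProduct.map comul comul (comul (R := k) h)) =
    ((comul (R := k) (A := H)).rTensor H).lTensor H
      ((comul (R := k) (A := H)).lTensor H (comul h)) := comul_four h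
  rw [e4]
  generalize (comul (R := k) (A := H)).lTensor H (comul h) = t
  induction t with
  | zero => simp
  | add p q hp hq => simp only [map_add, hp, hq]
  | tmul x s =>
    induction s with
    | zero => simp
    | add p q hp hq => simp only [map_add, TensorProduct.tmul_add, hp, hq]
    | tmul y z => simp [hΨ, hG]

instance : HModuleAlgebra k H (BraidedProduct R A B) where
  act := show H →ₐ[k] Module.End k (BraidedProduct R A B) from diagAct A B
  act_one h := by
    rw [Algebra.algebraMap_eq_smul_one]
    exact diagAct_one A B h
  act_mul h x y := by
    refine Eq.trans (diagAct_twistedMul R A B h x y) ?_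
    generalize comul (R := k) h = t
    induction t with
    | zero => simp; rfl
    | add p q hp hq =>
      simp only [map_add, LinearMap.add_apply] at hp hq ⊢
      exact congrArg₂ _ hp hq
    | tmul p q => rfl

end BraidedProduct

section Smash

variable (k H) (A : Type*) [Ring A] [Algebra k A] [HModuleAlgebra k H A]

/-- The linear map `H ⊗ A → A ⊗ H`, `h ⊗ a ↦ ∑ (h₁ · a) ⊗ h₂`. -/
def smashMap : H ⊗[k] A →ₗ[k] A ⊗[k] H :=
  (TensorProduct.lift (hact k H A).toLinearMap).rTensor H ∘ₗ
    (TensorProduct.rightComm k H H A).toLinearMap ∘ₗ (comul (R := k) (A := H)).rTensor A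

variable {k H A} in
lemma smashMap_tmul (h : H) (a : A) :
    smashMap k H A (h ⊗ₜ a) = (ev (hact k H A) a).rTensor H (comul h) := by
  simp only [smashMap, LinearMap.comp_apply, LinearMap.rTensor_tmul]
  generalize comul (R := k) h = t
  induction t with
  | zero => simp
  | tmul x y => simp
  | add x y hx hy => simp only [map_add, TensorProduct.add_tmul, hx, hy]

variable {k H A} in
lemma smashMap_repr {ι : Type*} (h : H) (a : A) (r : Repr k h ι) :
    smashMap k H A (h ⊗ₜ a) = ∑ i ∈ r.index, hact k H A (r.left i) a ⊗ₜ r.right i := by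
  rw [smashMap_tmul, ← r.eq]; simp

/-- The twisting map `h ⊗ a ↦ ∑ (h₁ · a) ⊗ h₂` of the smash product. -/
def smashTwist : TwistingMap k A H where
  toMap := smashMap k H A
  one_left a := by simp [smashMap_tmul, Algebra.TensorProduct.one_def]
  one_right h := by
    have := congrArg ((Algebra.linearMap k A).rTensor H) (rTensor_counit_comul (R := k) h)
    rw [smashMap_tmul]
    rw [← (ℛ k h).eq] at this ⊢
    simp only [map_sum, LinearMap.rTensor_tmul, Algebra.linearMap_apply, map_one] at this
    simpa only [map_sum, LinearMap.rTensor_tmul, ev_apply, hact_one] using this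
  mul_left h h' a := by
    rw [smashMap_repr h' a (ℛ k h')]
    simp only [map_sum, TwistedTensor.passLeft_tmul, smashMap_tmul, Bialgebra.comul_mul]
    conv_lhs => rw [← (ℛ k h').eq]
    rw [Finset.mul_sum, map_sum]
    refine Finset.sum_congr rfl fun i _ => ?_
    generalize comul (R := k) h = t
    induction t with
    | zero => simp
    | tmul x y => simp
    | add x y hx hy => simp only [map_add, add_mul, hx, hy]
  mul_right h a a' := by
    have key := congrArg (TensorProduct.map (LinearMap.mul' k A ∘ₗ
      TensorProduct.map (ev (hact k H A) a) (ev (hact k H A) a')) LinearMap.id ∘ₗ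
      (TensorProduct.assoc k H H H).symm.toLinearMap) (coassoc_apply (R := k) h)
    rw [smashMap_tmul, smashMap_tmul, ← (ℛ k h).eq]
    rw [← (ℛ k h).eq] at key
    simp only [LinearMap.comp_apply, LinearEquiv.coe_coe, LinearEquiv.symm_apply_apply, map_sum,
      LinearMap.rTensor_tmul, LinearMap.lTensor_tmul, TensorProduct.map_tmul, ev_apply,
      ← hact_mul', LinearMap.id_apply] at key ⊢
    rw [key]
    refine Finset.sum_congr rfl fun i _ => ?_
    rw [TwistedTensor.passRight_tmul, smashMap_tmul]
    generalize comul (R := k) ((ℛ k h).right i) = t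
    induction t with
    | zero => simp
    | tmul x y => simp
    | add x y hx hy => simp only [map_add, TensorProduct.tmul_add, hx, hy]

/-- The smash product algebra `A # H`: the space `A ⊗ H` with multiplication
`(a ⊗ h) (a' ⊗ h') = ∑ a (h₁ · a') ⊗ h₂ h'`. -/
abbrev Smash : Type _ := TwistedTensor (smashTwist k H A)

end Smash

end HopfActions

section PBW

variable {k : Type*} [Field k]

variable (k) in
/-- An exhaustive filtration `F₀ ⊆ F₁ ⊆ ⋯` of the algebra `D` by subspaces. -/
structure AlgFiltration (D : Type*) [Ring D] [Algebra k D] where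
  F : ℕ → Submodule k D
  mono : Monotone F
  one_mem : (1 : D) ∈ F 0
  mul_mem : ∀ {m n : ℕ} {x y : D}, x ∈ F m → y ∈ F n → x * y ∈ F (m + n)
  exhaustive : ∀ x : D, ∃ n, x ∈ F n

namespace AlgFiltration

variable {D : Type*} [Ring D] [Algebra k D] (𝓕 : AlgFiltration k D)

/-- The subspace `F_{n-1}`, with `F_{-1} = 0`. -/
def prev : ℕ → Submodule k D
  | 0 => ⊥
  | n + 1 => 𝓕.F n

/-- The component `F_n / F_{n-1}` of the associated graded algebra. -/
abbrev Gr (n : ℕ) : Type _ := 𝓕.F n ⧸ (𝓕.prev n).submoduleOf (𝓕.F n)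

/-- The class in `F_n / F_{n-1}` of an element of `F_n`. -/
def cls (n : ℕ) : 𝓕.F n →ₗ[k] 𝓕.Gr n := ((𝓕.prev n).submoduleOf (𝓕.F n)).mkQ

/-- Multiplication `F_m × F_n → F_{m+n}`. -/
def mulF (m n : ℕ) : 𝓕.F m →ₗ[k] 𝓕.F n →ₗ[k] 𝓕.F (m + n) :=
  LinearMap.mk₂ k (fun x y => ⟨x * y, 𝓕.mul_mem x.2 y.2⟩)
    (fun _ _ _ => Subtype.ext (add_mul _ _ _)) (fun _ _ _ => Subtype.ext (smul_mul_assoc _ _ _))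
    (fun _ _ _ => Subtype.ext (mul_add _ _ _)) (fun _ _ _ => Subtype.ext (mul_smul_comm _ _ _))

lemma mul_mem_prev_left {m n : ℕ} {x y : D} (hx : x ∈ 𝓕.prev m) (hy : y ∈ 𝓕.F n) :
    x * y ∈ 𝓕.prev (m + n) := by
  cases m with
  | zero => rw [(Submodule.mem_bot k).1 hx, zero_mul]; exact zero_mem _
  | succ m => rw [Nat.add_right_comm]; exact 𝓕.mul_mem hx hy

lemma mul_mem_prev_right {m n : ℕ} {x y : D} (hx : x ∈ 𝓕.F m) (hy : y ∈ 𝓕.prev n) :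
    x * y ∈ 𝓕.prev (m + n) := by
  cases n with
  | zero => rw [(Submodule.mem_bot k).1 hy, mul_zero]; exact zero_mem _
  | succ n => exact 𝓕.mul_mem hx hy

/-- The multiplication `[x] [y] = [x y]` of the associated graded algebra. -/
def grMul (m n : ℕ) : 𝓕.Gr m →ₗ[k] 𝓕.Gr n →ₗ[k] 𝓕.Gr (m + n) :=
  Submodule.liftQ _
    (LinearMap.flip (Submodule.liftQ _ ((LinearMap.compr₂ (𝓕.mulF m n) (𝓕.cls (m + n))).flip)
      (fun y hy => by
        rw [LinearMap.mem_ker]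
        ext x
        exact (Submodule.Quotient.mk_eq_zero _).2 (𝓕.mul_mem_prev_right x.2 hy))))
    (fun x hx => by
      rw [LinearMap.mem_ker]
      ext y
      exact (Submodule.Quotient.mk_eq_zero _).2 (𝓕.mul_mem_prev_left hx y.2))

lemma grMul_cls (m n : ℕ) (x : 𝓕.F m) (y : 𝓕.F n) :
    𝓕.grMul m n (𝓕.cls m x) (𝓕.cls n y) =
      𝓕.cls (m + n) ⟨x * y, 𝓕.mul_mem x.2 y.2⟩ := rfl

/-- The filtered algebra `D` is a PBW deformation of the `ℕ`-graded algebra `R = ⨁ 𝓡 n`: its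
associated graded algebra `⨁ F_n / F_{n-1}` is isomorphic to `R` as an `ℕ`-graded algebra. -/
def IsPBWDeformation {R : Type*} [Ring R] [Algebra k R] (𝓡 : ℕ → Submodule k R)
    [GradedAlgebra 𝓡] : Prop :=
  ∃ φ : ∀ n, 𝓕.Gr n ≃ₗ[k] 𝓡 n,
    (φ 0 (𝓕.cls 0 ⟨1, 𝓕.one_mem⟩) : R) = 1 ∧
    ∀ (m n : ℕ) (x : 𝓕.Gr m) (y : 𝓕.Gr n),
      (φ (m + n) (𝓕.grMul m n x y) : R) = (φ m x : R) * (φ n y : R)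

end AlgFiltration

end PBW

section Gradings

open Coalgebra

variable {k : Type*} [Field k]

/-- The subspace `P ⊗ Q` of `M ⊗ N`. -/
abbrev tensorSub {M N : Type*} [AddCommGroup M] [Module k M] [AddCommGroup N] [Module k N]
    (P : Submodule k M) (Q : Submodule k N) : Submodule k (M ⊗[k] N) :=
  Submodule.map₂ (TensorProduct.mk k M N) P Q

/-- The total grading on a tensor product of graded spaces. -/
def totalGrading {M N : Type*} [AddCommGroup M] [Module k M] [AddCommGroup N] [Module k N]
    (𝓜 : ℕ → Submodule k M) (𝓝 : ℕ → Submodule k N) (n : ℕ) : Submodule k (M ⊗[k] N) :=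
  ⨆ (p : ℕ × ℕ) (_ : p.1 + p.2 = n), tensorSub (𝓜 p.1) (𝓝 p.2)

section internal

variable {M N : Type*} [AddCommGroup M] [Module k M] [AddCommGroup N] [Module k N]

lemma isInternal_of_coaction (𝓜 : ℕ → Submodule k M) (δ : M →ₗ[k] (ℕ →₀ M))
    (hδ : ∀ n, ∀ m ∈ 𝓜 n, δ m = Finsupp.single n m) (htop : ⨆ n, 𝓜 n = ⊤) :
    DirectSum.IsInternal 𝓜 := by
  rw [DirectSum.isInternal_submodule_iff_iSupIndep_and_iSup_eq_top]
  refine ⟨?_, htop⟩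
  apply iSupIndep_of_dfinsupp_lsum_injective
  rw [injective_iff_map_eq_zero]
  intro f hf
  have key : ∀ (f : Π₀ n, 𝓜 n) (n : ℕ),
      δ (DFinsupp.lsum ℕ (fun i => (𝓜 i).subtype) f) n = (f n : M) := by
    intro f n
    induction f using DFinsupp.induction with
    | h0 => simp
    | ha i b f _ _ ih =>
      rw [map_add, map_add, Finsupp.add_apply, ih]
      simp only [DFinsupp.lsum_single, Submodule.subtype_apply, DFinsupp.add_apply,
        Submodule.coe_add, add_left_inj]
      rw [hδ i b b.2, Finsupp.single_apply, DFinsupp.single_apply]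
      split_ifs with h
      · subst h; rfl
      · rfl
  ext n
  rw [← key f n, hf]; simp

lemma exists_coaction (𝓜 : ℕ → Submodule k M) (h : DirectSum.IsInternal 𝓜) :
    ∃ δ : M →ₗ[k] (ℕ →₀ M), ∀ n, ∀ m ∈ 𝓜 n, δ m = Finsupp.single n m := by
  let e := LinearEquiv.ofBijective (DirectSum.coeLinearMap 𝓜) h
  refine ⟨DirectSum.toModule k ℕ (ℕ →₀ M)
    (fun n => Finsupp.lsingle n ∘ₗ (𝓜 n).subtype) ∘ₗ e.symm.toLinearMap, fun n m hm => ?_⟩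
  have : e.symm m = DirectSum.lof k ℕ (fun i => 𝓜 i) n ⟨m, hm⟩ := by
    rw [LinearEquiv.symm_apply_eq]
    exact (DirectSum.coeLinearMap_lof 𝓜 n ⟨m, hm⟩).symm
  simp [this]

lemma totalGrading_isInternal (𝓜 : ℕ → Submodule k M) (𝓝 : ℕ → Submodule k N)
    (hM : DirectSum.IsInternal 𝓜) (hN : DirectSum.IsInternal 𝓝) :
    DirectSum.IsInternal (totalGrading 𝓜 𝓝) := by
  obtain ⟨δ, hδ⟩ := exists_coaction 𝓜 hM
  obtain ⟨ε, hε⟩ := exists_coaction 𝓝 hN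
  refine isInternal_of_coaction _ ((Finsupp.lmapDomain (M ⊗[k] N) k (fun p : ℕ × ℕ => p.1 + p.2)) ∘ₗ
    (finsuppTensorFinsupp k k M N ℕ ℕ).toLinearMap ∘ₗ TensorProduct.map δ ε) ?_ ?_
  · intro n z hz
    have : totalGrading 𝓜 𝓝 n ≤ LinearMap.eqLocus ((Finsupp.lmapDomain (M ⊗[k] N) k
      (fun p : ℕ × ℕ => p.1 + p.2)) ∘ₗ (finsuppTensorFinsupp k k M N ℕ ℕ).toLinearMap ∘ₗ
      TensorProduct.map δ ε) (Finsupp.lsingle n) := by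
      refine iSup_le fun p => iSup_le fun hp => Submodule.map₂_le.2 fun x hx y hy => ?_
      rw [LinearMap.mem_eqLocus]
      simp [hδ _ x hx, hε _ y hy, hp]
    exact this hz
  · rw [eq_top_iff, ← TensorProduct.map₂_mk_top_top_eq_top]
    have hM' := hM.submodule_iSup_eq_top
    have hN' := hN.submodule_iSup_eq_top
    rw [← hM', ← hN', Submodule.map₂_iSup_left]
    refine iSup_le fun i => ?_
    rw [Submodule.map₂_iSup_right]
    refine iSup_le fun j => ?_
    exact (le_iSup₂ (f := fun (p : ℕ × ℕ) (_ : p.1 + p.2 = i + j) =>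
      tensorSub (𝓜 p.1) (𝓝 p.2)) (i, j) rfl).trans (le_iSup (totalGrading 𝓜 𝓝) (i + j))

lemma tensorTop_isInternal (𝓜 : ℕ → Submodule k M) (hM : DirectSum.IsInternal 𝓜) :
    DirectSum.IsInternal (fun n => tensorSub (𝓜 n) (⊤ : Submodule k N)) := by
  obtain ⟨δ, hδ⟩ := exists_coaction 𝓜 hM
  refine isInternal_of_coaction _ ((TensorProduct.finsuppLeft k k M N ℕ).toLinearMap ∘ₗ
    δ.rTensor N) ?_ ?_
  · intro n z hz
    have : tensorSub (𝓜 n) (⊤ : Submodule k N) ≤ LinearMap.eqLocus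
      ((TensorProduct.finsuppLeft k k M N ℕ).toLinearMap ∘ₗ δ.rTensor N) (Finsupp.lsingle n) := by
      refine Submodule.map₂_le.2 fun x hx y _ => ?_
      rw [LinearMap.mem_eqLocus]
      simp only [LinearMap.comp_apply, TensorProduct.mk_apply, LinearMap.rTensor_tmul, hδ _ x hx,
        LinearEquiv.coe_coe, Finsupp.lsingle_apply]
      ext i
      simp [TensorProduct.finsuppLeft_apply_tmul_apply, Finsupp.single_apply]
      split_ifs <;> simp
    exact this hz
  · rw [eq_top_iff, ← TensorProduct.map₂_mk_top_top_eq_top, ← hM.submodule_iSup_eq_top,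
      Submodule.map₂_iSup_left]

end internal

variable {H : Type*} [Ring H] [Bialgebra k H]

variable (k H) in
/-- A family of subspaces of an `H`-module algebra that contains `1` in degree `0`, is
multiplicative and is preserved by the action of `H`. -/
structure IsHMultiplicative {A : Type*} [Ring A] [Algebra k A] [HModuleAlgebra k H A]
    (𝓐 : ℕ → Submodule k A) : Prop where
  one_mem : (1 : A) ∈ 𝓐 0
  mul_mem : ∀ {m n : ℕ} {x y : A}, x ∈ 𝓐 m → y ∈ 𝓐 n → x * y ∈ 𝓐 (m + n)
  act_mem : ∀ (h : H) {n : ℕ} {x : A}, x ∈ 𝓐 n → hact k H A h x ∈ 𝓐 n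

lemma tensorAct_mem {M N : Type*} [AddCommGroup M] [Module k M] [AddCommGroup N] [Module k N]
    (ρ : H →ₐ[k] Module.End k M) (σ : H →ₐ[k] Module.End k N) {P : Submodule k M}
    {Q : Submodule k N} (hP : ∀ h, ∀ m ∈ P, ρ h m ∈ P) (hQ : ∀ h, ∀ n ∈ Q, σ h n ∈ Q)
    (t : H ⊗[k] H) {z : M ⊗[k] N} (hz : z ∈ tensorSub P Q) : tensorAct ρ σ t z ∈ tensorSub P Q := by
  suffices h : tensorSub P Q ≤ (tensorSub P Q).comap (tensorAct ρ σ t) from h hz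
  refine Submodule.map₂_le.2 fun m hm n hn => ?_
  rw [Submodule.mem_comap, TensorProduct.mk_apply]
  induction t with
  | zero => simp
  | add x y hx hy => rw [map_add, LinearMap.add_apply]; exact add_mem hx hy
  | tmul x y => exact Submodule.apply_mem_map₂ _ (hP _ _ hm) (hQ _ _ hn)

section

variable (R : RMatrix k H) {A B : Type*} [Ring A] [Algebra k A] [HModuleAlgebra k H A]
  [Ring B] [Algebra k B] [HModuleAlgebra k H B]
  {𝓐 : ℕ → Submodule k A} {𝓑 : ℕ → Submodule k B}

lemma braiding_mem (hA : IsHMultiplicative k H 𝓐) (hB : IsHMultiplicative k H 𝓑) {i j : ℕ}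
    {b : B} {a : A} (hb : b ∈ 𝓑 j) (ha : a ∈ 𝓐 i) :
    braiding R (hact k H B) (hact k H A) (b ⊗ₜ a) ∈ tensorSub (𝓐 i) (𝓑 j) :=
  tensorAct_mem _ _ (fun h _ hm => hA.act_mem h hm) (fun h _ hm => hB.act_mem h hm) _
    (Submodule.apply_mem_map₂ (TensorProduct.mk k A B) ha hb)

/-- The grading of `A^{op_c}` that it has as a vector space. -/
def oppGrading (𝓐 : ℕ → Submodule k A) (n : ℕ) : Submodule k (BraidedOpp R A) :=
  (𝓐 n).map (BraidedOpp.of R A).toLinearMap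

lemma oppGrading_isHMultiplicative (hA : IsHMultiplicative k H 𝓐) :
    IsHMultiplicative k H (oppGrading R 𝓐) where
  one_mem := ⟨1, hA.one_mem, rfl⟩
  mul_mem := by
    rintro m n _ _ ⟨a, ha, rfl⟩ ⟨b, hb, rfl⟩
    have h1 := braiding_mem R hA hA ha hb
    have h2 : tensorSub (𝓐 n) (𝓐 m) ≤ (𝓐 (m + n)).comap (LinearMap.mul' k A) :=
      Submodule.map₂_le.2 fun x hx y hy => by
        rw [add_comm]; exact hA.mul_mem hx hy
    exact ⟨_, h2 h1, rfl⟩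
  act_mem := by
    rintro h n _ ⟨a, ha, rfl⟩
    exact ⟨_, hA.act_mem h ha, rfl⟩

lemma oppGrading_isInternal (hA : DirectSum.IsInternal 𝓐) :
    DirectSum.IsInternal (oppGrading R 𝓐) := by
  have e : oppGrading R 𝓐 = 𝓐 := by
    funext n
    exact Submodule.map_id _
  exact (congrArg DirectSum.IsInternal e).mpr hA

/-- The total grading of `A ⊗^c B`. -/
def braidedGrading (𝓐 : ℕ → Submodule k A) (𝓑 : ℕ → Submodule k B) (n : ℕ) :
    Submodule k (BraidedProduct R A B) :=
  (totalGrading 𝓐 𝓑 n).map (TwistedTensor.of (braidTwist R A B)).toLinearMap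

lemma braidedGrading_isInternal (hA : DirectSum.IsInternal 𝓐) (hB : DirectSum.IsInternal 𝓑) :
    DirectSum.IsInternal (braidedGrading R 𝓐 𝓑) := by
  have e : braidedGrading R 𝓐 𝓑 = totalGrading 𝓐 𝓑 := by
    funext n
    exact Submodule.map_id _
  exact (congrArg DirectSum.IsInternal e).mpr (totalGrading_isInternal 𝓐 𝓑 hA hB)

lemma tensorSub_le_totalGrading (i j : ℕ) : tensorSub (𝓐 i) (𝓑 j) ≤ totalGrading 𝓐 𝓑 (i + j) :=
  le_iSup₂ (f := fun (p : ℕ × ℕ) (_ : p.1 + p.2 = i + j) => tensorSub (𝓐 p.1) (𝓑 p.2)) (i, j) rfl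

lemma twistedMul_mem (τ : TwistingMap k A B) {i j i' j' : ℕ}
    (hA : ∀ {m n : ℕ} {x y : A}, x ∈ 𝓐 m → y ∈ 𝓐 n → x * y ∈ 𝓐 (m + n))
    (hB : ∀ {m n : ℕ} {x y : B}, x ∈ 𝓑 m → y ∈ 𝓑 n → x * y ∈ 𝓑 (m + n))
    (hτ : ∀ b ∈ 𝓑 j, ∀ a ∈ 𝓐 i', τ.toMap (b ⊗ₜ a) ∈ tensorSub (𝓐 i') (𝓑 j))
    {z w : A ⊗[k] B} (hz : z ∈ tensorSub (𝓐 i) (𝓑 j)) (hw : w ∈ tensorSub (𝓐 i') (𝓑 j')) :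
    twistedMul τ.toMap (z ⊗ₜ w) ∈ tensorSub (𝓐 (i + i')) (𝓑 (j + j')) := by
  suffices h : tensorSub (𝓐 i) (𝓑 j) ≤ (tensorSub (𝓐 (i + i')) (𝓑 (j + j'))).comap
      (twistedMul τ.toMap ∘ₗ (TensorProduct.mk k _ _).flip w) from h hz
  refine Submodule.map₂_le.2 fun a ha b hb => ?_
  suffices h : tensorSub (𝓐 i') (𝓑 j') ≤ (tensorSub (𝓐 (i + i')) (𝓑 (j + j'))).comap
      (twistedMul τ.toMap ∘ₗ TensorProduct.mk k _ _ (a ⊗ₜ b)) from h hw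
  refine Submodule.map₂_le.2 fun a' ha' b' hb' => ?_
  simp only [Submodule.mem_comap, LinearMap.comp_apply, TensorProduct.mk_apply,
    TwistedTensor.twistedMul_tmul]
  have h1 : tensorSub (𝓐 i') (𝓑 j) ≤ (tensorSub (𝓐 (i + i')) (𝓑 (j + j'))).comap
      (TwistedTensor.lA a ∘ₗ TwistedTensor.rB b') := by
    refine Submodule.map₂_le.2 fun p hp q hq => ?_
    simp only [Submodule.mem_comap, LinearMap.comp_apply, TensorProduct.mk_apply,
      TwistedTensor.rB_tmul, TwistedTensor.lA_tmul]
    exact Submodule.apply_mem_map₂ (TensorProduct.mk k A B) (hA ha hp) (hB hq hb')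
  exact h1 (hτ b hb a' ha')

lemma braidedGrading_isHMultiplicative (hA : IsHMultiplicative k H 𝓐)
    (hB : IsHMultiplicative k H 𝓑) : IsHMultiplicative k H (braidedGrading R 𝓐 𝓑) where
  one_mem := ⟨1 ⊗ₜ 1, tensorSub_le_totalGrading 0 0
    (Submodule.apply_mem_map₂ (TensorProduct.mk k A B) hA.one_mem hB.one_mem), rfl⟩
  mul_mem := by
    rintro m n _ _ ⟨z, hz, rfl⟩ ⟨w, hw, rfl⟩
    refine ⟨twistedMul (braidTwist R A B).toMap (z ⊗ₜ w), ?_, rfl⟩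
    suffices h : totalGrading 𝓐 𝓑 m ≤ (totalGrading 𝓐 𝓑 (m + n)).comap
      (twistedMul (braidTwist R A B).toMap ∘ₗ (TensorProduct.mk k _ _).flip w) from h hz
    refine iSup_le fun p => iSup_le fun hp => ?_
    intro z hz
    suffices h : totalGrading 𝓐 𝓑 n ≤ (totalGrading 𝓐 𝓑 (m + n)).comap
      (twistedMul (braidTwist R A B).toMap ∘ₗ TensorProduct.mk k _ _ z) from h hw
    refine iSup_le fun q => iSup_le fun hq => ?_
    intro w hw
    have h1 := twistedMul_mem (braidTwist R A B) hA.mul_mem hB.mul_mem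
      (fun b hb a ha => braiding_mem R hA hB hb ha) hz hw
    have h2 := tensorSub_le_totalGrading _ _ h1
    have e : p.1 + q.1 + (p.2 + q.2) = m + n := by omega
    rw [e] at h2
    exact h2
  act_mem := by
    rintro h n _ ⟨z, hz, rfl⟩
    refine ⟨BraidedProduct.diagAct A B h z, ?_, rfl⟩
    suffices hh : totalGrading 𝓐 𝓑 n ≤ (totalGrading 𝓐 𝓑 n).comap
      (BraidedProduct.diagAct A B h) from hh hz
    refine iSup_le fun p => iSup_le fun hp => ?_
    intro w hw
    subst hp
    exact tensorSub_le_totalGrading _ _ (tensorAct_mem _ _ (fun h _ hm => hA.act_mem h hm)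
      (fun h _ hm => hB.act_mem h hm) _ hw)

variable (k H) in
/-- The grading `n ↦ A_n ⊗ H` of the smash product `A # H`, with `H` in degree `0`. -/
def smashGrading (𝓐 : ℕ → Submodule k A) (n : ℕ) : Submodule k (Smash k H A) :=
  (tensorSub (𝓐 n) (⊤ : Submodule k H)).map (TwistedTensor.of (smashTwist k H A)).toLinearMap

lemma smashGrading_isInternal (hA : DirectSum.IsInternal 𝓐) :
    DirectSum.IsInternal (smashGrading k H 𝓐) := by
  have e : smashGrading k H 𝓐 = fun n => tensorSub (𝓐 n) (⊤ : Submodule k H) := by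
    funext n
    exact Submodule.map_id _
  exact (congrArg DirectSum.IsInternal e).mpr (tensorTop_isInternal 𝓐 hA)

lemma smashMap_mem (hA : IsHMultiplicative k H 𝓐) {n : ℕ} (h : H) {a : A} (ha : a ∈ 𝓐 n) :
    smashMap k H A (h ⊗ₜ a) ∈ tensorSub (𝓐 n) (⊤ : Submodule k H) := by
  rw [smashMap_repr h a (ℛ k h)]
  exact sum_mem fun i _ => Submodule.apply_mem_map₂ (TensorProduct.mk k A H)
    (hA.act_mem _ ha) Submodule.mem_top

lemma smashGrading_one_mem (hA : IsHMultiplicative k H 𝓐) :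
    (1 : Smash k H A) ∈ smashGrading k H 𝓐 0 :=
  ⟨1 ⊗ₜ 1, Submodule.apply_mem_map₂ (TensorProduct.mk k A H) hA.one_mem Submodule.mem_top, rfl⟩

lemma smashGrading_mul_mem (hA : IsHMultiplicative k H 𝓐) {m n : ℕ} {x y : Smash k H A}
    (hx : x ∈ smashGrading k H 𝓐 m) (hy : y ∈ smashGrading k H 𝓐 n) :
    x * y ∈ smashGrading k H 𝓐 (m + n) := by
  obtain ⟨z, hz, rfl⟩ := hx
  obtain ⟨w, hw, rfl⟩ := hy
  exact ⟨_, twistedMul_mem (𝓑 := fun _ => ⊤) (j := 0) (j' := 0) (smashTwist k H A) hA.mul_mem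
    (fun _ _ => Submodule.mem_top) (fun b _ a ha => smashMap_mem hA b ha) hz hw, rfl⟩

/-- The grading of the smash product makes it a graded algebra. -/
@[reducible] def smashGradedAlgebra (hA : IsHMultiplicative k H 𝓐) (hi : DirectSum.IsInternal 𝓐) :
    GradedAlgebra (smashGrading k H 𝓐) :=
  { (smashGrading_isInternal hi).chooseDecomposition with
    one_mem := smashGrading_one_mem hA
    mul_mem := fun _ _ _ _ hx hy => smashGrading_mul_mem hA hx hy }

end

end Gradings

set_option linter.unusedSimpArgs false

section Sweedler

open Coalgebra

/-- The Sweedler algebra `T(2)` with basis `1, g, x, gx` and relations `g² = 1`, `x² = 0`,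
`gx + xg = 0`. As an algebra it is the quaternion algebra with `i² = 1`, `j² = 0`, `ij = -ji`, where
`g = i`, `x = j` and `gx = ij`. -/
abbrev Sweedler (k : Type*) [Field k] : Type _ := QuaternionAlgebra k 1 0 0

namespace Sweedler

variable {k : Type*} [Field k]

variable (k) in
/-- The generator `g`. -/
def g : Sweedler k := ⟨0, 1, 0, 0⟩
variable (k) in
/-- The generator `x`. -/
def x : Sweedler k := ⟨0, 0, 1, 0⟩

@[simp] lemma g_mul_g : g k * g k = 1 := by ext <;> simp [g]
@[simp] lemma x_mul_x : x k * x k = 0 := by ext <;> simp [x]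
lemma x_mul_g : x k * g k = -(g k * x k) := by ext <;> simp [x, g]
@[simp] lemma g_mul_g_mul (a : Sweedler k) : g k * (g k * a) = a := by
  rw [← mul_assoc, g_mul_g, one_mul]
@[simp] lemma x_mul_g_mul_x : x k * (g k * x k) = 0 := by
  rw [← mul_assoc, x_mul_g, neg_mul, mul_assoc, x_mul_x, mul_zero, neg_zero]

lemma eq_comb (h : Sweedler k) :
    h = h.re • 1 + h.imI • g k + h.imJ • x k + h.imK • (g k * x k) := by
  ext <;> simp [g, x]

/-- The universal property of the presentation of `T(2)`. -/
def lift {A : Type*} [Ring A] [Algebra k A] (G X : A) (hG : G * G = 1) (hX : X * X = 0)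
    (hGX : G * X + X * G = 0) : Sweedler k →ₐ[k] A :=
  QuaternionAlgebra.lift
    { i := G, j := X, k := G * X
      i_mul_i := by simp [hG]
      j_mul_j := by simp [hX]
      i_mul_j := rfl
      j_mul_i := by rw [zero_smul, zero_sub]; exact eq_neg_of_add_eq_zero_right hGX }

section lift
variable {A : Type*} [Ring A] [Algebra k A] {G X : A} (hG : G * G = 1) (hX : X * X = 0)
  (hGX : G * X + X * G = 0)

@[simp] lemma lift_g : lift (k := k) G X hG hX hGX (g k) = G := by
  simp [lift, g, QuaternionAlgebra.lift, QuaternionAlgebra.Basis.lift]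
@[simp] lemma lift_x : lift (k := k) G X hG hX hGX (x k) = X := by
  simp [lift, x, QuaternionAlgebra.lift, QuaternionAlgebra.Basis.lift]

end lift

lemma algHom_ext {A : Type*} [Ring A] [Algebra k A] {f f' : Sweedler k →ₐ[k] A}
    (hg : f (g k) = f' (g k)) (hx : f (x k) = f' (x k)) : f = f' := by
  refine AlgHom.ext fun h => ?_
  rw [eq_comb h]
  simp [hg, hx]

variable (k) in
/-- The comultiplication: `Δ(g) = g ⊗ g`, `Δ(x) = x ⊗ 1 + g ⊗ x`. -/
def comulHom : Sweedler k →ₐ[k] Sweedler k ⊗[k] Sweedler k :=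
  lift (g k ⊗ₜ g k) (x k ⊗ₜ 1 + g k ⊗ₜ x k) (by simp [Algebra.TensorProduct.one_def])
    (by simp [add_mul, mul_add, x_mul_g, TensorProduct.neg_tmul])
    (by simp [add_mul, mul_add, x_mul_g, TensorProduct.neg_tmul, TensorProduct.tmul_neg]; abel)

variable (k) in
/-- The counit: `ε(g) = 1`, `ε(x) = 0`. -/
def counitHom : Sweedler k →ₐ[k] k := lift 1 0 (by simp) (by simp) (by simp)

@[simp] lemma comulHom_g : comulHom k (g k) = g k ⊗ₜ g k := lift_g _ _ _
@[simp] lemma comulHom_x : comulHom k (x k) = x k ⊗ₜ 1 + g k ⊗ₜ x k := lift_x _ _ _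
@[simp] lemma counitHom_g : counitHom k (g k) = 1 := lift_g _ _ _
@[simp] lemma counitHom_x : counitHom k (x k) = 0 := lift_x _ _ _

instance : Bialgebra k (Sweedler k) :=
  Bialgebra.ofAlgHom (comulHom k) (counitHom k)
    (algHom_ext (by simp) (by simp [TensorProduct.add_tmul, TensorProduct.tmul_add, add_assoc,
      Algebra.TensorProduct.one_def]))
    (algHom_ext (by simp) (by simp))
    (algHom_ext (by simp) (by simp))

@[simp] lemma comul_g : comul (R := k) (g k) = g k ⊗ₜ g k := comulHom_g
@[simp] lemma comul_x : comul (R := k) (x k) = x k ⊗ₜ 1 + g k ⊗ₜ x k := comulHom_x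
@[simp] lemma counit_g : counit (R := k) (g k) = 1 := counitHom_g
@[simp] lemma counit_x : counit (R := k) (x k) = 0 := counitHom_x

variable (k) in
/-- The antipode: `S(1) = 1`, `S(g) = g`, `S(x) = -gx`, `S(gx) = x`. -/
def antipodeMap : Sweedler k →ₗ[k] Sweedler k where
  toFun h := ⟨h.re, h.imI, h.imK, -h.imJ⟩
  map_add' a b := by ext <;> simp [add_comm]
  map_smul' c a := by ext <;> simp

@[simp] lemma antipode_one : antipodeMap k 1 = 1 := by ext <;> simp [antipodeMap]
@[simp] lemma antipode_g : antipodeMap k (g k) = g k := by ext <;> simp [antipodeMap, g]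
@[simp] lemma antipode_x : antipodeMap k (x k) = -(g k * x k) := by
  ext <;> simp [antipodeMap, g, x]
@[simp] lemma antipode_gx : antipodeMap k (g k * x k) = x k := by
  ext <;> simp [antipodeMap, g, x]

lemma linearMap_ext {M : Type*} [AddCommGroup M] [Module k M] {f f' : Sweedler k →ₗ[k] M}
    (h1 : f 1 = f' 1) (hg : f (g k) = f' (g k)) (hx : f (x k) = f' (x k))
    (hgx : f (g k * x k) = f' (g k * x k)) : f = f' := by
  ext h
  rw [eq_comb h]
  simp only [map_add, map_smul, h1, hg, hx, hgx]

instance : HopfAlgebra k (Sweedler k) where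
  antipode := antipodeMap k
  mul_antipode_rTensor_comul := by
    apply linearMap_ext <;>
      simp [Algebra.TensorProduct.one_def, mul_add, mul_assoc, x_mul_g]
  mul_antipode_lTensor_comul := by
    apply linearMap_ext <;>
      simp [Algebra.TensorProduct.one_def, mul_add, mul_assoc, x_mul_g]

/-- The element `½ (1 ⊗ 1 + 1 ⊗ g + g ⊗ 1 - g ⊗ g) + ½ λ (x ⊗ x + x ⊗ gx + gx ⊗ gx - gx ⊗ x)`. -/
def rElem (lam : k) : Sweedler k ⊗[k] Sweedler k :=
  (2 : k)⁻¹ • (1 ⊗ₜ 1 + 1 ⊗ₜ g k + g k ⊗ₜ 1 - g k ⊗ₜ g k) +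
    (lam / 2) • (x k ⊗ₜ x k + x k ⊗ₜ (g k * x k) + (g k * x k) ⊗ₜ (g k * x k) -
      (g k * x k) ⊗ₜ x k)

/-- `R_λ` with its tensor factors exchanged is inverse to `R_λ`. -/
lemma rElem_mul_swap (h2 : (2 : k) ≠ 0) (lam : k) :
    rElem lam * TensorProduct.comm k _ _ (rElem lam) = 1 ∧
    TensorProduct.comm k _ _ (rElem lam) * rElem lam = 1 := by
  constructor <;>
  · simp only [rElem, map_add, map_sub, map_smul, TensorProduct.comm_tmul, mul_add, add_mul, mul_sub,
      sub_mul, smul_mul_assoc, mul_smul_comm, Algebra.TensorProduct.tmul_mul_tmul, one_mul, mul_one,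
      mul_assoc, g_mul_g, x_mul_x, x_mul_g, g_mul_g_mul, x_mul_g_mul_x, mul_neg,
      neg_mul, mul_zero, TensorProduct.neg_tmul, TensorProduct.tmul_neg, TensorProduct.zero_tmul,
      TensorProduct.tmul_zero, Algebra.TensorProduct.one_def]
    match_scalars <;> field_simp <;> ring

/-- The universal `R`-matrix `R_λ` of `T(2)`. -/
def rMatrix [NeZero (2 : k)] (lam : k) : RMatrix k (Sweedler k) where
  val := rElem lam
  val_isUnit := ⟨⟨_, _, (rElem_mul_swap (NeZero.ne _) lam).1,
    (rElem_mul_swap (NeZero.ne _) lam).2⟩, rfl⟩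
  mul_comul_swap h := by
    have : LinearMap.mulLeft k (rElem lam) ∘ₗ (TensorProduct.comm k _ _).toLinearMap ∘ₗ comul =
        LinearMap.mulRight k (rElem lam) ∘ₗ comul := by
      apply linearMap_ext <;>
      · simp only [LinearMap.comp_apply, LinearEquiv.coe_coe, LinearMap.mulLeft_apply,
          LinearMap.mulRight_apply, comul_g, comul_x, Bialgebra.comul_mul, Bialgebra.comul_one,
          Algebra.TensorProduct.one_def, TensorProduct.comm_tmul,
          rElem, map_add, map_sub, map_smul, mul_add, add_mul, mul_sub,
          sub_mul, smul_mul_assoc, mul_smul_comm, Algebra.TensorProduct.tmul_mul_tmul, one_mul,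
          mul_one, mul_assoc, g_mul_g, x_mul_x, x_mul_g, g_mul_g_mul, x_mul_g_mul_x, mul_neg,
          neg_mul, mul_zero, TensorProduct.neg_tmul, TensorProduct.tmul_neg,
          TensorProduct.zero_tmul, TensorProduct.tmul_zero] <;> module
    exact congrArg (fun f => f h) this
  hexagon_right := by
    have h2 : (2 : k) ≠ 0 := NeZero.ne _
    simp only [rElem, map_add, map_sub, map_smul, LinearMap.lTensor_tmul, comul_g, comul_x,
      Bialgebra.comul_mul, Bialgebra.comul_one, Algebra.TensorProduct.map_tmul,
      Algebra.TensorProduct.includeLeft_apply, Algebra.TensorProduct.includeRight_apply,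
      AlgHom.coe_id, id_eq, Algebra.TensorProduct.one_def, mul_add, add_mul, mul_sub,
      sub_mul, smul_mul_assoc, mul_smul_comm, Algebra.TensorProduct.tmul_mul_tmul, one_mul,
      mul_one, mul_assoc, g_mul_g, x_mul_x, x_mul_g, g_mul_g_mul, x_mul_g_mul_x, mul_neg,
      neg_mul, mul_zero, TensorProduct.neg_tmul, TensorProduct.tmul_neg,
      TensorProduct.zero_tmul, TensorProduct.tmul_zero, TensorProduct.tmul_add,
      TensorProduct.add_tmul]
    match_scalars <;> field_simp <;> ring
  hexagon_left := by
    have h2 : (2 : k) ≠ 0 := NeZero.ne _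
    simp only [rElem, map_add, map_sub, map_smul, LinearMap.rTensor_tmul, comul_g, comul_x,
      Bialgebra.comul_mul, Bialgebra.comul_one, Algebra.TensorProduct.map_tmul,
      Algebra.TensorProduct.includeLeft_apply, Algebra.TensorProduct.includeRight_apply,
      AlgHom.coe_id, id_eq, Algebra.TensorProduct.one_def, mul_add, add_mul, mul_sub,
      sub_mul, smul_mul_assoc, mul_smul_comm, Algebra.TensorProduct.tmul_mul_tmul, one_mul,
      mul_one, mul_assoc, g_mul_g, x_mul_x, x_mul_g, g_mul_g_mul, x_mul_g_mul_x, mul_neg,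
      neg_mul, mul_zero, TensorProduct.neg_tmul, TensorProduct.tmul_neg,
      TensorProduct.zero_tmul, TensorProduct.tmul_zero, TensorProduct.tmul_add,
      TensorProduct.add_tmul, TensorProduct.assoc_tmul]
    match_scalars <;> field_simp <;> ring

end Sweedler
end Sweedler

section SweedlerActions

open Coalgebra Sweedler

variable {k : Type*} [Field k]

/-- A `T(2)`-module algebra structure, from the actions `G` of `g` and `X` of `x`: `G` is an algebra
endomorphism, `X (a b) = X(a) b + G(a) X(b)`, and the relations of `T(2)` hold. -/
@[reducible] def sweedlerModuleAlgebra {A : Type*} [Ring A] [Algebra k A] (G : A →ₐ[k] A)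
    (X : A →ₗ[k] A) (hG : ∀ a, G (G a) = a) (hX : ∀ a, X (X a) = 0)
    (hGX : ∀ a, G (X a) + X (G a) = 0) (hmul : ∀ a b, X (a * b) = X a * b + G a * X b) :
    HModuleAlgebra k (Sweedler k) A where
  act := Sweedler.lift (A := Module.End k A) G.toLinearMap X (LinearMap.ext hG) (LinearMap.ext hX)
    (LinearMap.ext hGX)
  act_one h := by
    have X1 : X 1 = 0 := by simpa using hmul 1 1
    rw [eq_comb h]
    simp [X1, Algebra.algebraMap_eq_smul_one, add_smul]
  act_mul h a b := by
    rw [eq_comb h]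
    simp [hmul, tensorAct_apply, ev, Algebra.TensorProduct.one_def]

section Plane

open MvPolynomial

variable (k) in
/-- The polynomial algebra `k[u,v]`, with `u = X 0` and `v = X 1`. -/
abbrev Plane : Type _ := MvPolynomial (Fin 2) k

variable (k) in
/-- The action of `g` on `k[u,v]`: the algebra map with `u ↦ u`, `v ↦ -v`. -/
def planeG : Plane k →ₐ[k] Plane k := aeval ![X 0, -X 1]

variable (k) in
/-- The action of `x` on `k[u,v]`: the linear map with `uᵃ vᵇ ↦ uᵃ⁺¹ vᵇ⁻¹` for odd `b` and
`uᵃ vᵇ ↦ 0` for even `b`; it is the only one with `u ↦ 0`, `v ↦ u` and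
`x (p q) = (x p) q + (g p) (x q)`. -/
def planeX : Plane k →ₗ[k] Plane k :=
  (basisMonomials (Fin 2) k).constr k
    (fun m => if Odd (m 1) then X 0 ^ (m 0 + 1) * X 1 ^ (m 1 - 1) else 0)

lemma monomial_eq_pow (m : Fin 2 →₀ ℕ) :
    monomial m (1 : k) = X 0 ^ m 0 * X 1 ^ m 1 := by
  rw [monomial_eq, Finsupp.prod_fintype _ _ (by simp)]
  simp

lemma planeX_pow (a b : ℕ) : planeX k (X 0 ^ a * X 1 ^ b) =
    if Odd b then X 0 ^ (a + 1) * X 1 ^ (b - 1) else 0 := by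
  set m : Fin 2 →₀ ℕ := Finsupp.equivFunOnFinite.symm ![a, b] with hm
  have h0 : m 0 = a := by simp [hm]
  have h1 : m 1 = b := by simp [hm]
  have := (basisMonomials (Fin 2) k).constr_basis k
    (fun m => if Odd (m 1) then (X 0 ^ (m 0 + 1) * X 1 ^ (m 1 - 1) : Plane k) else 0) m
  rw [coe_basisMonomials] at this
  simp only [monomial_eq_pow, h0, h1] at this
  exact this

lemma planeG_pow (a b : ℕ) : planeG k (X 0 ^ a * X 1 ^ b) = (-1) ^ b * (X 0 ^ a * X 1 ^ b) := by
  simp only [planeG, map_mul, map_pow, aeval_X, Matrix.cons_val_zero, Matrix.cons_val_one,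
    neg_pow (X 1 : Plane k)]
  ring

lemma plane_ext {M : Type*} [AddCommGroup M] [Module k M] {f f' : Plane k →ₗ[k] M}
    (h : ∀ a b, f (X 0 ^ a * X 1 ^ b) = f' (X 0 ^ a * X 1 ^ b)) : f = f' := by
  apply (basisMonomials (Fin 2) k).ext
  intro m
  rw [coe_basisMonomials]
  simp only [monomial_eq_pow, h]

lemma planeG_planeG (p : Plane k) : planeG k (planeG k p) = p := by
  have : (planeG k).comp (planeG k) = AlgHom.id k _ := by
    ext i
    fin_cases i <;> simp [planeG]
  exact congrArg (fun f => f p) this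

lemma planeX_planeX (p : Plane k) : planeX k (planeX k p) = 0 := by
  have : planeX k ∘ₗ planeX k = 0 := by
    apply plane_ext
    intro a b
    rw [LinearMap.comp_apply, planeX_pow]
    split_ifs with h
    · rw [planeX_pow, if_neg]
      · rfl
      · rw [Nat.not_odd_iff_even]; exact h.tsub_odd odd_one
    · simp
  exact congrArg (fun f => f p) this

lemma planeG_planeX (p : Plane k) : planeG k (planeX k p) + planeX k (planeG k p) = 0 := by
  have : (planeG k).toLinearMap ∘ₗ planeX k + planeX k ∘ₗ (planeG k).toLinearMap = 0 := by
    apply plane_ext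
    intro a b
    have e : ∀ (c : ℕ) (q : Plane k), planeX k ((-1) ^ c * q) = (-1) ^ c * planeX k q := by
      intro c q
      rcases neg_one_pow_eq_or (Plane k) c with h | h <;> simp [h]
    simp only [LinearMap.add_apply, LinearMap.comp_apply, AlgHom.toLinearMap_apply,
      LinearMap.zero_apply, planeG_pow, e, planeX_pow]
    split_ifs with h
    · obtain ⟨c, rfl⟩ := h
      rw [planeG_pow]
      simp [pow_succ]
    · simp
  exact congrArg (fun f => f p) this

lemma planeX_mul (p q : Plane k) :
    planeX k (p * q) = planeX k p * q + planeG k p * planeX k q := by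
  have : (LinearMap.mul k (Plane k)).compr₂ (planeX k) =
      (LinearMap.mul k (Plane k)) ∘ₗ (planeX k) +
        ((LinearMap.mul k (Plane k)) ∘ₗ (planeG k).toLinearMap).compl₂ (planeX k) := by
    apply plane_ext
    intro a b
    apply plane_ext
    intro a' b'
    have e : (X 0 ^ a * X 1 ^ b * (X 0 ^ a' * X 1 ^ b') : Plane k) =
      X 0 ^ (a + a') * X 1 ^ (b + b') := by ring
    simp only [LinearMap.compr₂_apply, LinearMap.mul_apply', LinearMap.add_apply,
      LinearMap.comp_apply, LinearMap.compl₂_apply, AlgHom.toLinearMap_apply, e, planeX_pow,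
      planeG_pow]
    rcases Nat.even_or_odd b with hb | hb <;> rcases Nat.even_or_odd b' with hb' | hb'
    · have h1 := hb.add hb'
      simp only [Nat.not_odd_iff_even.2 hb, Nat.not_odd_iff_even.2 hb',
        Nat.not_odd_iff_even.2 h1]
      simp
    · have h1 := hb.add_odd hb'
      simp only [Nat.not_odd_iff_even.2 hb, hb', h1, hb.neg_one_pow]
      obtain ⟨c, rfl⟩ := hb'
      simp only [if_true, if_false, ← add_assoc, Nat.add_sub_cancel]
      ring
    · have h1 := hb.add_even hb'
      simp only [Nat.not_odd_iff_even.2 hb', hb, h1]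
      obtain ⟨c, rfl⟩ := hb
      have : 2 * c + 1 + b' - 1 = 2 * c + b' := by omega
      simp only [if_true, if_false, this, Nat.add_sub_cancel]
      ring
    · have h1 := hb.add_odd hb'
      simp only [Nat.not_odd_iff_even.2 h1, hb, hb', hb.neg_one_pow]
      obtain ⟨c, rfl⟩ := hb
      obtain ⟨d, rfl⟩ := hb'
      simp only [if_true, if_false, Nat.add_sub_cancel]
      ring
  exact congrArg (fun f => f p q) this

/-- The action of `T(2)` on `k[u,v]` with `g u = u`, `g v = -v`, `x u = 0`, `x v = u`. -/
instance : HModuleAlgebra k (Sweedler k) (Plane k) :=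
  sweedlerModuleAlgebra (planeG k) (planeX k) planeG_planeG planeX_planeX planeG_planeX planeX_mul

lemma plane_g (p : Plane k) : hact k (Sweedler k) (Plane k) (g k) p = planeG k p :=
  congrArg (fun f : Module.End k (Plane k) => f p)
    (lift_g (LinearMap.ext planeG_planeG) (LinearMap.ext planeX_planeX)
      (LinearMap.ext planeG_planeX))
lemma plane_x (p : Plane k) : hact k (Sweedler k) (Plane k) (Sweedler.x k) p = planeX k p :=
  congrArg (fun f : Module.End k (Plane k) => f p)
    (lift_x (LinearMap.ext planeG_planeG) (LinearMap.ext planeX_planeX)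
      (LinearMap.ext planeG_planeX))

lemma plane_g_u : hact k (Sweedler k) (Plane k) (g k) (X 0) = X 0 := by simp [plane_g, planeG]
lemma plane_g_v : hact k (Sweedler k) (Plane k) (g k) (X 1) = -X 1 := by simp [plane_g, planeG]
lemma plane_x_u : hact k (Sweedler k) (Plane k) (Sweedler.x k) (X 0) = 0 := by
  rw [plane_x]; simpa using planeX_pow (k := k) 1 0
lemma plane_x_v : hact k (Sweedler k) (Plane k) (Sweedler.x k) (X 1) = X 0 := by
  rw [plane_x]; simpa using planeX_pow (k := k) 0 1

end Plane

section Free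

open FreeAlgebra (ι)

variable (k) in
/-- The free algebra `k⟨u,v,u',v'⟩`, with generators `u, v, u', v'` in this order. -/
abbrev Free4 : Type _ := FreeAlgebra k (Fin 4)

variable (k) in
/-- The action of `g` on `k⟨u,v,u',v'⟩`: the algebra map that fixes `u, u'` and negates `v, v'`. -/
def freeG : Free4 k →ₐ[k] Free4 k := FreeAlgebra.lift k ![ι k 0, -ι k 1, ι k 2, -ι k 3]

variable (k) in
/-- The algebra map `a ↦ (g a, x a; 0, a)` to matrices, where `x` kills `u, u'` and sends `v, v'` to
`u, u'`: it is multiplicative if and only if `x (a b) = (x a) b + (g a) (x b)`. -/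
def freeMat : Free4 k →ₐ[k] Matrix (Fin 2) (Fin 2) (Free4 k) :=
  FreeAlgebra.lift k ![!![ι k 0, 0; 0, ι k 0], !![-ι k 1, ι k 0; 0, ι k 1],
    !![ι k 2, 0; 0, ι k 2], !![-ι k 3, ι k 2; 0, ι k 3]]

variable (k) in
/-- The action of `x` on `k⟨u,v,u',v'⟩`: the linear map with `u, u' ↦ 0`, `v ↦ u`, `v' ↦ u'` and
`x (a b) = (x a) b + (g a) (x b)`. -/
def freeX : Free4 k →ₗ[k] Free4 k where
  toFun a := freeMat k a 0 1
  map_add' a b := by simp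
  map_smul' c a := by simp

lemma freeMat_apply (a : Free4 k) : freeMat k a = !![freeG k a, freeX k a; 0, a] := by
  have h : freeMat k a 0 0 = freeG k a ∧ freeMat k a 1 0 = 0 ∧ freeMat k a 1 1 = a := by
    induction a using FreeAlgebra.induction with
    | grade0 r => simp [Matrix.algebraMap_matrix_apply]
    | grade1 i => fin_cases i <;> simp [freeMat, freeG]
    | mul a b ha hb => simp [Matrix.mul_apply, ha, hb]
    | add a b ha hb => simp [ha, hb]
  ext i j
  fin_cases i <;> fin_cases j <;> simp [h, freeX]

@[simp] lemma freeX_mul (a b : Free4 k) :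
    freeX k (a * b) = freeX k a * b + freeG k a * freeX k b := by
  have : freeMat k (a * b) 0 1 = (freeMat k a * freeMat k b) 0 1 := by rw [map_mul]
  simp only [freeMat_apply, Matrix.mul_apply] at this
  simpa [add_comm] using this

@[simp] lemma freeX_algebraMap (r : k) : freeX k (algebraMap k _ r) = 0 := by
  simp [freeX, Matrix.algebraMap_matrix_apply]

@[simp] lemma freeX_ι (i : Fin 4) : freeX k (ι k i) = ![0, ι k 0, 0, ι k 2] i := by
  fin_cases i <;> simp [freeX, freeMat]

@[simp] lemma freeG_ι (i : Fin 4) : freeG k (ι k i) = ![ι k 0, -ι k 1, ι k 2, -ι k 3] i := by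
  simp [freeG]

lemma freeG_freeG (a : Free4 k) : freeG k (freeG k a) = a := by
  have : (freeG k).comp (freeG k) = AlgHom.id k _ := by
    ext i
    fin_cases i <;> simp
  exact congrArg (fun f => f a) this

lemma freeG_freeX (a : Free4 k) : freeG k (freeX k a) + freeX k (freeG k a) = 0 := by
  induction a using FreeAlgebra.induction with
  | grade0 r => simp
  | grade1 i => fin_cases i <;> simp
  | mul a b ha hb =>
    rw [add_eq_zero_iff_eq_neg] at ha hb
    simp [ha, hb, freeG_freeG]
    abel
  | add a b ha hb =>
    rw [add_eq_zero_iff_eq_neg] at ha hb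
    simp [ha, hb]
    abel

lemma freeX_freeX (a : Free4 k) : freeX k (freeX k a) = 0 := by
  induction a using FreeAlgebra.induction with
  | grade0 r => simp
  | grade1 i => fin_cases i <;> simp
  | mul a b ha hb =>
    have := freeG_freeX a
    rw [add_eq_zero_iff_eq_neg] at this
    simp [ha, hb, this]
  | add a b ha hb => simp [ha, hb]

/-- The action of `T(2)` on `k⟨u,v,u',v'⟩ = T(V ⊕ V')` induced by its action on `V` and `V'`:
`g u = u`, `g v = -v`, `x u = 0`, `x v = u`, and the same for `u', v'`. -/
instance : HModuleAlgebra k (Sweedler k) (Free4 k) :=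
  sweedlerModuleAlgebra (freeG k) (freeX k) freeG_freeG freeX_freeX freeG_freeX freeX_mul

lemma free_g (a : Free4 k) : hact k (Sweedler k) (Free4 k) (g k) a = freeG k a :=
  congrArg (fun f : Module.End k (Free4 k) => f a)
    (lift_g (LinearMap.ext freeG_freeG) (LinearMap.ext freeX_freeX) (LinearMap.ext freeG_freeX))
lemma free_x (a : Free4 k) : hact k (Sweedler k) (Free4 k) (Sweedler.x k) a = freeX k a :=
  congrArg (fun f : Module.End k (Free4 k) => f a)
    (lift_x (LinearMap.ext freeG_freeG) (LinearMap.ext freeX_freeX) (LinearMap.ext freeG_freeX))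

end Free

end SweedlerActions

section Deformations

open Coalgebra Sweedler MvPolynomial

variable {k : Type*} [Field k]

variable (k) in
/-- The grading of `k[u,v]` by degree. -/
def planeGrading (n : ℕ) : Submodule k (Plane k) := homogeneousSubmodule (Fin 2) k n

lemma act_mem_of_generators {A : Type*} [Ring A] [Algebra k A] [HModuleAlgebra k (Sweedler k) A]
    {P : Submodule k A} (hg : ∀ a ∈ P, hact k (Sweedler k) A (g k) a ∈ P)
    (hx : ∀ a ∈ P, hact k (Sweedler k) A (Sweedler.x k) a ∈ P) (h : Sweedler k) {a : A}
    (ha : a ∈ P) : hact k (Sweedler k) A h a ∈ P := by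
  rw [eq_comb h]
  simp only [map_add, map_smul, map_mul, map_one, LinearMap.add_apply, LinearMap.smul_apply,
    Module.End.mul_apply, Module.End.one_apply]
  exact add_mem (add_mem (add_mem (P.smul_mem _ ha) (P.smul_mem _ (hg _ ha)))
    (P.smul_mem _ (hx _ ha))) (P.smul_mem _ (hg _ (hx _ ha)))

lemma planeGrading_eq_span (n : ℕ) : planeGrading k n =
    Submodule.span k {p | ∃ a b : ℕ, a + b = n ∧ p = X 0 ^ a * X 1 ^ b} := by
  apply le_antisymm
  · intro p hp
    rw [p.as_sum]
    refine Submodule.sum_mem _ fun d hd => ?_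
    have hdeg : d.degree = n := by
      rw [Finsupp.degree_eq_weight_one]
      exact hp (mem_support_iff.1 hd)
    rw [monomial_eq, MvPolynomial.C_mul']
    refine Submodule.smul_mem _ _ (Submodule.subset_span ⟨d 0, d 1, ?_, ?_⟩)
    · rw [← hdeg, Finsupp.degree_eq_sum, Fin.sum_univ_two]
    · rw [Finsupp.prod_fintype _ _ (fun i => pow_zero _), Fin.prod_univ_two]
  · refine Submodule.span_le.2 ?_
    rintro _ ⟨a, b, rfl, rfl⟩
    exact (isHomogeneous_X_pow _ _).mul (isHomogeneous_X_pow _ _)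

lemma planeGrading_isHMultiplicative : IsHMultiplicative k (Sweedler k) (planeGrading k) where
  one_mem := isHomogeneous_one _ _
  mul_mem hx hy := IsHomogeneous.mul hx hy
  act_mem h n p hp := by
    refine act_mem_of_generators (P := planeGrading k n) ?_ ?_ h hp
    · intro p hp
      rw [plane_g]
      have : planeGrading k n ≤ (planeGrading k n).comap (planeG k).toLinearMap := by
        conv_lhs => rw [planeGrading_eq_span]
        refine Submodule.span_le.2 ?_
        rintro _ ⟨a, b, hab, rfl⟩
        rw [SetLike.mem_coe, Submodule.mem_comap, AlgHom.toLinearMap_apply, planeG_pow]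
        have : (X 0 ^ a * X 1 ^ b : Plane k) ∈ planeGrading k n := by
          rw [planeGrading_eq_span]; exact Submodule.subset_span ⟨a, b, hab, rfl⟩
        rcases neg_one_pow_eq_or (Plane k) b with h | h
        · simpa [h] using this
        · simpa [h] using this
      exact this hp
    · intro p hp
      rw [plane_x]
      have : planeGrading k n ≤ (planeGrading k n).comap (planeX k) := by
        conv_lhs => rw [planeGrading_eq_span]
        refine Submodule.span_le.2 ?_
        rintro _ ⟨a, b, hab, rfl⟩
        rw [SetLike.mem_coe, Submodule.mem_comap, planeX_pow]
        split_ifs with hb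
        · rw [planeGrading_eq_span]
          refine Submodule.subset_span ⟨a + 1, b - 1, ?_, rfl⟩
          have := hb.pos
          omega
        · exact zero_mem _
      exact this hp

lemma planeGrading_isInternal : DirectSum.IsInternal (planeGrading k) :=
  letI := MvPolynomial.gradedAlgebra (R := k) (σ := Fin 2)
  DirectSum.Decomposition.isInternal (homogeneousSubmodule (Fin 2) k)

section Double

variable [NeZero (2 : k)] (lam : k)

/-- The braided-opposite algebra `A^{op_c}` of `A = k[u,v]`, for the braiding given by `R_λ`. -/
abbrev PlaneOpp : Type _ := BraidedOpp (rMatrix lam) (Plane k)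

/-- The braided product `A ⊗^c A^{op_c}` for `A = k[u,v]` and the braiding given by `R_λ`. -/
abbrev Double : Type _ := BraidedProduct (rMatrix lam) (Plane k) (PlaneOpp lam)

/-- The images of the generators `u, v, u', v'` in `A ⊗^c A^{op_c}`: they are `u ⊗ 1`, `v ⊗ 1`,
`1 ⊗ u` and `1 ⊗ v`. -/
def doubleGen : Fin 4 → Double lam :=
  ![TwistedTensor.of _ (X 0 ⊗ₜ 1), TwistedTensor.of _ (X 1 ⊗ₜ 1),
    TwistedTensor.of _ (1 ⊗ₜ BraidedOpp.of _ _ (X 0)),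
    TwistedTensor.of _ (1 ⊗ₜ BraidedOpp.of _ _ (X 1))]

/-- The grading of `A ⊗^c A^{op_c}` by total degree. -/
def doubleGrading : ℕ → Submodule k (Double lam) :=
  braidedGrading (rMatrix lam) (planeGrading k) (oppGrading (rMatrix lam) (planeGrading k))

/-- The grading of `(A ⊗^c A^{op_c}) # T(2)`, with `T(2)` in degree `0`. -/
def doubleSmashGrading : ℕ → Submodule k (Smash k (Sweedler k) (Double lam)) :=
  smashGrading k (Sweedler k) (doubleGrading lam)

instance : GradedAlgebra (doubleSmashGrading lam) :=
  smashGradedAlgebra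
    (braidedGrading_isHMultiplicative _ planeGrading_isHMultiplicative
      (oppGrading_isHMultiplicative _ planeGrading_isHMultiplicative))
    (braidedGrading_isInternal _ planeGrading_isInternal
      (oppGrading_isInternal _ planeGrading_isInternal))

end Double

/-- The relations `r₁, …, r₆` (here `rel lam 0, …, rel lam 5`), in the free algebra. -/
def rel (lam : k) : Fin 6 → Free4 k :=
  let u := FreeAlgebra.ι k 0
  let v := FreeAlgebra.ι k 1
  let u' := FreeAlgebra.ι k 2
  let v' := FreeAlgebra.ι k 3
  ![u * v - v * u,
    u' * v' - v' * u',
    u * v' - v' * u,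
    v * v' + v' * v - lam • (u * u'),
    u * u' - u' * u,
    v * u' - u' * v]

/-- The space `I` spanned by the relations `r₁, …, r₆`. -/
def relSpace (lam : k) : Submodule k (Free4 k) := Submodule.span k (Set.range (rel lam))

/-- The relation `rᵢ` as an element of `I`. -/
def relElem (lam : k) (i : Fin 6) : relSpace lam := ⟨rel lam i, Submodule.subset_span ⟨i, rfl⟩⟩

variable (k) in
/-- The grading of `k⟨u,v,u',v'⟩` by length of words. -/
def freeGrading (n : ℕ) : Submodule k (Free4 k) :=
  Submodule.span k (Set.range (FreeAlgebra.ι k)) ^ n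

lemma freeGrading_isHMultiplicative : IsHMultiplicative k (Sweedler k) (freeGrading k) where
  one_mem := by rw [freeGrading, pow_zero]; exact Submodule.one_le.1 le_rfl
  mul_mem hx hy := by rw [freeGrading, pow_add]; exact Submodule.mul_mem_mul hx hy
  act_mem h n a ha := by
    have hV : ∀ i, FreeAlgebra.ι k i ∈ Submodule.span k (Set.range (FreeAlgebra.ι k (X := Fin 4))) :=
      fun i => Submodule.subset_span ⟨i, rfl⟩
    have key : ∀ n : ℕ, freeGrading k n ≤ (freeGrading k n).comap (freeG k).toLinearMap ∧
        freeGrading k n ≤ (freeGrading k n).comap (freeX k) := by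
      intro n
      induction n with
      | zero =>
        simp only [freeGrading, pow_zero]
        constructor <;>
        · intro a ha
          obtain ⟨c, rfl⟩ := Submodule.mem_one.1 ha
          simp
      | succ n ih =>
        simp only [freeGrading, pow_succ] at ih ⊢
        constructor <;> refine Submodule.mul_le.2 fun a ha b hb => ?_
        · refine Submodule.span_induction ?_ ?_ ?_ ?_ hb
          · rintro _ ⟨i, rfl⟩
            rw [Submodule.mem_comap, AlgHom.toLinearMap_apply, map_mul]
            refine Submodule.mul_mem_mul (ih.1 ha) ?_
            fin_cases i <;> simp [hV]
          · simp
          · intro x y _ _ hx hy; rw [mul_add]; exact add_mem hx hy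
          · intro c x _ hx; rw [mul_smul_comm]; exact Submodule.smul_mem _ _ hx
        · refine Submodule.span_induction ?_ ?_ ?_ ?_ hb
          · rintro _ ⟨i, rfl⟩
            rw [Submodule.mem_comap, freeX_mul]
            refine add_mem (Submodule.mul_mem_mul (ih.2 ha) (hV i))
              (Submodule.mul_mem_mul (ih.1 ha) ?_)
            fin_cases i <;> simp [hV]
          · simp
          · intro x y _ _ hx hy; rw [mul_add]; exact add_mem hx hy
          · intro c x _ hx; rw [mul_smul_comm]; exact Submodule.smul_mem _ _ hx
    refine act_mem_of_generators (P := freeGrading k n) ?_ ?_ h ha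
    · intro a ha; rw [free_g]; exact (key n).1 ha
    · intro a ha; rw [free_x]; exact (key n).2 ha

lemma freeGrading_iSup : ⨆ n, freeGrading k n = ⊤ := by
  rw [eq_top_iff]
  intro a _
  have hle : ∀ n, freeGrading k n ≤ ⨆ n, freeGrading k n := le_iSup (freeGrading k)
  induction a using FreeAlgebra.induction with
  | grade0 r =>
    refine hle 0 ?_
    rw [freeGrading, pow_zero]; exact Submodule.algebraMap_mem r
  | grade1 i =>
    refine hle 1 ?_
    rw [freeGrading, pow_one]; exact Submodule.subset_span ⟨i, rfl⟩
  | mul a b ha hb =>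
    have ha := ha trivial
    have hb := hb trivial
    refine Submodule.iSup_induction _ (motive := fun a => a * b ∈ ⨆ n, freeGrading k n) ha ?_
      (by simp) (fun x y hx hy => by rw [add_mul]; exact add_mem hx hy)
    intro m a ha
    refine Submodule.iSup_induction _ (motive := fun b => a * b ∈ ⨆ n, freeGrading k n) hb ?_
      (by simp) (fun x y hx hy => by rw [mul_add]; exact add_mem hx hy)
    intro n b hb
    exact hle (m + n) (freeGrading_isHMultiplicative.mul_mem ha hb)
  | add a b ha hb => exact add_mem (ha trivial) (hb trivial)

variable (k) in
/-- The smash product `k⟨u,v,u',v'⟩ # T(2)`. -/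
abbrev FreeSmash : Type _ := Smash k (Sweedler k) (Free4 k)

/-- The algebra `k⟨u,v,u',v'⟩ # T(2)` modulo the two-sided ideal generated by the elements
`r - κ(r)` for `r ∈ I`, where `κ : I → T(2)` is linear. -/
abbrev Deformation (lam : k) (κ : relSpace lam →ₗ[k] Sweedler k) : Type _ :=
  RingQuot fun a b : FreeSmash k => ∃ r : relSpace lam,
    a = TwistedTensor.of _ ((r : Free4 k) ⊗ₜ 1) ∧ b = TwistedTensor.of _ (1 ⊗ₜ κ r)

/-- The quotient map. -/
def toDeformation (lam : k) (κ : relSpace lam →ₗ[k] Sweedler k) :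
    FreeSmash k →ₐ[k] Deformation lam κ :=
  RingQuot.mkAlgHom k _

variable (k) in
/-- The elements of degree at most `n` in `k⟨u,v,u',v'⟩ # T(2)`, with `T(2)` in degree `0`. -/
def freeSmashFil (n : ℕ) : Submodule k (FreeSmash k) :=
  ⨆ (m : ℕ) (_ : m ≤ n), smashGrading k (Sweedler k) (freeGrading k) m

lemma smashGrading_le_fil {m n : ℕ} (h : m ≤ n) :
    smashGrading k (Sweedler k) (freeGrading k) m ≤ freeSmashFil k n :=
  le_iSup₂ (f := fun (m : ℕ) (_ : m ≤ n) => smashGrading k (Sweedler k) (freeGrading k) m) m h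

lemma freeSmashFil_mono : Monotone (freeSmashFil k) := fun _ _ h =>
  iSup₂_le fun _ hi => smashGrading_le_fil (hi.trans h)

lemma freeSmashFil_mul {m n : ℕ} {x y : FreeSmash k} (hx : x ∈ freeSmashFil k m)
    (hy : y ∈ freeSmashFil k n) : x * y ∈ freeSmashFil k (m + n) := by
  suffices h : freeSmashFil k m * freeSmashFil k n ≤ freeSmashFil k (m + n) from
    h (Submodule.mul_mem_mul hx hy)
  simp only [freeSmashFil, Submodule.iSup_mul, Submodule.mul_iSup]
  refine iSup₂_le fun i hi => iSup₂_le fun j hj => ?_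
  refine Submodule.mul_le.2 fun a ha b hb => ?_
  exact smashGrading_le_fil (add_le_add (by assumption) (by assumption))
    (smashGrading_mul_mem freeGrading_isHMultiplicative ha hb)

lemma freeSmashFil_exhaustive (x : FreeSmash k) : ∃ n, x ∈ freeSmashFil k n := by
  have htop : ⨆ n, freeSmashFil k n = ⊤ := by
    rw [eq_top_iff]
    intro z _
    obtain ⟨z, rfl⟩ := (TwistedTensor.of (smashTwist k (Sweedler k) (Free4 k))).surjective z
    have h1 : z ∈ ⨆ n, tensorSub (freeGrading k n) (⊤ : Submodule k (Sweedler k)) := by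
      rw [← Submodule.map₂_iSup_left, freeGrading_iSup, TensorProduct.map₂_mk_top_top_eq_top]
      trivial
    suffices h : (⨆ n, tensorSub (freeGrading k n) (⊤ : Submodule k (Sweedler k))) ≤
        (⨆ n, freeSmashFil k n).comap
          (TwistedTensor.of (smashTwist k (Sweedler k) (Free4 k))).toLinearMap from h h1
    refine iSup_le fun n w hw => ?_
    exact (le_iSup (freeSmashFil k) n) (smashGrading_le_fil le_rfl ⟨w, hw, rfl⟩)
  have : x ∈ ⨆ n, freeSmashFil k n := by rw [htop]; trivial
  exact (Submodule.mem_iSup_of_directed _ freeSmashFil_mono.directed_le).1 this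

/-- The filtration of the deformation by degree, with `T(2)` in degree `0`: `F_n` is the image of the
elements of degree at most `n` in `k⟨u,v,u',v'⟩ # T(2)`. -/
def deformationFiltration (lam : k) (κ : relSpace lam →ₗ[k] Sweedler k) :
    AlgFiltration k (Deformation lam κ) where
  F n := (freeSmashFil k n).map (toDeformation lam κ).toLinearMap
  mono _ _ h := Submodule.map_mono (freeSmashFil_mono h)
  one_mem := ⟨1, smashGrading_le_fil le_rfl (smashGrading_one_mem freeGrading_isHMultiplicative),
    map_one (toDeformation lam κ)⟩
  mul_mem := by
    rintro m n _ _ ⟨x, hx, rfl⟩ ⟨y, hy, rfl⟩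
    exact ⟨x * y, freeSmashFil_mul hx hy, map_mul (toDeformation lam κ) x y⟩
  exhaustive x := by
    obtain ⟨x, rfl⟩ := RingQuot.mkAlgHom_surjective k _ x
    obtain ⟨n, hn⟩ := freeSmashFil_exhaustive x
    exact ⟨n, x, hn, rfl⟩

end Deformations

end SweedlerPBW

end

/-! Write B = A ⊗^c A^{op_c} and T = T(2). Everything rests on the ordered monomials uᵃvᵇu'ᶜv'ᵈ.

They are a basis of B. In such a product no factor crosses another, so it suffices that the
monomials uᵃvᵇ formed with the product of A^{op_c} are a basis of that space. Let θ (`oppEnd`) be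
the endomorphism of k[u,v] that sends uᵃvᵇ to the monomial formed in A^{op_c}. Multiplying twice by
v in A^{op_c} is ordinary multiplication by λu² - v². So θ is u-linear, fixes 1 and v, and satisfies
θ(v²p) = (λu² - v²)θ(p). The substitution v² ↦ λu² - v² undoes itself, hence θ² = id. Conversely,
r₁, …, r₆ reorder every word into ordered monomials (`lift_mem_monomialSpan_sup`). This is proved
with error spaces Eₙ, so that it serves twice: with Eₙ = 0 it gives the presentation of B, and with
Eₙ = Fₙ₋₁ it controls the deformations.

Suppose κ(r₄) = α and the other values vanish. The deformation then acts on B # T: all generators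
act by left multiplication, except that v' acts by left multiplication plus αδ. Here δ is the skew
derivative in v on the first factor, with uᵃvᵇ ↦ uᵃvᵇ⁻¹ for odd b and 0 for even b. It commutes with
u and u', anticommutes with g and x, and satisfies vδ + δv = 1, so exactly r₄ changes, by α. Since δ
lowers degree, a homogeneous z of degree n sends 1 to its image in B # T plus terms of lower degree.
So if z becomes an element of Fₙ₋₁ in the deformation, its image in B # T is zero. The converse
follows by straightening z into normal words, which are independent in B # T. Thus Fₙ/Fₙ₋₁ and the
degree n part of B # T are the same quotient of the degree n part of k⟨u,v,u',v'⟩ # T.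

Suppose the deformation is PBW. A dimension count in degrees 0 and 1 shows that T embeds and that
the generators are right independent over T (`IsPBWDeformation.eq_zero_of_mem_prev`). Commuting g
and x past the relations determines the parity of each κ(rᵢ) under conjugation by g, gives κ(r₅) =
0, and ties κ(r₄) to κ(r₃) - κ(r₆). Expanding [u, r₄] and [u', r₄] through the other relations gives
two identities of degree one, and independence forces κ(r₁) = κ(r₂) = κ(r₃) = κ(r₆) = 0. Then κ(r₄)
commutes with g and x, so it is a scalar (`relation_values_of_independent`).

For the parametrization it is enough that the word vv' occurs in r₄ and in no other relation. -/

noncomputable section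

namespace SweedlerPBW

/-! ### Factors of a twisted tensor product and its universal property -/

namespace TwistedTensor

variable {k A B C : Type*} [Field k] [Ring A] [Algebra k A] [Ring B] [Algebra k B]
  [Ring C] [Algebra k C] (τ : TwistingMap k A B)

/-- The inclusion `a ↦ a ⊗ 1` of the first factor. -/
def inl : A →ₐ[k] TwistedTensor τ :=
  AlgHom.ofLinearMap ((of τ).toLinearMap ∘ₗ (TensorProduct.mk k A B).flip 1) rfl fun a a' => by
    simp [of_mul_of, τ.one_left]

/-- The inclusion `b ↦ 1 ⊗ b` of the second factor. -/
def inr : B →ₐ[k] TwistedTensor τ :=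
  AlgHom.ofLinearMap ((of τ).toLinearMap ∘ₗ TensorProduct.mk k A B 1) rfl fun b b' => by
    simp [of_mul_of, τ.one_right]

lemma inl_apply (a : A) : inl τ a = of τ (a ⊗ₜ 1) := rfl
lemma inr_apply (b : B) : inr τ b = of τ (1 ⊗ₜ b) := rfl

lemma inl_mul_of (a : A) (z : A ⊗[k] B) : inl τ a * of τ z = of τ (lA a z) := by
  induction z with
  | zero => simp
  | add x y hx hy => simp only [map_add, mul_add, hx, hy]
  | tmul p q => simp [inl_apply, of_mul_of, τ.one_left]

lemma inl_mul_inr (a : A) (b : B) : inl τ a * inr τ b = of τ (a ⊗ₜ b) := by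
  rw [inr_apply, inl_mul_of]; simp

lemma inr_mul_inl (a : A) (b : B) : inr τ b * inl τ a = of τ (τ.toMap (b ⊗ₜ a)) := by
  rw [inr_apply, inl_apply, of_mul_of]
  generalize τ.toMap (b ⊗ₜ a) = w
  congr 1
  induction w with
  | zero => simp
  | tmul x y => simp
  | add x y hx hy => simp only [map_add, hx, hy]

/-- Algebra maps out of a twisted tensor product. -/
def lift (f : A →ₐ[k] C) (h : B →ₐ[k] C)
    (hfh : ∀ b a, h b * f a =
      LinearMap.mul' k C (TensorProduct.map f.toLinearMap h.toLinearMap (τ.toMap (b ⊗ₜ a)))) :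
    TwistedTensor τ →ₐ[k] C :=
  AlgHom.ofLinearMap ((LinearMap.mul' k C ∘ₗ TensorProduct.map f.toLinearMap h.toLinearMap) ∘ₗ
      (of τ).symm.toLinearMap)
    (by simp [one_def]) fun x y => by
    induction x using ind with
    | h0 => simp
    | ha x y hx hy => simp only [add_mul, map_add, hx, hy]
    | ht a b =>
    induction y using ind with
    | h0 => simp
    | ha x y hx hy => simp only [mul_add, map_add, hx, hy]
    | ht a' b' =>
    have key : ∀ w : A ⊗[k] B, LinearMap.mul' k C
        (TensorProduct.map f.toLinearMap h.toLinearMap (lA a (rB b' w))) =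
        f a * LinearMap.mul' k C (TensorProduct.map f.toLinearMap h.toLinearMap w) * h b' := by
      intro w
      induction w with
      | zero => simp
      | tmul x y => simp [mul_assoc]
      | add x y hx hy => simp only [map_add, mul_add, add_mul, hx, hy]
    rw [of_mul_of]
    simp only [LinearMap.comp_apply, LinearEquiv.coe_coe, LinearEquiv.symm_apply_apply, key, ← hfh]
    simp [mul_assoc]

@[simp] lemma lift_of (f : A →ₐ[k] C) (h : B →ₐ[k] C) (hfh) (a : A) (b : B) :
    lift τ f h hfh (of τ (a ⊗ₜ b)) = f a * h b := by
  simp [lift]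

end TwistedTensor

/-! ### Smash products with T(2) -/

section Sweedler

open Coalgebra Sweedler

variable {k : Type*} [Field k]

section

variable {A : Type*} [Ring A] [Algebra k A] [HModuleAlgebra k (Sweedler k) A]

lemma hact_g_one : hact k (Sweedler k) A (g k) 1 = 1 := by simp [hact_one]
lemma hact_x_one : hact k (Sweedler k) A (x k) 1 = 0 := by simp [hact_one]

lemma smashMap_one_tmul (a : A) : smashMap k (Sweedler k) A (1 ⊗ₜ a) = a ⊗ₜ 1 :=
  (smashTwist k (Sweedler k) A).one_left a

lemma smashMap_g (a : A) : smashMap k (Sweedler k) A (g k ⊗ₜ a) =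
    hact k (Sweedler k) A (g k) a ⊗ₜ g k := by
  rw [smashMap_tmul, comul_g]; simp

lemma smashMap_x (a : A) : smashMap k (Sweedler k) A (x k ⊗ₜ a) =
    hact k (Sweedler k) A (x k) a ⊗ₜ 1 + hact k (Sweedler k) A (g k) a ⊗ₜ x k := by
  rw [smashMap_tmul, comul_x]; simp

lemma hact_g_g (a : A) :
    hact k (Sweedler k) A (g k) (hact k (Sweedler k) A (g k) a) = a := by
  rw [← Module.End.mul_apply, ← map_mul, g_mul_g]; simp

/-- Because g² = 1, Δ(gx) = gx ⊗ g + 1 ⊗ gx; this is why `a` itself appears in the second term. -/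
lemma smashMap_gx (a : A) : smashMap k (Sweedler k) A ((g k * x k) ⊗ₜ a) =
    hact k (Sweedler k) A (g k) (hact k (Sweedler k) A (x k) a) ⊗ₜ g k + a ⊗ₜ (g k * x k) := by
  rw [smashMap_tmul, Bialgebra.comul_mul, comul_g, comul_x]
  simp [mul_add]

end

section

variable {A C : Type*} [Ring A] [Algebra k A] [HModuleAlgebra k (Sweedler k) A] [Ring C]
  [Algebra k C]

/-- Algebra maps out of a smash product `A # T(2)`: it is enough to control the commutation
relations of `g` and `x` with `A`. -/
def smashLift (f : A →ₐ[k] C) (h : Sweedler k →ₐ[k] C)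
    (hg : ∀ a, h (g k) * f a = f (hact k (Sweedler k) A (g k) a) * h (g k))
    (hx : ∀ a, h (x k) * f a = f (hact k (Sweedler k) A (x k) a) +
      f (hact k (Sweedler k) A (g k) a) * h (x k)) :
    Smash k (Sweedler k) A →ₐ[k] C :=
  TwistedTensor.lift _ f h fun b a => by
    have : (LinearMap.mulRight k (f a)) ∘ₗ h.toLinearMap =
        LinearMap.mul' k C ∘ₗ TensorProduct.map f.toLinearMap h.toLinearMap ∘ₗ
          (smashTwist k (Sweedler k) A).toMap ∘ₗ (TensorProduct.mk k _ A).flip a := by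
      have e : (smashTwist k (Sweedler k) A).toMap = smashMap k (Sweedler k) A := rfl
      -- Both sides are linear in the element of T(2), so the basis 1, g, x, gx is enough. For gx,
      -- first x and then g is moved past `f a`.
      apply linearMap_ext
      · simp [e, smashMap_one_tmul]
      · simp [e, smashMap_g, hg]
      · simp [e, smashMap_x, hx]
      · simp only [LinearMap.comp_apply, LinearMap.mulRight_apply, AlgHom.toLinearMap_apply, map_mul,
          e, LinearMap.flip_apply, TensorProduct.mk_apply, smashMap_gx, map_add,
          TensorProduct.map_tmul, LinearMap.mul'_apply, mul_assoc, hx]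
        rw [mul_add, hg, ← mul_assoc, hg, hact_g_g, mul_assoc]
    exact congrArg (fun l => l b) this

variable (f : A →ₐ[k] C) (h : Sweedler k →ₐ[k] C) (hg) (hx)

@[simp] lemma smashLift_of (a : A) (b : Sweedler k) :
    smashLift f h hg hx (TwistedTensor.of _ (a ⊗ₜ b)) = f a * h b :=
  TwistedTensor.lift_of _ _ _ _ _ _

end

section

variable {A : Type*} [Ring A] [Algebra k A] [HModuleAlgebra k (Sweedler k) A]

variable (k A) in
/-- The inclusion of `A` in `A # T(2)`. -/
abbrev smashInl : A →ₐ[k] Smash k (Sweedler k) A := TwistedTensor.inl _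
variable (k A) in
/-- The inclusion of `T(2)` in `A # T(2)`. -/
abbrev smashInr : Sweedler k →ₐ[k] Smash k (Sweedler k) A := TwistedTensor.inr _

lemma smashInr_g_mul (a : A) : smashInr k A (g k) * smashInl k A a =
    smashInl k A (hact k (Sweedler k) A (g k) a) * smashInr k A (g k) := by
  rw [TwistedTensor.inr_mul_inl, TwistedTensor.inl_mul_inr]
  exact congrArg _ (smashMap_g a)

lemma smashInr_x_mul (a : A) : smashInr k A (x k) * smashInl k A a =
    smashInl k A (hact k (Sweedler k) A (x k) a) +
      smashInl k A (hact k (Sweedler k) A (g k) a) * smashInr k A (x k) := by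
  rw [TwistedTensor.inr_mul_inl, TwistedTensor.inl_mul_inr, TwistedTensor.inl_apply, ← map_add]
  exact congrArg _ (smashMap_x a)

end

end Sweedler

/-! ### The braided-opposite algebra of k[u,v] and its monomial basis -/

section OppositePlane

open Coalgebra Sweedler MvPolynomial

variable {k : Type*} [Field k]

lemma planeG_u : planeG k (X 0) = X 0 := by simp [planeG]
lemma planeG_v : planeG k (X 1) = -X 1 := by simp [planeG]
lemma planeX_u : planeX k (X 0) = 0 := by rw [← plane_x, plane_x_u]
lemma planeX_v : planeX k (X 1) = X 0 := by rw [← plane_x, plane_x_v]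

variable [NeZero (2 : k)] (lam : k)

/-- As x kills u and g fixes it, only ½(1 + 1 + g - g) = 1 is left to act on `p`: the braiding with
u is the plain flip. -/
lemma opMul_u (p : Plane k) :
    BraidedOpp.opMul (rMatrix lam) (Plane k) (X 0 ⊗ₜ p) = X 0 * p := by
  have h2 : (2 : k) ≠ 0 := NeZero.ne _
  simp only [BraidedOpp.opMul, braiding, rMatrix, rElem, LinearMap.comp_apply,
    LinearEquiv.coe_coe, TensorProduct.comm_tmul, map_add, map_sub, map_smul, LinearMap.add_apply,
    LinearMap.sub_apply, LinearMap.smul_apply, tensorAct_tmul, map_one, map_mul,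
    Module.End.mul_apply, Module.End.one_apply, plane_g_u, plane_x_u, LinearMap.mul'_apply,
    map_zero, mul_zero]
  rw [mul_comm (X 0) p]
  match_scalars <;> field_simp <;> ring

/-- Here g v = -v and x v = gx v = u. The group-like part of R_λ leaves the action of g on `p`, and
in the λ-part the two terms with gx on the first leg cancel. -/
lemma opMul_v (p : Plane k) :
    BraidedOpp.opMul (rMatrix lam) (Plane k) (X 1 ⊗ₜ p) =
      planeG k p * X 1 + lam • (planeX k p * X 0) := by
  have h2 : (2 : k) ≠ 0 := NeZero.ne _
  simp only [BraidedOpp.opMul, braiding, rMatrix, rElem, LinearMap.comp_apply,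
    LinearEquiv.coe_coe, TensorProduct.comm_tmul, map_add, map_sub, map_smul, LinearMap.add_apply,
    LinearMap.sub_apply, LinearMap.smul_apply, tensorAct_tmul, map_one, map_mul,
    Module.End.mul_apply, Module.End.one_apply, plane_g_v, plane_x_v, plane_g_u,
    LinearMap.mul'_apply, mul_neg]
  rw [plane_g, plane_x]
  match_scalars <;> field_simp <;> ring

/-- The image of `u` in `A^{op_c}`. -/
def oppU : PlaneOpp lam := BraidedOpp.of _ _ (X 0)
/-- The image of `v` in `A^{op_c}`. -/
def oppV : PlaneOpp lam := BraidedOpp.of _ _ (X 1)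

lemma oppU_mul (p : Plane k) : oppU lam * BraidedOpp.of _ _ p = BraidedOpp.of _ _ (X 0 * p) := by
  rw [oppU, BraidedOpp.of_mul_of, opMul_u]

lemma oppV_mul (p : Plane k) : oppV lam * BraidedOpp.of _ _ p =
    BraidedOpp.of _ _ (planeG k p * X 1 + lam • (planeX k p * X 0)) := by
  rw [oppV, BraidedOpp.of_mul_of, opMul_v]

/-- A single multiplication by v twists `p` by g and x. Doing it twice removes the twist, because g²
= 1, x² = 0 and gx = -xg, and an ordinary multiplication remains. -/
lemma oppV_mul_oppV_mul (p : Plane k) : oppV lam * (oppV lam * BraidedOpp.of _ _ p) =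
    BraidedOpp.of _ _ ((lam • X 0 ^ 2 - X 1 ^ 2) * p) := by
  have h : planeX k (planeG k p) = - planeG k (planeX k p) := by
    rw [eq_neg_iff_add_eq_zero, add_comm]; exact planeG_planeX p
  rw [oppV_mul, oppV_mul]
  congr 1
  simp only [map_add, map_smul, map_mul, planeX_mul, planeG_planeG, planeX_planeX, planeG_u,
    planeG_v, planeX_u, planeX_v, h]
  simp only [smul_eq_C_mul]
  ring

/-- The linear map `k[u,v] → A^{op_c}` sending `uᵃ vᵇ` to the monomial `uᵃ vᵇ` formed in
`A^{op_c}`. -/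
def oppMonomials : Plane k →ₗ[k] PlaneOpp lam :=
  (basisMonomials (Fin 2) k).constr k (fun m => oppU lam ^ m 0 * oppV lam ^ m 1)

lemma oppMonomials_pow (a b : ℕ) :
    oppMonomials lam (X 0 ^ a * X 1 ^ b) = oppU lam ^ a * oppV lam ^ b := by
  set m : Fin 2 →₀ ℕ := Finsupp.equivFunOnFinite.symm ![a, b] with hm
  have h0 : m 0 = a := by simp [hm]
  have h1 : m 1 = b := by simp [hm]
  have := (basisMonomials (Fin 2) k).constr_basis k
    (fun m => oppU lam ^ m 0 * oppV lam ^ m 1) m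
  rw [coe_basisMonomials] at this
  simp only [monomial_eq_pow, h0, h1] at this
  exact this

/-- Relation r₂. Both products agree with the commutative product of k[u,v], because g u = u and x u
= 0. -/
lemma oppU_comm_oppV : oppV lam * oppU lam = oppU lam * oppV lam := by
  rw [show oppU lam = BraidedOpp.of _ _ (X 0) from rfl, oppV_mul,
    show oppV lam = BraidedOpp.of _ _ (X 1) from rfl, ← oppU, oppU_mul, planeG_u, planeX_u]
  simp

/-- `oppMonomials` as an endomorphism of the vector space `k[u,v]`. -/
def oppEnd : Plane k →ₗ[k] Plane k := (BraidedOpp.of _ _).symm.toLinearMap ∘ₗ oppMonomials lam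

lemma of_oppEnd (p : Plane k) : BraidedOpp.of _ _ (oppEnd lam p) = oppMonomials lam p := by
  simp [oppEnd]

lemma oppEnd_u_mul (p : Plane k) : oppEnd lam (X 0 * p) = X 0 * oppEnd lam p := by
  apply (BraidedOpp.of (rMatrix lam) (Plane k)).injective
  rw [of_oppEnd, ← oppU_mul, of_oppEnd]
  have : oppMonomials lam ∘ₗ LinearMap.mulLeft k (X 0) =
      LinearMap.mulLeft k (oppU lam) ∘ₗ oppMonomials lam := by
    apply plane_ext
    intro a b
    simp only [LinearMap.comp_apply, LinearMap.mulLeft_apply, oppMonomials_pow]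
    rw [← mul_assoc, ← pow_succ', oppMonomials_pow, pow_succ', mul_assoc]
  exact congrArg (fun f => f p) this

lemma oppMonomials_v_mul (p : Plane k) :
    oppMonomials lam (X 1 * p) = oppV lam * oppMonomials lam p := by
  have : oppMonomials lam ∘ₗ LinearMap.mulLeft k (X 1) =
      LinearMap.mulLeft k (oppV lam) ∘ₗ oppMonomials lam := by
    apply plane_ext
    intro a b
    have hc : Commute (oppV lam) (oppU lam ^ a) := Commute.pow_right (oppU_comm_oppV lam) a
    simp only [LinearMap.comp_apply, LinearMap.mulLeft_apply, oppMonomials_pow]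
    rw [mul_left_comm, ← pow_succ', oppMonomials_pow, pow_succ', ← mul_assoc, ← mul_assoc, hc.eq]
  exact congrArg (fun f => f p) this

/-- Two letters v of the braided-opposite product become the ordinary factor λu² - v². This is what
makes `oppEnd` computable without a formula for odd powers of v. -/
lemma oppEnd_v_sq_mul (p : Plane k) :
    oppEnd lam (X 1 ^ 2 * p) = (lam • X 0 ^ 2 - X 1 ^ 2) * oppEnd lam p := by
  apply (BraidedOpp.of (rMatrix lam) (Plane k)).injective
  rw [of_oppEnd, ← oppV_mul_oppV_mul, of_oppEnd, pow_two, mul_assoc, oppMonomials_v_mul,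
    oppMonomials_v_mul]

/-- Applied twice, v² turns into λu² - (λu² - v²) = v², and u, 1 and v are unaffected. Bijectivity
of `oppEnd` comes from this involution. -/
lemma oppEnd_oppEnd (p : Plane k) : oppEnd lam (oppEnd lam p) = p := by
  have hu : ∀ q, oppEnd lam (oppEnd lam q) = q →
      oppEnd lam (oppEnd lam (X 0 * q)) = X 0 * q := by
    intro q hq
    rw [oppEnd_u_mul, oppEnd_u_mul, hq]
  have hv : ∀ q, oppEnd lam (oppEnd lam q) = q →
      oppEnd lam (oppEnd lam (X 1 ^ 2 * q)) = X 1 ^ 2 * q := by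
    intro q hq
    rw [oppEnd_v_sq_mul, sub_mul, map_sub, oppEnd_v_sq_mul, hq, smul_mul_assoc, map_smul, pow_two,
      mul_assoc, oppEnd_u_mul, oppEnd_u_mul, hq]
    simp only [sub_mul, smul_mul_assoc, pow_two, mul_assoc]
    abel
  have h0 : oppEnd lam (oppEnd lam 1) = 1 := by
    have : oppEnd lam 1 = 1 := by
      have := oppMonomials_pow lam 0 0
      simp only [pow_zero, mul_one] at this
      rw [oppEnd, LinearMap.comp_apply, this]; rfl
    rw [this, this]
  have h1 : oppEnd lam (oppEnd lam (X 1)) = X 1 := by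
    have : oppEnd lam (X 1) = X 1 := by
      have := oppMonomials_pow lam 0 1
      simp only [pow_zero, pow_one, one_mul] at this
      rw [oppEnd, LinearMap.comp_apply, this]; rfl
    rw [this, this]
  -- Only multiplication by v² is controlled, so the induction goes in steps of two and needs both 1
  -- and v as starting points.
  have hb : ∀ b : ℕ, oppEnd lam (oppEnd lam (X 1 ^ b)) = X 1 ^ b := by
    intro b
    induction b using Nat.twoStepInduction with
    | zero => simpa using h0
    | one => simpa using h1
    | more b h _ => rw [add_comm, pow_add]; exact hv _ h
  have : oppEnd lam ∘ₗ oppEnd lam = LinearMap.id := by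
    apply plane_ext
    intro a b
    simp only [LinearMap.comp_apply, LinearMap.id_apply]
    induction a with
    | zero => simpa using hb b
    | succ a ih => rw [pow_succ', mul_assoc]; exact hu _ ih
  exact congrArg (fun f => f p) this

/-- The monomials in `u, v` formed in `A^{op_c}` are a basis of it. -/
def oppEquiv : Plane k ≃ₗ[k] PlaneOpp lam :=
  (LinearEquiv.ofInvolutive (oppEnd lam) (oppEnd_oppEnd lam)).trans (BraidedOpp.of _ _)

lemma oppEquiv_pow (a b : ℕ) :
    oppEquiv lam (X 0 ^ a * X 1 ^ b) = oppU lam ^ a * oppV lam ^ b := by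
  rw [← oppMonomials_pow, ← of_oppEnd]; rfl

end OppositePlane

/-! ### The monomial basis of the braided product, and its relations -/

section Double

open Coalgebra Sweedler MvPolynomial
open FreeAlgebra (ι)

variable {k : Type*} [Field k]

lemma planeTensor_ext {M : Type*} [AddCommGroup M] [Module k M]
    {f f' : Plane k ⊗[k] Plane k →ₗ[k] M}
    (h : ∀ a b c d : ℕ, f ((X 0 ^ a * X 1 ^ b) ⊗ₜ (X 0 ^ c * X 1 ^ d)) =
      f' ((X 0 ^ a * X 1 ^ b) ⊗ₜ (X 0 ^ c * X 1 ^ d))) : f = f' := by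
  apply TensorProduct.ext
  apply plane_ext
  intro a b
  apply plane_ext
  intro c d
  exact h a b c d

/-- `(uᵃ vᵇ) ⊗ (uᶜ vᵈ) ↦ y₀ᵃ y₁ᵇ y₂ᶜ y₃ᵈ`. -/
def normalOrder {D : Type*} [Ring D] [Algebra k D] (y : Fin 4 → D) :
    Plane k ⊗[k] Plane k →ₗ[k] D :=
  LinearMap.mul' k D ∘ₗ TensorProduct.map
    ((basisMonomials (Fin 2) k).constr k (fun m => y 0 ^ m 0 * y 1 ^ m 1))
    ((basisMonomials (Fin 2) k).constr k (fun m => y 2 ^ m 0 * y 3 ^ m 1))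

lemma constr_pow {M : Type*} [AddCommGroup M] [Module k M] (φ : ℕ → ℕ → M) (a b : ℕ) :
    (basisMonomials (Fin 2) k).constr k (fun m => φ (m 0) (m 1)) (X 0 ^ a * X 1 ^ b) = φ a b := by
  set m : Fin 2 →₀ ℕ := Finsupp.equivFunOnFinite.symm ![a, b] with hm
  have h0 : m 0 = a := by simp [hm]
  have h1 : m 1 = b := by simp [hm]
  have := (basisMonomials (Fin 2) k).constr_basis k (fun m => φ (m 0) (m 1)) m
  rw [coe_basisMonomials] at this
  simp only [monomial_eq_pow, h0, h1] at this
  exact this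

lemma normalOrder_pow {D : Type*} [Ring D] [Algebra k D] (y : Fin 4 → D) (a b c d : ℕ) :
    normalOrder (k := k) y ((X 0 ^ a * X 1 ^ b) ⊗ₜ (X 0 ^ c * X 1 ^ d)) =
      y 0 ^ a * y 1 ^ b * (y 2 ^ c * y 3 ^ d) := by
  simp only [normalOrder, LinearMap.comp_apply, TensorProduct.map_tmul, LinearMap.mul'_apply]
  rw [constr_pow (fun a b => y 0 ^ a * y 1 ^ b), constr_pow (fun a b => y 2 ^ a * y 3 ^ b)]

lemma map_normalOrder {D E : Type*} [Ring D] [Algebra k D] [Ring E] [Algebra k E] (f : D →ₐ[k] E)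
    (y : Fin 4 → D) (t : Plane k ⊗[k] Plane k) :
    f (normalOrder y t) = normalOrder (fun j => f (y j)) t := by
  have : f.toLinearMap ∘ₗ normalOrder y = normalOrder (fun j => f (y j)) := by
    apply planeTensor_ext
    intro a b c d
    simp [normalOrder_pow]
  exact congrArg (fun l => l t) this

variable [NeZero (2 : k)] (lam : k)

lemma doubleGen_zero : doubleGen lam 0 = TwistedTensor.inl _ (X 0) := rfl
lemma doubleGen_one : doubleGen lam 1 = TwistedTensor.inl _ (X 1) := rfl
lemma doubleGen_two : doubleGen lam 2 = TwistedTensor.inr _ (oppU lam) := rfl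
lemma doubleGen_three : doubleGen lam 3 = TwistedTensor.inr _ (oppV lam) := rfl

/-- In an ordered monomial u, v stand to the left of u', v', so the product (p ⊗ 1)(1 ⊗ b) = p ⊗ b
never uses the braiding. Hence independence in the braided product reduces to that of the monomials
in A^{op_c}. -/
lemma normalOrder_doubleGen (t : Plane k ⊗[k] Plane k) :
    normalOrder (doubleGen lam) t = TwistedTensor.of _ ((oppEquiv lam).toLinearMap.lTensor _ t) := by
  have : normalOrder (doubleGen lam) =
      (TwistedTensor.of _).toLinearMap ∘ₗ (oppEquiv lam).toLinearMap.lTensor _ := by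
    apply planeTensor_ext
    intro a b c d
    simp only [normalOrder_pow, LinearMap.comp_apply,
      LinearMap.lTensor_tmul, LinearEquiv.coe_coe, oppEquiv_pow, doubleGen_zero, doubleGen_one,
      doubleGen_two, doubleGen_three, ← map_pow, ← map_mul]
    rw [TwistedTensor.inl_mul_inr]
  exact congrArg (fun l => l t) this

/-- The monomials `uᵃ vᵇ u'ᶜ v'ᵈ` are a basis of `A ⊗^c A^{op_c}`. -/
lemma normalOrder_doubleGen_bijective :
    Function.Bijective (normalOrder (k := k) (doubleGen lam)) := by
  have : ⇑(normalOrder (k := k) (doubleGen lam)) =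
      ((oppEquiv lam).lTensor (Plane k)).trans (TwistedTensor.of _) := by
    ext t
    exact normalOrder_doubleGen lam t
  rw [this]
  exact LinearEquiv.bijective _

section

variable {B : Type*} [Ring B] [Algebra k B] [HModuleAlgebra k (Sweedler k) B]

/-- The first leg of R_λ acts on u, where x is 0 and g is 1. What remains acts on `b` as ½(1 + g + 1
- g) = 1. -/
lemma inr_mul_inl_u (b : B) :
    TwistedTensor.inr (braidTwist (rMatrix lam) (Plane k) B) b * TwistedTensor.inl _ (X 0) =
      TwistedTensor.inl _ (X 0) * TwistedTensor.inr _ b := by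
  have h2 : (2 : k) ≠ 0 := NeZero.ne _
  rw [TwistedTensor.inr_mul_inl, TwistedTensor.inl_mul_inr]
  congr 1
  simp only [braidTwist, braiding, rMatrix, rElem, LinearMap.comp_apply,
    LinearEquiv.coe_coe, TensorProduct.comm_tmul, map_add, map_sub, map_smul, LinearMap.add_apply,
    LinearMap.sub_apply, LinearMap.smul_apply, tensorAct_tmul, map_one, map_mul,
    Module.End.mul_apply, Module.End.one_apply, plane_g_u, plane_x_u,
    map_zero, TensorProduct.zero_tmul]
  match_scalars <;> field_simp <;> ring

/-- On v the group-like part of R_λ leaves v ⊗ gb. In the λ-part both x and gx send v to u, so the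
terms with xb cancel and those with gxb add up. -/
lemma inr_mul_inl_v (b : B) :
    TwistedTensor.inr (braidTwist (rMatrix lam) (Plane k) B) b * TwistedTensor.inl _ (X 1) =
      TwistedTensor.inl _ (X 1) * TwistedTensor.inr _ (hact k (Sweedler k) B (g k) b) +
      lam • (TwistedTensor.inl _ (X 0) *
        TwistedTensor.inr _ (hact k (Sweedler k) B (g k) (hact k (Sweedler k) B (x k) b))) := by
  have h2 : (2 : k) ≠ 0 := NeZero.ne _
  rw [TwistedTensor.inr_mul_inl, TwistedTensor.inl_mul_inr, TwistedTensor.inl_mul_inr, ← map_smul,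
    ← map_add]
  congr 1
  simp only [braidTwist, braiding, rMatrix, rElem, LinearMap.comp_apply,
    LinearEquiv.coe_coe, TensorProduct.comm_tmul, map_add, map_sub, map_smul, LinearMap.add_apply,
    LinearMap.sub_apply, LinearMap.smul_apply, tensorAct_tmul, map_one, map_mul,
    Module.End.mul_apply, Module.End.one_apply, plane_g_u, plane_g_v, plane_x_v,
    TensorProduct.neg_tmul]
  match_scalars <;> field_simp <;> ring

end

lemma opp_g (p : Plane k) : hact k (Sweedler k) (PlaneOpp lam) (g k) (BraidedOpp.of _ _ p) =
    BraidedOpp.of _ _ (planeG k p) := plane_g p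
lemma opp_x (p : Plane k) : hact k (Sweedler k) (PlaneOpp lam) (x k) (BraidedOpp.of _ _ p) =
    BraidedOpp.of _ _ (planeX k p) := plane_x p

/-- The algebra map `k⟨u,v,u',v'⟩ → A ⊗^c A^{op_c}`. -/
def toDouble : Free4 k →ₐ[k] Double lam := FreeAlgebra.lift k (doubleGen lam)

@[simp] lemma toDouble_ι (j : Fin 4) : toDouble lam (ι k j) = doubleGen lam j := by
  simp [toDouble]

/-- r₁ and r₂ hold inside the two factors. The other four are the crossing rules for u and v,
applied to b = u' and b = v'; the term λuu' in r₄ comes from gx v' = u'. -/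
lemma toDouble_rel (i : Fin 6) : toDouble lam (rel lam i) = 0 := by
  have hu : ∀ b : PlaneOpp lam, TwistedTensor.inr (braidTwist (rMatrix lam) (Plane k) _) b *
      TwistedTensor.inl _ (X 0) = _ := inr_mul_inl_u lam
  have hv : ∀ b : PlaneOpp lam, TwistedTensor.inr (braidTwist (rMatrix lam) (Plane k) _) b *
      TwistedTensor.inl _ (X 1) = _ := inr_mul_inl_v lam
  have gu : hact k (Sweedler k) (PlaneOpp lam) (g k) (oppU lam) = oppU lam := by
    rw [oppU, opp_g, planeG_u]
  have gv : hact k (Sweedler k) (PlaneOpp lam) (g k) (oppV lam) = -oppV lam := by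
    rw [oppV, opp_g, planeG_v, map_neg]
  have xu : hact k (Sweedler k) (PlaneOpp lam) (x k) (oppU lam) = 0 := by
    rw [oppU, opp_x, planeX_u, map_zero]
  have xv : hact k (Sweedler k) (PlaneOpp lam) (x k) (oppV lam) = oppU lam := by
    rw [oppV, opp_x, planeX_v, oppU]
  fin_cases i
  · suffices h : doubleGen lam 0 * doubleGen lam 1 - doubleGen lam 1 * doubleGen lam 0 = 0 by
      simpa [rel] using h
    rw [doubleGen_zero, doubleGen_one, ← map_mul, ← map_mul, mul_comm, sub_self]
  · suffices h : doubleGen lam 2 * doubleGen lam 3 - doubleGen lam 3 * doubleGen lam 2 = 0 by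
      simpa [rel] using h
    rw [doubleGen_two, doubleGen_three, ← map_mul, ← map_mul, oppU_comm_oppV, sub_self]
  · simp [rel, doubleGen_zero, doubleGen_three, hu]
  · simp [rel, doubleGen_zero, doubleGen_one, doubleGen_two, doubleGen_three, hv, gv, xv, gu]
  · simp [rel, doubleGen_zero, doubleGen_two, hu]
  · simp [rel, doubleGen_one, doubleGen_two, hv, gu, xu]

end Double

/-! ### Reordering words by means of the relations, up to lower terms -/

section Straightening

open FreeAlgebra (ι)

variable {k D : Type*} [Field k] [Ring D] [Algebra k D]

variable (k) in
/-- The span of the monomials `y₀ᵃ y₁ᵇ y₂ᶜ y₃ᵈ` of degree `n`. -/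
def monomialSpan (y : Fin 4 → D) (n : ℕ) : Submodule k D :=
  Submodule.span k {z | ∃ a b c d : ℕ, a + b + c + d = n ∧
    z = y 0 ^ a * y 1 ^ b * (y 2 ^ c * y 3 ^ d)}

/-- Modulo a filtered ideal `E` containing the relations, every word is a combination of ordered
monomials of the same degree. -/
lemma lift_mem_monomialSpan_sup {F E : ℕ → Submodule k D} {y : Fin 4 → D} {lam : k}
    (hy : ∀ j, y j ∈ F 1) (h1 : (1 : D) ∈ F 0)
    (hF : ∀ {m n a b}, a ∈ F m → b ∈ F n → a * b ∈ F (m + n))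
    (hFE : ∀ {m n a b}, a ∈ F m → b ∈ E n → a * b ∈ E (m + n))
    (hEF : ∀ {m n a b}, a ∈ E m → b ∈ F n → a * b ∈ E (m + n))
    (hrel : ∀ i, FreeAlgebra.lift k y (rel lam i) ∈ E 2) (n : ℕ) {z : Free4 k}
    (hz : z ∈ freeGrading k n) :
    FreeAlgebra.lift k y z ∈ monomialSpan k y n ⊔ E n := by
  set S : ℕ → Submodule k D := fun n => monomialSpan k y n ⊔ E n with hS
  have hES : ∀ {n z}, z ∈ E n → z ∈ S n := fun h => Submodule.mem_sup_right h
  have hmS : ∀ a b c d : ℕ, y 0 ^ a * y 1 ^ b * (y 2 ^ c * y 3 ^ d) ∈ S (a + b + c + d) :=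
    fun a b c d => Submodule.mem_sup_left (Submodule.subset_span ⟨a, b, c, d, rfl, rfl⟩)
  have hpow : ∀ (j : Fin 4) (a : ℕ), y j ^ a ∈ F a := by
    intro j a
    induction a with
    | zero => simpa using h1
    | succ a ih => rw [pow_succ]; exact hF ih (hy j)
  have hmF : ∀ a b c d : ℕ, y 0 ^ a * y 1 ^ b * (y 2 ^ c * y 3 ^ d) ∈ F (a + b + c + d) := by
    intro a b c d
    have := hF (hF (hpow 0 a) (hpow 1 b)) (hF (hpow 2 c) (hpow 3 d))
    rwa [← add_assoc] at this
  -- `E` absorbs multiplication by generators, so left multiplication by y_j need only be checked on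
  -- ordered monomials.
  have key : ∀ (j : Fin 4) (n : ℕ), (∀ a b c d : ℕ, a + b + c + d = n →
      y j * (y 0 ^ a * y 1 ^ b * (y 2 ^ c * y 3 ^ d)) ∈ S (n + 1)) →
      ∀ w ∈ S n, y j * w ∈ S (n + 1) := by
    intro j n h w hw
    suffices hle : S n ≤ (S (n + 1)).comap (LinearMap.mulLeft k (y j)) from hle hw
    refine sup_le (Submodule.span_le.2 ?_) fun e he => hES ?_
    · rintro _ ⟨a, b, c, d, h', rfl⟩
      exact h a b c d h'
    · rw [add_comm]; exact hFE (hy j) he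
  -- Each use of a relation in front of a word of degree n costs an error in E (n + 2).
  have rem : ∀ {r w n}, r ∈ E 2 → w ∈ F n → r * w ∈ S (n + 1 + 1) := by
    intro r w n hr hw
    have := hEF hr hw
    rw [add_comm 2 n] at this
    exact hES this
  have r0 := hrel 0
  have r2 := hrel 2
  have r3 := hrel 3
  have r1 := hrel 1
  have r4 := hrel 4
  have r5 := hrel 5
  simp only [rel, Matrix.cons_val, map_sub, map_add, map_mul, map_smul, FreeAlgebra.lift_ι_apply]
    at r0 r1 r2 r3 r4 r5
  have m0 : ∀ n, ∀ w ∈ S n, y 0 * w ∈ S (n + 1) := by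
    intro n
    refine key 0 n ?_
    rintro a b c d rfl
    have := hmS (a + 1) b c d
    rw [pow_succ', show a + 1 + b + c + d = a + b + c + d + 1 by ring] at this
    simpa only [mul_assoc] using this
  -- The same scheme serves y₁, y₂, y₃. If the monomial starts with a letter y_i of smaller index,
  -- the relation moves y_j behind it. Induction on the degree treats y_j times the shorter word,
  -- and the case of y_i, already settled, puts y_i back in front.
  have m1 : ∀ n, ∀ w ∈ S n, y 1 * w ∈ S (n + 1) := by
    intro n
    induction n with
    | zero =>
      refine key 1 0 ?_
      rintro a b c d h
      obtain ⟨⟨⟨rfl, rfl⟩, rfl⟩, rfl⟩ : ((a = 0 ∧ b = 0) ∧ c = 0) ∧ d = 0 := by omega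
      simpa using hmS 0 1 0 0
    | succ n ih =>
      refine key 1 (n + 1) ?_
      rintro a b c d h
      rcases a with _ | a
      · have := hmS 0 (b + 1) c d
        rw [pow_succ', show 0 + (b + 1) + c + d = n + 1 + 1 by omega] at this
        simpa only [mul_assoc, pow_zero, one_mul] using this
      · obtain rfl : n = a + b + c + d := by omega
        set w := y 0 ^ a * y 1 ^ b * (y 2 ^ c * y 3 ^ d) with hw
        have e : y 1 * (y 0 ^ (a + 1) * y 1 ^ b * (y 2 ^ c * y 3 ^ d)) =
            y 0 * (y 1 * w) - (y 0 * y 1 - y 1 * y 0) * w := by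
          rw [pow_succ', hw]; noncomm_ring
        rw [e]
        exact sub_mem (m0 _ _ (ih _ (hmS a b c d))) (rem r0 (hmF a b c d))
  have m2 : ∀ n, ∀ w ∈ S n, y 2 * w ∈ S (n + 1) := by
    intro n
    induction n with
    | zero =>
      refine key 2 0 ?_
      rintro a b c d h
      obtain ⟨⟨⟨rfl, rfl⟩, rfl⟩, rfl⟩ : ((a = 0 ∧ b = 0) ∧ c = 0) ∧ d = 0 := by omega
      simpa using hmS 0 0 1 0
    | succ n ih =>
      refine key 2 (n + 1) ?_
      rintro a b c d h
      rcases a with _ | a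
      · rcases b with _ | b
        · have := hmS 0 0 (c + 1) d
          rw [pow_succ', show 0 + 0 + (c + 1) + d = n + 1 + 1 by omega] at this
          simpa only [mul_assoc, pow_zero, one_mul] using this
        · obtain rfl : n = 0 + b + c + d := by omega
          set w := y 0 ^ 0 * y 1 ^ b * (y 2 ^ c * y 3 ^ d) with hw
          have e : y 2 * (y 0 ^ 0 * y 1 ^ (b + 1) * (y 2 ^ c * y 3 ^ d)) =
              y 1 * (y 2 * w) - (y 1 * y 2 - y 2 * y 1) * w := by
            rw [pow_succ', hw, pow_zero]; noncomm_ring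
          rw [e]
          exact sub_mem (m1 _ _ (ih _ (hmS 0 b c d))) (rem r5 (hmF 0 b c d))
      · obtain rfl : n = a + b + c + d := by omega
        set w := y 0 ^ a * y 1 ^ b * (y 2 ^ c * y 3 ^ d) with hw
        have e : y 2 * (y 0 ^ (a + 1) * y 1 ^ b * (y 2 ^ c * y 3 ^ d)) =
            y 0 * (y 2 * w) - (y 0 * y 2 - y 2 * y 0) * w := by
          rw [pow_succ', hw]; noncomm_ring
        rw [e]
        exact sub_mem (m0 _ _ (ih _ (hmS a b c d))) (rem r4 (hmF a b c d))
  have m3 : ∀ n, ∀ w ∈ S n, y 3 * w ∈ S (n + 1) := by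
    intro n
    induction n with
    | zero =>
      refine key 3 0 ?_
      rintro a b c d h
      obtain ⟨⟨⟨rfl, rfl⟩, rfl⟩, rfl⟩ : ((a = 0 ∧ b = 0) ∧ c = 0) ∧ d = 0 := by omega
      simpa using hmS 0 0 0 1
    | succ n ih =>
      refine key 3 (n + 1) ?_
      rintro a b c d h
      rcases a with _ | a
      · rcases b with _ | b
        · rcases c with _ | c
          · have := hmS 0 0 0 (d + 1)
            rw [pow_succ', show 0 + 0 + 0 + (d + 1) = n + 1 + 1 by omega] at this
            simpa only [mul_assoc, pow_zero, one_mul] using this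
          · obtain rfl : n = 0 + 0 + c + d := by omega
            set w := y 0 ^ 0 * y 1 ^ 0 * (y 2 ^ c * y 3 ^ d) with hw
            have e : y 3 * (y 0 ^ 0 * y 1 ^ 0 * (y 2 ^ (c + 1) * y 3 ^ d)) =
                y 2 * (y 3 * w) - (y 2 * y 3 - y 3 * y 2) * w := by
              rw [pow_succ', hw, pow_zero, pow_zero]; noncomm_ring
            rw [e]
            exact sub_mem (m2 _ _ (ih _ (hmS 0 0 c d))) (rem r1 (hmF 0 0 c d))
        · obtain rfl : n = 0 + b + c + d := by omega
          set w := y 0 ^ 0 * y 1 ^ b * (y 2 ^ c * y 3 ^ d) with hw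
          -- Here r₄ is used: passing v' over v changes the sign and creates λuu'w. That extra term
          -- has the full degree and is ordered by the cases of y₀ and y₂.
          have e : y 3 * (y 0 ^ 0 * y 1 ^ (b + 1) * (y 2 ^ c * y 3 ^ d)) =
              (y 1 * y 3 + y 3 * y 1 - lam • (y 0 * y 2)) * w +
                lam • (y 0 * (y 2 * w)) - y 1 * (y 3 * w) := by
            rw [pow_succ', hw, pow_zero]
            simp only [add_mul, sub_mul, smul_mul_assoc, mul_assoc, one_mul]
            abel
          rw [e]
          have hw' := hmS 0 b c d
          exact sub_mem (add_mem (rem r3 (hmF 0 b c d))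
            (Submodule.smul_mem _ _ (m0 _ _ (m2 _ _ hw')))) (m1 _ _ (ih _ hw'))
      · obtain rfl : n = a + b + c + d := by omega
        set w := y 0 ^ a * y 1 ^ b * (y 2 ^ c * y 3 ^ d) with hw
        have e : y 3 * (y 0 ^ (a + 1) * y 1 ^ b * (y 2 ^ c * y 3 ^ d)) =
            y 0 * (y 3 * w) - (y 0 * y 3 - y 3 * y 0) * w := by
          rw [pow_succ', hw]; noncomm_ring
        rw [e]
        exact sub_mem (m0 _ _ (ih _ (hmS a b c d))) (rem r2 (hmF a b c d))
  have hone : (1 : D) ∈ S 0 := by simpa using hmS 0 0 0 0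
  change FreeAlgebra.lift k y z ∈ S n
  suffices h : freeGrading k n ≤ (S n).comap (FreeAlgebra.lift k y).toLinearMap from h hz
  clear hz
  induction n with
  | zero =>
    rw [freeGrading, pow_zero]
    intro z hz
    obtain ⟨c, rfl⟩ := Submodule.mem_one.1 hz
    simpa [Algebra.algebraMap_eq_smul_one] using Submodule.smul_mem _ c hone
  | succ n ih =>
    rw [freeGrading, pow_succ']
    refine Submodule.mul_le.2 fun a ha b hb => ?_
    have hb' := ih hb
    refine Submodule.span_induction ?_ ?_ ?_ ?_ ha
    · rintro _ ⟨j, rfl⟩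
      simp only [Submodule.mem_comap, AlgHom.toLinearMap_apply, map_mul, FreeAlgebra.lift_ι_apply]
      fin_cases j
      exacts [m0 _ _ hb', m1 _ _ hb', m2 _ _ hb', m3 _ _ hb']
    · simp
    · intro x y _ _ hx hy; rw [add_mul]; exact add_mem hx hy
    · intro c x _ hx; rw [smul_mul_assoc]; exact Submodule.smul_mem _ _ hx

lemma monomialSpan_le_range (y : Fin 4 → D) (n : ℕ) :
    monomialSpan k y n ≤ LinearMap.range (normalOrder (k := k) y) := by
  refine Submodule.span_le.2 ?_
  rintro _ ⟨a, b, c, d, -, rfl⟩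
  exact ⟨_, normalOrder_pow y a b c d⟩

/-- Elements satisfying the relations generate the span of their ordered monomials. -/
lemma lift_mem_range_normalOrder {y : Fin 4 → D} {lam : k}
    (hrel : ∀ i, FreeAlgebra.lift k y (rel lam i) = 0) (z : Free4 k) :
    FreeAlgebra.lift k y z ∈ LinearMap.range (normalOrder (k := k) y) := by
  suffices h : ⨆ n, freeGrading k n ≤
      (LinearMap.range (normalOrder (k := k) y)).comap (FreeAlgebra.lift k y).toLinearMap by
    rw [freeGrading_iSup] at h
    exact h trivial
  refine iSup_le fun n z hz => ?_
  -- When the relations hold exactly there are no errors, and the trivial choices of `F` and `E`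
  -- suffice.
  have := lift_mem_monomialSpan_sup (F := fun _ => ⊤) (E := fun _ => ⊥) (y := y) (lam := lam)
    (by simp) (by simp) (by simp) (by simp +contextual) (by simp +contextual) (by simp [hrel]) n hz
  rw [sup_bot_eq] at this
  exact monomialSpan_le_range y n this

end Straightening

/-! ### The presentation of the braided product -/

section Presentation

open FreeAlgebra (ι)

variable {k : Type*} [Field k] [NeZero (2 : k)] (lam : k)

/-- The ordered monomials span the presented algebra, and the map to the braided product takes them
to a basis. A combination of them that maps to zero therefore has zero coefficients. -/
lemma exists_presentation_equiv :
    ∃ e : RingQuot (fun a b : Free4 k => (∃ i, a = rel lam i) ∧ b = 0) ≃ₐ[k] Double lam,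
      ∀ j : Fin 4, e (RingQuot.mkAlgHom k _ (ι k j)) = doubleGen lam j := by
  set s : Free4 k → Free4 k → Prop := fun a b => (∃ i, a = rel lam i) ∧ b = 0 with hs
  set q : Free4 k →ₐ[k] RingQuot s := RingQuot.mkAlgHom k s with hq
  have hsd : ∀ ⦃a b : Free4 k⦄, s a b → toDouble lam a = toDouble lam b := by
    rintro _ _ ⟨⟨i, rfl⟩, rfl⟩
    rw [toDouble_rel, map_zero]
  set f : RingQuot s →ₐ[k] Double lam := RingQuot.liftAlgHom k ⟨toDouble lam, hsd⟩ with hf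
  have hfq : ∀ z, f (q z) = toDouble lam z := fun z => RingQuot.liftAlgHom_mkAlgHom_apply _ _ _ _
  set y : Fin 4 → RingQuot s := fun j => q (ι k j) with hy
  have hlift : FreeAlgebra.lift k y = q := by
    ext j; simp [hy]
  have hfy : (fun j => f (y j)) = doubleGen lam := by
    funext j; simp [hy, hfq]
  have hsurj : ∀ z, ∃ t, normalOrder (k := k) y t = z := by
    intro z
    obtain ⟨z, rfl⟩ := RingQuot.mkAlgHom_surjective k s z
    have := lift_mem_range_normalOrder (y := y) (lam := lam) (fun i => by
      rw [hlift, ← map_zero q]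
      exact RingQuot.mkAlgHom_rel k ⟨⟨i, rfl⟩, rfl⟩) z
    rwa [hlift] at this
  have hb := normalOrder_doubleGen_bijective lam
  have hft : ∀ t, f (normalOrder (k := k) y t) = normalOrder (doubleGen lam) t := by
    intro t; rw [map_normalOrder, hfy]
  refine ⟨AlgEquiv.ofBijective f ⟨?_, ?_⟩, fun j => ?_⟩
  · rw [injective_iff_map_eq_zero]
    intro z hz
    obtain ⟨t, rfl⟩ := hsurj z
    rw [hft] at hz
    rw [hb.1 (hz.trans (map_zero _).symm), map_zero]
  · intro w
    obtain ⟨t, rfl⟩ := hb.2 w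
    exact ⟨_, hft t⟩
  · exact (hfq _).trans (toDouble_ι lam j)

end Presentation

/-! ### Linear maps on the span of the relations -/

section Parametrization

open FreeAlgebra (ι)

variable {k : Type*} [Field k]

/-- The coefficient of the word `v v'`. -/
def coeffVV' : Free4 k →ₗ[k] k :=
  LinearMap.proj (R := k) (φ := fun _ : Fin 3 => k) 2 ∘ₗ
    LinearMap.proj (R := k) (φ := fun _ : Fin 3 => Fin 3 → k) 0 ∘ₗ
    (FreeAlgebra.lift k ![0, Matrix.single 0 1 1, 0, Matrix.single 1 2 1] :
      Free4 k →ₐ[k] Matrix (Fin 3) (Fin 3) k).toLinearMap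

/-- Let u, u' act by 0 and v, v' by the matrix units E₀₁, E₁₂. The only word with a nonzero (0, 2)
entry is vv', which occurs in r₄ alone. -/
lemma coeffVV'_rel (lam : k) (i : Fin 6) : coeffVV' (rel lam i) = if i = 3 then 1 else 0 := by
  have h : ∀ a : Free4 k, coeffVV' a = (FreeAlgebra.lift k ![0, Matrix.single 0 1 1, 0,
    Matrix.single 1 2 1] : Free4 k →ₐ[k] Matrix (Fin 3) (Fin 3) k) a 0 2 := fun _ => rfl
  fin_cases i <;> simp [h, rel, Matrix.sub_apply]

lemma relSpace_ext {lam : k} {M : Type*} [AddCommGroup M] [Module k M]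
    {f f' : relSpace lam →ₗ[k] M} (h : ∀ i, f (relElem lam i) = f' (relElem lam i)) : f = f' := by
  apply LinearMap.ext_on_range (v := relElem lam) _ h
  rw [eq_top_iff]
  rintro ⟨z, hz⟩ -
  have : Submodule.map (relSpace lam).subtype (Submodule.span k (Set.range (relElem lam))) =
      relSpace lam := by
    rw [Submodule.map_span, ← Set.range_comp]; rfl
  rw [← this] at hz
  obtain ⟨w, hw, hw'⟩ := hz
  have : w = ⟨z, by rw [← hw']; exact w.2⟩ := Subtype.ext hw'
  rwa [← this]

/-- Existence needs a functional that is 1 on r₄ and 0 on the other relations, and the coefficient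
of vv' is one. Uniqueness holds because the rᵢ span I. -/
lemma existsUnique_relSpace_map (lam α : k) : ∃! κ : relSpace lam →ₗ[k] Sweedler k,
    κ (relElem lam 3) = algebraMap k (Sweedler k) α ∧ ∀ i, i ≠ 3 → κ (relElem lam i) = 0 := by
  refine ⟨LinearMap.toSpanSingleton k _ (algebraMap k (Sweedler k) α) ∘ₗ coeffVV' ∘ₗ
    (relSpace lam).subtype, ⟨?_, fun i hi => ?_⟩, fun κ hκ => relSpace_ext fun i => ?_⟩
  · simp [relElem, coeffVV'_rel]
  · simp [relElem, coeffVV'_rel, hi]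
  · by_cases hi : i = 3
    · subst hi; rw [hκ.1]; simp [relElem, coeffVV'_rel]
    · rw [hκ.2 i hi]; simp [relElem, coeffVV'_rel, hi]

end Parametrization

/-! ### The graded smash product and the skew derivative δ -/

section SmashDouble

open Coalgebra Sweedler MvPolynomial
open FreeAlgebra (ι)

variable {k : Type*} [Field k]

lemma planeX_one : planeX k 1 = 0 := by rw [← plane_x, hact_x_one]

/-- An algebra map out of `k⟨u,v,u',v'⟩ # T(2)`, from the images of the generators. -/
def freeSmashLift {C : Type*} [Ring C] [Algebra k C] (y : Fin 4 → C) (h : Sweedler k →ₐ[k] C)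
    (hg : ∀ j, h (g k) * y j = ![y 0, -y 1, y 2, -y 3] j * h (g k))
    (hx : ∀ j, h (x k) * y j = ![0, y 0, 0, y 2] j + ![y 0, -y 1, y 2, -y 3] j * h (x k)) :
    FreeSmash k →ₐ[k] C :=
  have lg : ∀ j, FreeAlgebra.lift k y (freeG k (ι k j)) = ![y 0, -y 1, y 2, -y 3] j := by
    intro j; fin_cases j <;> simp
  have lx : ∀ j, FreeAlgebra.lift k y (freeX k (ι k j)) = ![0, y 0, 0, y 2] j := by
    intro j; fin_cases j <;> simp
  -- The commutation rules, assumed on generators, extend to all words: the rule for g because g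
  -- acts by an algebra map, the rule for x because of its twisted Leibniz formula.
  have hg' : ∀ a, h (g k) * FreeAlgebra.lift k y a =
      FreeAlgebra.lift k y (freeG k a) * h (g k) := by
    intro a
    induction a using FreeAlgebra.induction with
    | grade0 r => simp [Algebra.commutes]
    | grade1 i => rw [lg, FreeAlgebra.lift_ι_apply, hg]
    | mul a b ha hb => rw [map_mul, ← mul_assoc, ha, mul_assoc, hb, map_mul, map_mul, mul_assoc]
    | add a b ha hb => simp only [map_add, mul_add, add_mul, ha, hb]
  smashLift (FreeAlgebra.lift k y) h (by intro a; rw [free_g]; exact hg' a) (by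
    intro a
    rw [free_g, free_x]
    induction a using FreeAlgebra.induction with
    | grade0 r => simp [Algebra.commutes]
    | grade1 i => rw [lg, lx, FreeAlgebra.lift_ι_apply, hx]
    | mul a b ha hb =>
      rw [map_mul, ← mul_assoc, ha, add_mul, mul_assoc (FreeAlgebra.lift k y (freeG k a)), hb,
        freeX_mul]
      simp only [map_add, map_mul, mul_add, mul_assoc]
      abel
    | add a b ha hb =>
      simp only [map_add, mul_add, add_mul, ha, hb]
      abel)

lemma freeSmashLift_of {C : Type*} [Ring C] [Algebra k C] (y : Fin 4 → C)
    (h : Sweedler k →ₐ[k] C) (hg) (hx) (a : Free4 k) (b : Sweedler k) :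
    freeSmashLift y h hg hx (TwistedTensor.of _ (a ⊗ₜ b)) = FreeAlgebra.lift k y a * h b :=
  by simp [freeSmashLift]

/-- The linear map of `k[u,v]` with `uᵃ vᵇ ↦ uᵃ vᵇ⁻¹` for odd `b` and `uᵃ vᵇ ↦ 0` for
even `b`. -/
def planeSkewDeriv : Plane k →ₗ[k] Plane k :=
  (basisMonomials (Fin 2) k).constr k
    (fun m => (fun a b => if Odd b then X 0 ^ a * X 1 ^ (b - 1) else 0 : ℕ → ℕ → Plane k)
      (m 0) (m 1))

lemma planeSkewDeriv_pow (a b : ℕ) : planeSkewDeriv (X 0 ^ a * X 1 ^ b : Plane k) =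
    if Odd b then X 0 ^ a * X 1 ^ (b - 1) else 0 :=
  constr_pow (fun a b => if Odd b then X 0 ^ a * X 1 ^ (b - 1) else 0 : ℕ → ℕ → Plane k) a b

lemma planeSkewDeriv_u_mul (p : Plane k) :
    planeSkewDeriv (X 0 * p) = X 0 * planeSkewDeriv p := by
  have : planeSkewDeriv ∘ₗ LinearMap.mulLeft k (X 0) =
      LinearMap.mulLeft k (X 0) ∘ₗ planeSkewDeriv (k := k) := by
    apply plane_ext
    intro a b
    simp only [LinearMap.comp_apply, LinearMap.mulLeft_apply, ← mul_assoc, ← pow_succ',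
      planeSkewDeriv_pow]
    split_ifs
    · rw [← mul_assoc, ← pow_succ']
    · simp
  exact congrArg (fun f => f p) this

/-- The exponents b and b + 1 have opposite parity, so exactly one of D(v·vᵇ) and v·D(vᵇ) is
nonzero, and it equals vᵇ. This gives vD + Dv = 1, the source of the constant α. -/
lemma planeSkewDeriv_v_mul (p : Plane k) :
    planeSkewDeriv (X 1 * p) = p - X 1 * planeSkewDeriv p := by
  have : planeSkewDeriv ∘ₗ LinearMap.mulLeft k (X 1) =
      LinearMap.id - LinearMap.mulLeft k (X 1) ∘ₗ planeSkewDeriv (k := k) := by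
    apply plane_ext
    intro a b
    simp only [LinearMap.comp_apply, LinearMap.mulLeft_apply, LinearMap.sub_apply,
      LinearMap.id_apply, mul_left_comm (X 1 : Plane k), ← pow_succ', planeSkewDeriv_pow]
    rcases Nat.even_or_odd b with h | h
    · rw [if_pos h.add_one, if_neg (Nat.not_odd_iff_even.2 h)]
      simp
    · rw [if_neg (Nat.not_odd_iff_even.2 h.add_one), if_pos h]
      obtain ⟨c, rfl⟩ := h
      simp only [Nat.add_sub_cancel, pow_succ]
      ring
  exact congrArg (fun f => f p) this

/-- g acts by the parity of the exponent of v, and D changes that exponent by one. -/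
lemma planeSkewDeriv_planeG (p : Plane k) :
    planeSkewDeriv (planeG k p) = -planeG k (planeSkewDeriv p) := by
  have : planeSkewDeriv ∘ₗ (planeG k).toLinearMap =
      -((planeG k).toLinearMap ∘ₗ planeSkewDeriv (k := k)) := by
    apply plane_ext
    intro a b
    have e : ∀ (c : ℕ) (q : Plane k), planeSkewDeriv ((-1) ^ c * q) =
        (-1) ^ c * planeSkewDeriv q := by
      intro c q
      rcases neg_one_pow_eq_or (Plane k) c with h | h <;> simp [h]
    simp only [LinearMap.comp_apply, AlgHom.toLinearMap_apply, LinearMap.neg_apply, planeG_pow, e,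
      planeSkewDeriv_pow]
    split_ifs with h
    · obtain ⟨c, rfl⟩ := h
      rw [planeG_pow]
      simp [pow_succ]
    · simp
  exact congrArg (fun f => f p) this

/-- D is the action of x divided by u. Its behaviour under x therefore follows from x² = 0. -/
lemma planeX_eq (p : Plane k) : planeX k p = X 0 * planeSkewDeriv p := by
  have : planeX k = LinearMap.mulLeft k (X 0) ∘ₗ planeSkewDeriv := by
    apply plane_ext
    intro a b
    rw [planeX_pow, LinearMap.comp_apply, planeSkewDeriv_pow]
    split_ifs
    · simp [pow_succ', mul_assoc]
    · simp
  exact congrArg (fun f => f p) this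

/-- x² = 0 reads u²D² = 0, and u can be cancelled in the domain k[u,v]. -/
lemma planeSkewDeriv_planeSkewDeriv (p : Plane k) : planeSkewDeriv (planeSkewDeriv p) = 0 := by
  have h := planeX_planeX p
  rw [planeX_eq, planeX_eq, planeSkewDeriv_u_mul] at h
  simpa using h

lemma planeSkewDeriv_mem {n : ℕ} {p : Plane k} (hp : p ∈ planeGrading k (n + 1)) :
    planeSkewDeriv p ∈ planeGrading k n := by
  suffices h : planeGrading k (n + 1) ≤ (planeGrading k n).comap planeSkewDeriv from h hp
  rw [planeGrading_eq_span, planeGrading_eq_span, Submodule.span_le]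
  rintro _ ⟨a, b, hab, rfl⟩
  rw [SetLike.mem_coe, Submodule.mem_comap, planeSkewDeriv_pow]
  split_ifs with h
  · have := h.pos
    exact Submodule.subset_span ⟨a, b - 1, by omega, rfl⟩
  · exact zero_mem _

lemma planeSkewDeriv_mem_zero {p : Plane k} (hp : p ∈ planeGrading k 0) :
    planeSkewDeriv p = 0 := by
  suffices h : planeGrading k 0 ≤ LinearMap.ker planeSkewDeriv from h hp
  rw [planeGrading_eq_span, Submodule.span_le]
  rintro _ ⟨a, b, hab, rfl⟩
  obtain rfl : b = 0 := by omega
  rw [SetLike.mem_coe, LinearMap.mem_ker, planeSkewDeriv_pow]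
  simp

variable [NeZero (2 : k)] (lam : k)

lemma double_act_of (h : Sweedler k) (p : Plane k) (b : PlaneOpp lam) :
    hact k (Sweedler k) (Double lam) h (TwistedTensor.of _ (p ⊗ₜ b)) =
      TwistedTensor.of _ (tensorAct (hact k _ (Plane k)) (hact k _ (PlaneOpp lam)) (comul h)
        (p ⊗ₜ b)) := rfl

lemma double_g_of (p : Plane k) (b : PlaneOpp lam) :
    hact k (Sweedler k) (Double lam) (g k) (TwistedTensor.of _ (p ⊗ₜ b)) =
      TwistedTensor.of _ (planeG k p ⊗ₜ hact k (Sweedler k) _ (g k) b) := by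
  rw [double_act_of, comul_g, tensorAct_tmul, plane_g]

lemma double_x_of (p : Plane k) (b : PlaneOpp lam) :
    hact k (Sweedler k) (Double lam) (x k) (TwistedTensor.of _ (p ⊗ₜ b)) =
      TwistedTensor.of _ (planeX k p ⊗ₜ b + planeG k p ⊗ₜ hact k (Sweedler k) _ (x k) b) := by
  rw [double_act_of, comul_x, map_add, LinearMap.add_apply, tensorAct_tmul, tensorAct_tmul, plane_g,
    plane_x, map_one, Module.End.one_apply]

lemma double_g_gen (j : Fin 4) : hact k (Sweedler k) (Double lam) (g k) (doubleGen lam j) =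
    ![doubleGen lam 0, -doubleGen lam 1, doubleGen lam 2, -doubleGen lam 3] j := by
  fin_cases j
  · simp [doubleGen, double_g_of, planeG_u, hact_g_one]
  · simp [doubleGen, double_g_of, planeG_v, hact_g_one, TensorProduct.neg_tmul]
  · simp [doubleGen, double_g_of, opp_g, planeG_u]
  · simp [doubleGen, double_g_of, opp_g, planeG_v, TensorProduct.tmul_neg]

lemma double_x_gen (j : Fin 4) : hact k (Sweedler k) (Double lam) (x k) (doubleGen lam j) =
    ![0, doubleGen lam 0, 0, doubleGen lam 2] j := by
  fin_cases j
  · simp [doubleGen, double_x_of, planeX_u, hact_x_one]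
  · simp [doubleGen, double_x_of, planeX_v, hact_x_one]
  · simp [doubleGen, double_x_of, opp_x, planeX_u, planeX_one]
  · simp [doubleGen, double_x_of, opp_x, planeX_v, planeX_one]

/-- The algebra `(A ⊗^c A^{op_c}) # T(2)`. -/
abbrev DoubleSmash : Type _ := Smash k (Sweedler k) (Double lam)

/-- The generators `u, v, u', v'` of `(A ⊗^c A^{op_c}) # T(2)`. -/
def smashGen (j : Fin 4) : DoubleSmash lam := smashInl k (Double lam) (doubleGen lam j)

lemma g_mul_smashGen (j : Fin 4) : smashInr k (Double lam) (g k) * smashGen lam j =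
    ![smashGen lam 0, -smashGen lam 1, smashGen lam 2, -smashGen lam 3] j *
      smashInr k (Double lam) (g k) := by
  rw [smashGen, smashInr_g_mul, double_g_gen]
  fin_cases j <;> simp [smashGen]

lemma x_mul_smashGen (j : Fin 4) : smashInr k (Double lam) (x k) * smashGen lam j =
    ![0, smashGen lam 0, 0, smashGen lam 2] j +
    ![smashGen lam 0, -smashGen lam 1, smashGen lam 2, -smashGen lam 3] j *
      smashInr k (Double lam) (x k) := by
  rw [smashGen, smashInr_x_mul, double_g_gen, double_x_gen]
  fin_cases j <;> simp [smashGen]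

/-- The projection of `k⟨u,v,u',v'⟩ # T(2)` onto `(A ⊗^c A^{op_c}) # T(2)`. -/
def toDoubleSmash : FreeSmash k →ₐ[k] DoubleSmash lam :=
  freeSmashLift (smashGen lam) (smashInr k (Double lam)) (g_mul_smashGen lam) (x_mul_smashGen lam)

lemma toDoubleSmash_of (a : Free4 k) (b : Sweedler k) :
    toDoubleSmash lam (TwistedTensor.of _ (a ⊗ₜ b)) =
      TwistedTensor.of _ (toDouble lam a ⊗ₜ b) := by
  have h : FreeAlgebra.lift k (smashGen lam) = (smashInl k (Double lam)).comp (toDouble lam) := by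
    ext j; simp [smashGen]
  rw [toDoubleSmash, freeSmashLift_of, h, AlgHom.comp_apply, TwistedTensor.inl_mul_inr]

/-- The extension `δ = D ⊗ id ⊗ id` of `D = planeSkewDeriv` to `(A ⊗^c A^{op_c}) # T(2)`. -/
def skewDeriv : Module.End k (DoubleSmash lam) :=
  (TwistedTensor.of _).toLinearMap ∘ₗ
    (((TwistedTensor.of _).toLinearMap ∘ₗ planeSkewDeriv.rTensor (PlaneOpp lam) ∘ₗ
      (TwistedTensor.of (braidTwist (rMatrix lam) (Plane k) (PlaneOpp lam))).symm.toLinearMap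
      ).rTensor (Sweedler k)) ∘ₗ
    (TwistedTensor.of _).symm.toLinearMap

/-- The pure tensor `p ⊗ b ⊗ h` in `(A ⊗^c A^{op_c}) # T(2)`. -/
def pure3 (p : Plane k) (b : PlaneOpp lam) (h : Sweedler k) : DoubleSmash lam :=
  TwistedTensor.of _ (TwistedTensor.of _ (p ⊗ₜ b) ⊗ₜ h)

lemma pure3_eq (p : Plane k) (b : PlaneOpp lam) (h : Sweedler k) :
    pure3 lam p b h = smashInl k (Double lam) (TwistedTensor.of _ (p ⊗ₜ b)) *
      smashInr k (Double lam) h := (TwistedTensor.inl_mul_inr _ _ _).symm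

lemma skewDeriv_pure3 (p : Plane k) (b : PlaneOpp lam) (h : Sweedler k) :
    skewDeriv lam (pure3 lam p b h) = pure3 lam (planeSkewDeriv p) b h := by
  simp [skewDeriv, pure3]

lemma doubleSmash_end_ext {f f' : Module.End k (DoubleSmash lam)}
    (hf : ∀ p b h, f (pure3 lam p b h) = f' (pure3 lam p b h)) : f = f' := by
  ext z
  induction z using TwistedTensor.ind with
  | h0 => simp
  | ha x y hx hy => simp only [map_add, hx, hy]
  | ht a h =>
    induction a using TwistedTensor.ind with
    | h0 => simp
    | ha x y hx hy => simp only [map_add, TensorProduct.add_tmul, hx, hy]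
    | ht p b => exact hf p b h

lemma pure3_add (p q : Plane k) (b : PlaneOpp lam) (h : Sweedler k) :
    pure3 lam (p + q) b h = pure3 lam p b h + pure3 lam q b h := by
  simp [pure3, TensorProduct.add_tmul]

lemma pure3_neg (p : Plane k) (b : PlaneOpp lam) (h : Sweedler k) :
    pure3 lam (-p) b h = -pure3 lam p b h := by
  simp [pure3, TensorProduct.neg_tmul]

lemma u_mul_pure3 (p b h) : smashGen lam 0 * pure3 lam p b h = pure3 lam (X 0 * p) b h := by
  rw [pure3_eq, smashGen, ← mul_assoc, ← map_mul, doubleGen_zero, TwistedTensor.inl_mul_of, pure3_eq]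
  simp

lemma v_mul_pure3 (p b h) : smashGen lam 1 * pure3 lam p b h = pure3 lam (X 1 * p) b h := by
  rw [pure3_eq, smashGen, ← mul_assoc, ← map_mul, doubleGen_one, TwistedTensor.inl_mul_of, pure3_eq]
  simp

/-- By r₅ and r₆, u' commutes with u and v. Left multiplication by u' thus passes the first tensor
factor untouched and cannot interfere with δ. -/
lemma u'_mul_inl (p : Plane k) :
    doubleGen lam 2 * TwistedTensor.inl _ p = TwistedTensor.inl _ p * doubleGen lam 2 := by
  have h0 := toDouble_rel lam 4
  have h1 := toDouble_rel lam 5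
  simp only [rel, Matrix.cons_val, map_sub, map_mul, toDouble_ι, sub_eq_zero] at h0 h1
  have : (LinearMap.mulLeft k (doubleGen lam 2)) ∘ₗ (TwistedTensor.inl _).toLinearMap =
      (LinearMap.mulRight k (doubleGen lam 2)) ∘ₗ (TwistedTensor.inl _).toLinearMap := by
    apply plane_ext
    intro a b
    simp only [LinearMap.comp_apply, AlgHom.toLinearMap_apply, map_mul, map_pow, ← doubleGen_zero,
      ← doubleGen_one, LinearMap.mulLeft_apply, LinearMap.mulRight_apply]
    have c0 : Commute (doubleGen lam 2) (doubleGen lam 0) := h0.symm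
    have c1 : Commute (doubleGen lam 2) (doubleGen lam 1) := h1.symm
    exact (c0.pow_right a).mul_right (c1.pow_right b)
  exact congrArg (fun f => f p) this

lemma u'_mul_of (p : Plane k) (b : PlaneOpp lam) :
    doubleGen lam 2 * TwistedTensor.of _ (p ⊗ₜ b) = TwistedTensor.of _ (p ⊗ₜ (oppU lam * b)) := by
  rw [← TwistedTensor.inl_mul_inr, ← TwistedTensor.inl_mul_inr, map_mul, ← mul_assoc, u'_mul_inl,
    mul_assoc, doubleGen_two]

lemma u'_mul_pure3 (p b h) : smashGen lam 2 * pure3 lam p b h = pure3 lam p (oppU lam * b) h := by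
  rw [pure3_eq, smashGen, ← mul_assoc, ← map_mul, u'_mul_of, pure3_eq]

lemma g_mul_pure3 (p b h) : smashInr k (Double lam) (g k) * pure3 lam p b h =
    pure3 lam (planeG k p) (hact k (Sweedler k) _ (g k) b) (g k * h) := by
  rw [pure3_eq, ← mul_assoc, smashInr_g_mul, double_g_of, pure3_eq, map_mul, mul_assoc]

/-- These are the three terms of the iterated coproduct x ⊗ 1 ⊗ 1 + g ⊗ x ⊗ 1 + g ⊗ g ⊗ x, the last
leg multiplying `h`. -/
lemma x_mul_pure3 (p b h) : smashInr k (Double lam) (x k) * pure3 lam p b h =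
    pure3 lam (planeX k p) b h + pure3 lam (planeG k p) (hact k (Sweedler k) _ (x k) b) h +
    pure3 lam (planeG k p) (hact k (Sweedler k) _ (g k) b) (x k * h) := by
  rw [pure3_eq, ← mul_assoc, smashInr_x_mul, double_g_of, double_x_of, pure3_eq, pure3_eq, pure3_eq,
    map_mul, map_add, map_add]
  simp only [add_mul, mul_assoc]

end SmashDouble

/-! ### Changing the last generator by an operator -/

section Perturbation

open FreeAlgebra (ι)

variable {k E : Type*} [Field k] [Ring E] [Algebra k E]

/-- The family `y` with `e` added to its last member. -/
def perturb (y : Fin 4 → E) (e : E) : Fin 4 → E := ![y 0, y 1, y 2, y 3 + e]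

/-- v' anticommutes with g, so adding an element that also anticommutes with g preserves the rule.
-/
lemma g_mul_perturb {y : Fin 4 → E} {e G : E}
    (h : ∀ j, G * y j = ![y 0, -y 1, y 2, -y 3] j * G) (he : G * e = -(e * G)) (j : Fin 4) :
    G * perturb y e j =
      ![perturb y e 0, -perturb y e 1, perturb y e 2, -perturb y e 3] j * G := by
  have hj := h j
  fin_cases j
  · exact hj
  · exact hj
  · exact hj
  · change G * (y 3 + e) = -(y 3 + e) * G
    replace hj : G * y 3 = - y 3 * G := hj
    rw [mul_add, hj, he]
    noncomm_ring

/-- The rule for v' has the inhomogeneous term u', which is already supplied by the old v'. The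
correction has only to satisfy the homogeneous rule. -/
lemma x_mul_perturb {y : Fin 4 → E} {e X : E}
    (h : ∀ j, X * y j = ![0, y 0, 0, y 2] j + ![y 0, -y 1, y 2, -y 3] j * X)
    (he : X * e = -(e * X)) (j : Fin 4) :
    X * perturb y e j = ![0, perturb y e 0, 0, perturb y e 2] j +
      ![perturb y e 0, -perturb y e 1, perturb y e 2, -perturb y e 3] j * X := by
  have hj := h j
  fin_cases j
  · exact hj
  · exact hj
  · exact hj
  · change X * (y 3 + e) = y 2 + -(y 3 + e) * X
    replace hj : X * y 3 = y 2 + - y 3 * X := hj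
    rw [mul_add, hj, he]
    noncomm_ring

/-- Only r₂, r₃ and r₄ contain v'. They change by [u', e], [u, e] and ve + ev respectively, the
hypotheses on `e`. -/
lemma lift_perturb_rel {y : Fin 4 → E} {e : E} {lam α : k}
    (h : ∀ i, FreeAlgebra.lift k y (rel lam i) = 0) (h0 : y 0 * e = e * y 0)
    (h1 : y 1 * e + e * y 1 = algebraMap k E α) (h2 : y 2 * e = e * y 2) (i : Fin 6) :
    FreeAlgebra.lift k (perturb y e) (rel lam i) = if i = 3 then algebraMap k E α else 0 := by
  have hi := h i
  fin_cases i
  · simpa [rel, perturb] using hi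
  · simp [rel, perturb] at hi ⊢
    rw [mul_add, add_mul, h2, add_sub_add_right_eq_sub, hi]
  · simp [rel, perturb] at hi ⊢
    rw [mul_add, add_mul, h0, add_sub_add_right_eq_sub, hi]
  · simp [rel, perturb] at hi ⊢
    rw [mul_add, add_mul, add_add_add_comm, h1, add_sub_right_comm, hi, zero_add]
  · simpa [rel, perturb] using hi
  · simpa [rel, perturb] using hi

end Perturbation

/-! ### The deformation acts on the graded smash product -/

section DeformedAction

open Coalgebra Sweedler MvPolynomial
open FreeAlgebra (ι)

variable {k : Type*} [Field k] [NeZero (2 : k)] (lam : k)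

/-- Left multiplication in `(A ⊗^c A^{op_c}) # T(2)`. -/
def leftMul : DoubleSmash lam →ₐ[k] Module.End k (DoubleSmash lam) := Algebra.lmul k _

@[simp] lemma leftMul_apply (a w : DoubleSmash lam) : leftMul lam a w = a * w := rfl

lemma leftMul_u_mul_skewDeriv :
    leftMul lam (smashGen lam 0) * skewDeriv lam = skewDeriv lam * leftMul lam (smashGen lam 0) := by
  apply doubleSmash_end_ext
  intro p b h
  simp [skewDeriv_pure3, u_mul_pure3, planeSkewDeriv_u_mul]

lemma leftMul_u'_mul_skewDeriv :
    leftMul lam (smashGen lam 2) * skewDeriv lam = skewDeriv lam * leftMul lam (smashGen lam 2) := by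
  apply doubleSmash_end_ext
  intro p b h
  simp [skewDeriv_pure3, u'_mul_pure3]

lemma leftMul_v_mul_skewDeriv :
    leftMul lam (smashGen lam 1) * skewDeriv lam + skewDeriv lam * leftMul lam (smashGen lam 1) =
      1 := by
  apply doubleSmash_end_ext
  intro p b h
  simp only [LinearMap.add_apply, Module.End.mul_apply, leftMul_apply, skewDeriv_pure3,
    v_mul_pure3, planeSkewDeriv_v_mul, ← pure3_add,
    Module.End.one_apply]
  simp

lemma leftMul_g_mul_skewDeriv :
    leftMul lam (smashInr k _ (g k)) * skewDeriv lam =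
      -(skewDeriv lam * leftMul lam (smashInr k _ (g k))) := by
  apply doubleSmash_end_ext
  intro p b h
  simp only [Module.End.mul_apply, leftMul_apply, LinearMap.neg_apply,
    skewDeriv_pure3, g_mul_pure3, planeSkewDeriv_planeG, ← pure3_neg, neg_neg]

/-- x reaches the first factor in two ways. As x itself it is uD, and both products with D vanish
since D² = 0 and D is u-linear; in the other two terms of the coproduct it is g, which anticommutes
with D. -/
lemma leftMul_x_mul_skewDeriv :
    leftMul lam (smashInr k _ (x k)) * skewDeriv lam =
      -(skewDeriv lam * leftMul lam (smashInr k _ (x k))) := by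
  apply doubleSmash_end_ext
  intro p b h
  simp only [Module.End.mul_apply, leftMul_apply, LinearMap.neg_apply, planeX_eq,
    skewDeriv_pure3, x_mul_pure3, planeSkewDeriv_planeG, pure3_neg, neg_neg,
    map_add, planeSkewDeriv_u_mul, planeSkewDeriv_planeSkewDeriv, mul_zero, neg_add]
  simp [pure3]

/-- The operators on `(A ⊗^c A^{op_c}) # T(2)` by which the generators of the deformation with
`κ(r₄) = α` act: left multiplications, corrected by `α δ` for `v'`. -/
def deformedGen (α : k) : Fin 4 → Module.End k (DoubleSmash lam) :=
  perturb (fun j => leftMul lam (smashGen lam j)) (α • skewDeriv lam)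

lemma deformedGen_apply (α : k) (j : Fin 4) (w : DoubleSmash lam) :
    deformedGen lam α j w = smashGen lam j * w + if j = 3 then α • skewDeriv lam w else 0 := by
  fin_cases j
  · exact (add_zero _).symm
  · exact (add_zero _).symm
  · exact (add_zero _).symm
  · rfl

/-- The action of `T(2)` on `(A ⊗^c A^{op_c}) # T(2)` by left multiplication. -/
def leftMulInr : Sweedler k →ₐ[k] Module.End k (DoubleSmash lam) :=
  (leftMul lam).comp (smashInr k _)

lemma leftMulInr_g_mul (j : Fin 4) :
    leftMulInr lam (g k) * leftMul lam (smashGen lam j) =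
      ![leftMul lam (smashGen lam 0), -leftMul lam (smashGen lam 1), leftMul lam (smashGen lam 2),
        -leftMul lam (smashGen lam 3)] j * leftMulInr lam (g k) := by
  have h : ∀ a : Fin 4 → DoubleSmash lam,
      ![leftMul lam (a 0), -leftMul lam (a 1), leftMul lam (a 2), -leftMul lam (a 3)] j =
        leftMul lam (![a 0, -a 1, a 2, -a 3] j) := by
    intro a
    rw [← map_neg, ← map_neg]
    fin_cases j <;> rfl
  rw [h, leftMulInr, AlgHom.comp_apply, ← map_mul, ← map_mul, g_mul_smashGen]

lemma leftMulInr_x_mul (j : Fin 4) :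
    leftMulInr lam (x k) * leftMul lam (smashGen lam j) =
      ![0, leftMul lam (smashGen lam 0), 0, leftMul lam (smashGen lam 2)] j +
      ![leftMul lam (smashGen lam 0), -leftMul lam (smashGen lam 1), leftMul lam (smashGen lam 2),
        -leftMul lam (smashGen lam 3)] j * leftMulInr lam (x k) := by
  have h : ∀ a : Fin 4 → DoubleSmash lam,
      ![leftMul lam (a 0), -leftMul lam (a 1), leftMul lam (a 2), -leftMul lam (a 3)] j =
        leftMul lam (![a 0, -a 1, a 2, -a 3] j) := by
    intro a
    rw [← map_neg, ← map_neg]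
    fin_cases j <;> rfl
  have h' : ∀ a : Fin 4 → DoubleSmash lam, ![0, leftMul lam (a 0), 0, leftMul lam (a 2)] j =
        leftMul lam (![0, a 0, 0, a 2] j) := by
    intro a
    rw [← map_zero (leftMul lam)]
    fin_cases j <;> rfl
  rw [h, h', leftMulInr, AlgHom.comp_apply, ← map_mul, ← map_mul, ← map_add, x_mul_smashGen]

lemma leftMulInr_g_mul_smul_skewDeriv (α : k) :
    leftMulInr lam (g k) * (α • skewDeriv lam) = -((α • skewDeriv lam) * leftMulInr lam (g k)) := by
  rw [mul_smul_comm, smul_mul_assoc, ← smul_neg]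
  exact congrArg _ (leftMul_g_mul_skewDeriv lam)

lemma leftMulInr_x_mul_smul_skewDeriv (α : k) :
    leftMulInr lam (x k) * (α • skewDeriv lam) = -((α • skewDeriv lam) * leftMulInr lam (x k)) := by
  rw [mul_smul_comm, smul_mul_assoc, ← smul_neg]
  exact congrArg _ (leftMul_x_mul_skewDeriv lam)

/-- The action of `k⟨u,v,u',v'⟩ # T(2)` on `(A ⊗^c A^{op_c}) # T(2)` given by `deformedGen`. -/
def deformedAction (α : k) : FreeSmash k →ₐ[k] Module.End k (DoubleSmash lam) :=
  freeSmashLift (deformedGen lam α) (leftMulInr lam)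
    (g_mul_perturb (leftMulInr_g_mul lam) (leftMulInr_g_mul_smul_skewDeriv lam α))
    (x_mul_perturb (leftMulInr_x_mul lam) (leftMulInr_x_mul_smul_skewDeriv lam α))

lemma deformedAction_of (α : k) (a : Free4 k) (b : Sweedler k) :
    deformedAction lam α (TwistedTensor.of _ (a ⊗ₜ b)) =
      FreeAlgebra.lift k (deformedGen lam α) a * leftMulInr lam b :=
  freeSmashLift_of _ _ _ _ _ _

lemma lift_leftMul_smashGen (a : Free4 k) :
    FreeAlgebra.lift k (fun j => leftMul lam (smashGen lam j)) a =
      leftMul lam (smashInl k _ (toDouble lam a)) := by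
  have h : FreeAlgebra.lift k (fun j => leftMul lam (smashGen lam j)) =
      (leftMul lam).comp ((smashInl k (Double lam)).comp (toDouble lam)) := by
    apply FreeAlgebra.hom_ext
    funext j
    simp [smashGen]
  rw [h]; rfl

/-- Left multiplications satisfy the relations of the graded algebra. Correcting v' by αδ changes r₄
by α(vδ + δv) = α and the others by commutators that vanish. -/
lemma lift_deformedGen_rel (α : k) (i : Fin 6) :
    FreeAlgebra.lift k (deformedGen lam α) (rel lam i) = if i = 3 then algebraMap k _ α else 0 := by
  refine lift_perturb_rel (fun i => ?_) ?_ ?_ ?_ i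
  · rw [lift_leftMul_smashGen, toDouble_rel, map_zero, map_zero]
  · rw [mul_smul_comm, smul_mul_assoc, leftMul_u_mul_skewDeriv]
  · rw [mul_smul_comm, smul_mul_assoc, ← smul_add, leftMul_v_mul_skewDeriv,
      Algebra.algebraMap_eq_smul_one]
  · rw [mul_smul_comm, smul_mul_assoc, leftMul_u'_mul_skewDeriv]

variable {lam}

lemma lift_deformedGen_relSpace {α : k} {κ : relSpace lam →ₗ[k] Sweedler k}
    (h3 : κ (relElem lam 3) = algebraMap k (Sweedler k) α)
    (h0 : ∀ i, i ≠ 3 → κ (relElem lam i) = 0) (r : relSpace lam) :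
    FreeAlgebra.lift k (deformedGen lam α) r = leftMulInr lam (κ r) := by
  have : (FreeAlgebra.lift k (deformedGen lam α)).toLinearMap ∘ₗ (relSpace lam).subtype =
      (leftMulInr lam).toLinearMap ∘ₗ κ := by
    apply relSpace_ext
    intro i
    simp only [LinearMap.comp_apply, AlgHom.toLinearMap_apply, Submodule.subtype_apply]
    refine (lift_deformedGen_rel lam α i).trans ?_
    split_ifs with hi
    · rw [hi, h3, AlgHom.commutes]
    · rw [h0 i hi, map_zero]
  exact congrArg (fun f => f r) this

/-- The action of the deformation on `(A ⊗^c A^{op_c}) # T(2)`. -/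
def deformationAction {α : k} {κ : relSpace lam →ₗ[k] Sweedler k}
    (h3 : κ (relElem lam 3) = algebraMap k (Sweedler k) α)
    (h0 : ∀ i, i ≠ 3 → κ (relElem lam i) = 0) :
    Deformation lam κ →ₐ[k] Module.End k (DoubleSmash lam) :=
  RingQuot.liftAlgHom k ⟨deformedAction lam α, by
    rintro _ _ ⟨r, rfl, rfl⟩
    rw [deformedAction_of, deformedAction_of, lift_deformedGen_relSpace h3 h0, map_one,
      map_one, mul_one, one_mul]⟩

lemma deformationAction_toDeformation {α : k} {κ : relSpace lam →ₗ[k] Sweedler k}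
    (h3 : κ (relElem lam 3) = algebraMap k (Sweedler k) α)
    (h0 : ∀ i, i ≠ 3 → κ (relElem lam i) = 0) (z : FreeSmash k) :
    deformationAction h3 h0 (toDeformation lam κ z) = deformedAction lam α z :=
  RingQuot.liftAlgHom_mkAlgHom_apply _ _ _ _

end DeformedAction

/-! ### Degrees, and the leading term of the deformed action -/

section Degrees

open Coalgebra Sweedler MvPolynomial
open FreeAlgebra (ι)

variable {k : Type*} [Field k] [NeZero (2 : k)] (lam : k)

lemma doubleGrading_isHMultiplicative :
    IsHMultiplicative k (Sweedler k) (doubleGrading lam) :=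
  braidedGrading_isHMultiplicative _ planeGrading_isHMultiplicative
    (oppGrading_isHMultiplicative _ planeGrading_isHMultiplicative)

lemma pure3_mem {i j n : ℕ} {p : Plane k} {b : PlaneOpp lam} (hp : p ∈ planeGrading k i)
    (hb : b ∈ oppGrading (rMatrix lam) (planeGrading k) j) (hn : i + j = n) (h : Sweedler k) :
    pure3 lam p b h ∈ doubleSmashGrading lam n := by
  subst hn
  refine ⟨_, Submodule.apply_mem_map₂ (TensorProduct.mk k _ _) ?_ Submodule.mem_top, rfl⟩
  exact ⟨_, tensorSub_le_totalGrading i j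
    (Submodule.apply_mem_map₂ (TensorProduct.mk k _ _) hp hb), rfl⟩

lemma doubleSmashGrading_le {n : ℕ} {S : Submodule k (DoubleSmash lam)}
    (hS : ∀ i j p b h, i + j = n → p ∈ planeGrading k i →
      b ∈ oppGrading (rMatrix lam) (planeGrading k) j → pure3 lam p b h ∈ S) :
    doubleSmashGrading lam n ≤ S := by
  refine Submodule.map_le_iff_le_comap.2 (Submodule.map₂_le.2 ?_)
  rintro a ha h -
  suffices hle : doubleGrading lam n ≤ S.comap ((TwistedTensor.of _).toLinearMap ∘ₗ
      (TensorProduct.mk k (Double lam) (Sweedler k)).flip h) from hle ha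
  refine Submodule.map_le_iff_le_comap.2 (iSup₂_le fun p hp => Submodule.map₂_le.2 ?_)
  intro a ha b hb
  exact hS p.1 p.2 a b h hp ha hb

lemma doubleGen_mem (j : Fin 4) : doubleGen lam j ∈ doubleGrading lam 1 := by
  have hX : ∀ i, (MvPolynomial.X i : Plane k) ∈ planeGrading k 1 := fun i => isHomogeneous_X _ _
  have h1 := (oppGrading_isHMultiplicative (rMatrix lam)
    (planeGrading_isHMultiplicative (k := k))).one_mem
  have h1' := (planeGrading_isHMultiplicative (k := k)).one_mem
  fin_cases j
  · exact ⟨_, tensorSub_le_totalGrading 1 0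
      (Submodule.apply_mem_map₂ (TensorProduct.mk k _ _) (hX 0) h1), rfl⟩
  · exact ⟨_, tensorSub_le_totalGrading 1 0
      (Submodule.apply_mem_map₂ (TensorProduct.mk k _ _) (hX 1) h1), rfl⟩
  · exact ⟨_, tensorSub_le_totalGrading 0 1
      (Submodule.apply_mem_map₂ (TensorProduct.mk k _ _) h1' ⟨_, hX 0, rfl⟩), rfl⟩
  · exact ⟨_, tensorSub_le_totalGrading 0 1
      (Submodule.apply_mem_map₂ (TensorProduct.mk k _ _) h1' ⟨_, hX 1, rfl⟩), rfl⟩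

lemma smashGen_mem (j : Fin 4) : smashGen lam j ∈ doubleSmashGrading lam 1 :=
  ⟨_, Submodule.apply_mem_map₂ (TensorProduct.mk k _ _) (doubleGen_mem lam j) Submodule.mem_top, rfl⟩

lemma smashInr_mem (h : Sweedler k) : smashInr k (Double lam) h ∈ doubleSmashGrading lam 0 :=
  ⟨_, Submodule.apply_mem_map₂ (TensorProduct.mk k _ _)
    (doubleGrading_isHMultiplicative lam).one_mem Submodule.mem_top, rfl⟩

lemma doubleSmashGrading_mul_mem {m n : ℕ} {a b : DoubleSmash lam}
    (ha : a ∈ doubleSmashGrading lam m) (hb : b ∈ doubleSmashGrading lam n) :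
    a * b ∈ doubleSmashGrading lam (m + n) := SetLike.mul_mem_graded ha hb

/-- The elements of `(A ⊗^c A^{op_c}) # T(2)` of degree less than `n`. -/
def degreeLT (n : ℕ) : Submodule k (DoubleSmash lam) :=
  ⨆ (i : ℕ) (_ : i < n), doubleSmashGrading lam i

lemma doubleSmashGrading_le_degreeLT {i n : ℕ} (h : i < n) :
    doubleSmashGrading lam i ≤ degreeLT lam n :=
  le_iSup₂ (f := fun (i : ℕ) (_ : i < n) => doubleSmashGrading lam i) i h

lemma degreeLT_mono {m n : ℕ} (h : m ≤ n) : degreeLT lam m ≤ degreeLT lam n :=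
  iSup₂_le fun _ hi => doubleSmashGrading_le_degreeLT lam (hi.trans_le h)

lemma proj_of_mem {n : ℕ} {w : DoubleSmash lam} (h : w ∈ doubleSmashGrading lam n) :
    GradedAlgebra.proj (doubleSmashGrading lam) n w = w := by
  rw [GradedAlgebra.proj_apply, DirectSum.decompose_of_mem_same _ h]

lemma proj_of_mem_ne {m n : ℕ} {w : DoubleSmash lam} (h : w ∈ doubleSmashGrading lam m)
    (hmn : m ≠ n) : GradedAlgebra.proj (doubleSmashGrading lam) n w = 0 := by
  rw [GradedAlgebra.proj_apply, DirectSum.decompose_of_mem_ne _ h hmn]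

/-- The projection to degree n is the identity on the first space and zero on the second. -/
lemma eq_zero_of_mem_degreeLT {n : ℕ} {w : DoubleSmash lam} (h : w ∈ doubleSmashGrading lam n)
    (h' : w ∈ degreeLT lam n) : w = 0 := by
  have hle : degreeLT lam n ≤ LinearMap.ker (GradedAlgebra.proj (doubleSmashGrading lam) n) :=
    iSup₂_le fun i hi w hw => proj_of_mem_ne lam hw hi.ne
  rw [← proj_of_mem lam h]
  exact hle h'

/-- D lowers the degree of the first factor by one, and it vanishes on constants, so nothing is left
when that degree is zero. -/
lemma skewDeriv_mem {n : ℕ} {w : DoubleSmash lam} (h : w ∈ doubleSmashGrading lam n) :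
    skewDeriv lam w ∈ degreeLT lam n := by
  suffices hle : doubleSmashGrading lam n ≤ (degreeLT lam n).comap (skewDeriv lam) from hle h
  apply doubleSmashGrading_le
  intro i j p b h hij hp hb
  rw [Submodule.mem_comap, skewDeriv_pure3]
  rcases i with _ | i
  · rw [planeSkewDeriv_mem_zero hp]
    simp [pure3]
  · exact doubleSmashGrading_le_degreeLT lam (by omega)
      (pure3_mem lam (planeSkewDeriv_mem hp) hb rfl h)

/-- The only discrepancy is αδ, which lowers degree, whereas multiplication by a generator raises it
to n + 1. -/
lemma deformedGen_sub_mem (α : k) (j : Fin 4) {n : ℕ} {w : DoubleSmash lam}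
    (h : w ∈ doubleSmashGrading lam n) :
    deformedGen lam α j w - smashGen lam j * w ∈ degreeLT lam (n + 1) := by
  have : deformedGen lam α j w - smashGen lam j * w =
      if j = 3 then α • skewDeriv lam w else 0 := by
    rw [deformedGen_apply, add_sub_cancel_left]
  rw [this]
  split_ifs
  · exact Submodule.smul_mem _ _ (degreeLT_mono lam (Nat.le_succ n) (skewDeriv_mem lam h))
  · exact zero_mem _

lemma deformedGen_mem_degreeLT (α : k) (j : Fin 4) {n : ℕ} {w : DoubleSmash lam}
    (h : w ∈ degreeLT lam n) : deformedGen lam α j w ∈ degreeLT lam (n + 1) := by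
  suffices hle : degreeLT lam n ≤ (degreeLT lam (n + 1)).comap (deformedGen lam α j) from hle h
  refine iSup₂_le fun i hi w hw => ?_
  have h1 := degreeLT_mono lam (Nat.succ_le_succ hi.le) (deformedGen_sub_mem lam α j hw)
  have h2 := doubleSmashGrading_mul_mem lam (smashGen_mem lam j) hw
  have h3 := doubleSmashGrading_le_degreeLT lam (show 1 + i < n + 1 by omega) h2
  simpa using add_mem h1 h3

lemma toDouble_mem {n : ℕ} {a : Free4 k} (ha : a ∈ freeGrading k n) :
    toDouble lam a ∈ doubleGrading lam n := by
  suffices h : freeGrading k n ≤ (doubleGrading lam n).comap (toDouble lam).toLinearMap from h ha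
  have hm := doubleGrading_isHMultiplicative lam
  clear ha
  induction n with
  | zero =>
    rw [freeGrading, pow_zero]
    intro z hz
    obtain ⟨c, rfl⟩ := Submodule.mem_one.1 hz
    simpa [Algebra.algebraMap_eq_smul_one] using Submodule.smul_mem _ c hm.one_mem
  | succ n ih =>
    rw [freeGrading, pow_succ]
    refine Submodule.mul_le.2 fun a ha b hb => ?_
    have ha' := ih ha
    refine Submodule.span_induction ?_ ?_ ?_ ?_ hb
    · rintro _ ⟨j, rfl⟩
      simp only [Submodule.mem_comap, AlgHom.toLinearMap_apply, map_mul, toDouble_ι]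
      exact hm.mul_mem ha' (doubleGen_mem lam j)
    · simp
    · intro x y _ _ hx hy; rw [mul_add]; exact add_mem hx hy
    · intro c x _ hx; rw [mul_smul_comm]; exact Submodule.smul_mem _ _ hx

lemma toDoubleSmash_mem {n : ℕ} {z : FreeSmash k}
    (hz : z ∈ smashGrading k (Sweedler k) (freeGrading k) n) :
    toDoubleSmash lam z ∈ doubleSmashGrading lam n := by
  suffices h : smashGrading k (Sweedler k) (freeGrading k) n ≤
      (doubleSmashGrading lam n).comap (toDoubleSmash lam).toLinearMap from h hz
  refine Submodule.map_le_iff_le_comap.2 (Submodule.map₂_le.2 fun a ha h _ => ?_)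
  simp only [Submodule.mem_comap, TensorProduct.mk_apply, LinearEquiv.coe_coe,
    AlgHom.toLinearMap_apply, toDoubleSmash_of]
  exact ⟨_, Submodule.apply_mem_map₂ (TensorProduct.mk k _ _) (toDouble_mem lam ha)
    Submodule.mem_top, rfl⟩

/-- The leading term of the deformed action. -/
lemma lift_deformedGen_sub_mem (α : k) {n : ℕ} {a : Free4 k} (ha : a ∈ freeGrading k n)
    {w : DoubleSmash lam} (hw : w ∈ doubleSmashGrading lam 0) :
    FreeAlgebra.lift k (deformedGen lam α) a w - smashInl k _ (toDouble lam a) * w ∈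
      degreeLT lam n := by
  induction n generalizing a with
  | zero =>
    rw [freeGrading, pow_zero] at ha
    obtain ⟨c, rfl⟩ := Submodule.mem_one.1 ha
    simp only [AlgHom.commutes]
    rw [← Algebra.smul_def, Module.algebraMap_end_apply, sub_self]
    exact zero_mem _
  | succ n ih =>
    rw [freeGrading, pow_succ'] at ha
    suffices hle : Submodule.span k (Set.range (ι k)) * Submodule.span k (Set.range (ι k)) ^ n ≤
        (degreeLT lam (n + 1)).comap
        (LinearMap.applyₗ w ∘ₗ (FreeAlgebra.lift k (deformedGen lam α)).toLinearMap -
          LinearMap.mulRight k w ∘ₗ (smashInl k _).toLinearMap ∘ₗ (toDouble lam).toLinearMap) from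
      hle ha
    refine Submodule.mul_le.2 fun a ha b hb => ?_
    refine Submodule.span_induction ?_ ?_ ?_ ?_ ha
    · rintro _ ⟨j, rfl⟩
      have e := ih hb
      have hb' : smashInl k _ (toDouble lam b) * w ∈ doubleSmashGrading lam n := by
        have h := doubleSmashGrading_mul_mem lam (m := n) (n := 0)
          ⟨_, Submodule.apply_mem_map₂ (TensorProduct.mk k _ _) (toDouble_mem lam hb)
            (Submodule.mem_top (x := 1)), rfl⟩ hw
        exact h
      -- Two discrepancies add up: the deformed generator applied to the error for the shorter word,
      -- and its own deviation from multiplication on the leading term.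
      have e1 := deformedGen_mem_degreeLT lam α j e
      have e2 := deformedGen_sub_mem lam α j hb'
      have := add_mem e1 e2
      rw [map_sub, sub_add_sub_cancel] at this
      simpa [smashGen, mul_assoc] using this
    · simp
    · intro x y _ _ hx hy; rw [add_mul]; exact add_mem hx hy
    · intro c x _ hx; rw [smul_mul_assoc]; exact Submodule.smul_mem _ _ hx

/-- Acting on 1 shows the image in the graded algebra as the component of degree n. This symbol is
what separates elements of the deformation. -/
lemma deformedAction_one_sub_mem (α : k) {n : ℕ} {z : FreeSmash k}
    (hz : z ∈ smashGrading k (Sweedler k) (freeGrading k) n) :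
    deformedAction lam α z 1 - toDoubleSmash lam z ∈ degreeLT lam n := by
  suffices h : smashGrading k (Sweedler k) (freeGrading k) n ≤
      (degreeLT lam n).comap (LinearMap.applyₗ 1 ∘ₗ (deformedAction lam α).toLinearMap -
        (toDoubleSmash lam).toLinearMap) from h hz
  refine Submodule.map_le_iff_le_comap.2 (Submodule.map₂_le.2 fun a ha h _ => ?_)
  have := lift_deformedGen_sub_mem lam α ha (smashInr_mem lam h)
  rw [TwistedTensor.inl_mul_inr] at this
  simpa [deformedAction_of, toDoubleSmash_of, leftMulInr] using this

/-- The strict bound n + 1 means degree at most n: elements of Fₙ cannot raise 1 further. -/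
lemma deformedAction_one_mem (α : k) {n : ℕ} {z : FreeSmash k} (hz : z ∈ freeSmashFil k n) :
    deformedAction lam α z 1 ∈ degreeLT lam (n + 1) := by
  suffices h : freeSmashFil k n ≤ (degreeLT lam (n + 1)).comap
      (LinearMap.applyₗ 1 ∘ₗ (deformedAction lam α).toLinearMap) from h hz
  refine iSup₂_le fun m hm z hz => ?_
  have h1 := degreeLT_mono lam (by omega : m ≤ n + 1) (deformedAction_one_sub_mem lam α hz)
  have h2 := doubleSmashGrading_le_degreeLT lam (Nat.lt_succ_of_le hm) (toDoubleSmash_mem lam hz)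
  simpa using add_mem h1 h2

end Degrees

/-! ### Comparison of the associated graded algebra with the smash product -/

section AssociatedGraded

open Coalgebra Sweedler MvPolynomial
open FreeAlgebra (ι)

variable {k : Type*} [Field k]

namespace AlgFiltration

variable {D : Type*} [Ring D] [Algebra k D] (𝓕 : AlgFiltration k D)

lemma cls_eq_zero_iff {n : ℕ} (x : 𝓕.F n) : 𝓕.cls n x = 0 ↔ (x : D) ∈ 𝓕.prev n :=
  Submodule.Quotient.mk_eq_zero _

lemma cls_surjective (n : ℕ) : Function.Surjective (𝓕.cls n) := Submodule.mkQ_surjective _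

variable {𝓕} in
/-- If the filtered algebra `D` and the graded algebra `R` are images of a graded algebra `T`, and a
homogeneous element of degree `n` vanishes in `R` exactly if its image in `D` lies in `F_{n-1}`,
then `D` is a PBW deformation of `R`. -/
lemma isPBWDeformation_of_surjective {R T : Type*} [Ring R] [Algebra k R] [Ring T] [Algebra k T]
    {𝓡 : ℕ → Submodule k R} [GradedAlgebra 𝓡] {G : ℕ → Submodule k T} (hone : (1 : T) ∈ G 0)
    (hmul : ∀ {m n a b}, a ∈ G m → b ∈ G n → a * b ∈ G (m + n)) (q : T →ₐ[k] D) (p : T →ₐ[k] R)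
    (hq : ∀ {n z}, z ∈ G n → q z ∈ 𝓕.F n)
    (hq' : ∀ {n d}, d ∈ 𝓕.F n → ∃ z ∈ G n, q z - d ∈ 𝓕.prev n)
    (hp : ∀ {n z}, z ∈ G n → p z ∈ 𝓡 n) (hp' : ∀ {n w}, w ∈ 𝓡 n → ∃ z ∈ G n, p z = w)
    (h : ∀ {n z}, z ∈ G n → (p z = 0 ↔ q z ∈ 𝓕.prev n)) :
    𝓕.IsPBWDeformation 𝓡 := by
  let qn : ∀ n, G n →ₗ[k] 𝓕.Gr n := fun n => 𝓕.cls n ∘ₗ q.toLinearMap.restrict fun _ hz => hq hz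
  let pn : ∀ n, G n →ₗ[k] 𝓡 n := fun n => p.toLinearMap.restrict fun _ hz => hp hz
  have hqn : ∀ n (z : G n), qn n z = 𝓕.cls n ⟨q z, hq z.2⟩ := fun _ _ => rfl
  have hpn : ∀ n (z : G n), (pn n z : R) = p z := fun _ _ => rfl
  have qsurj : ∀ n, Function.Surjective (qn n) := by
    intro n d
    obtain ⟨d, rfl⟩ := 𝓕.cls_surjective n d
    obtain ⟨z, hz, hzd⟩ := hq' d.2
    refine ⟨⟨z, hz⟩, ?_⟩
    rw [hqn, ← sub_eq_zero, ← map_sub, cls_eq_zero_iff]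
    exact hzd
  have psurj : ∀ n, Function.Surjective (pn n) := by
    rintro n ⟨w, hw⟩
    obtain ⟨z, hz, rfl⟩ := hp' hw
    exact ⟨⟨z, hz⟩, rfl⟩
  have hker : ∀ n, LinearMap.ker (qn n) = LinearMap.ker (pn n) := by
    intro n
    ext z
    rw [LinearMap.mem_ker, LinearMap.mem_ker, hqn, cls_eq_zero_iff, ← h z.2, ← hpn,
      Submodule.coe_eq_zero]
  -- Both graded pieces are quotients of `G n` by the same kernel. Multiplicativity is then
  -- inherited from `T`.
  let φ : ∀ n, 𝓕.Gr n ≃ₗ[k] 𝓡 n := fun n =>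
    ((LinearMap.quotKerEquivOfSurjective _ (qsurj n)).symm.trans
      (Submodule.quotEquivOfEq _ _ (hker n))).trans (LinearMap.quotKerEquivOfSurjective _ (psurj n))
  have key : ∀ n z, (φ n (qn n z) : R) = p z := by
    intro n z
    have : (LinearMap.quotKerEquivOfSurjective _ (qsurj n)).symm (qn n z) =
        Submodule.Quotient.mk z := by
      rw [LinearEquiv.symm_apply_eq]; rfl
    simp only [φ, LinearEquiv.trans_apply]
    rw [this]
    rfl
  refine ⟨φ, ?_, fun m n a b => ?_⟩
  · have : 𝓕.cls 0 ⟨1, 𝓕.one_mem⟩ = qn 0 ⟨1, hone⟩ := by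
      rw [hqn]
      congr 2
      exact (map_one q).symm
    rw [this, key, map_one]
  · obtain ⟨a, rfl⟩ := qsurj m a
    obtain ⟨b, rfl⟩ := qsurj n b
    have : 𝓕.grMul m n (qn m a) (qn n b) = qn (m + n) ⟨a * b, hmul a.2 b.2⟩ := by
      rw [hqn, hqn, hqn, grMul_cls]
      congr 2
      exact (map_mul q _ _).symm
    rw [this, key, key, key, map_mul]

end AlgFiltration

section

variable {lam : k} {κ : relSpace lam →ₗ[k] Sweedler k}

lemma toDeformation_mem {n : ℕ} {z : FreeSmash k} (hz : z ∈ freeSmashFil k n) :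
    toDeformation lam κ z ∈ (deformationFiltration lam κ).F n := ⟨z, hz, rfl⟩

lemma toDeformation_rel (r : relSpace lam) :
    toDeformation lam κ (smashInl k _ (r : Free4 k)) = toDeformation lam κ (smashInr k _ (κ r)) :=
  RingQuot.mkAlgHom_rel k ⟨r, rfl, rfl⟩

lemma toDeformation_inl_mem {n : ℕ} {a : Free4 k} (ha : a ∈ freeGrading k n) :
    smashInl k _ a ∈ freeSmashFil k n :=
  smashGrading_le_fil le_rfl ⟨_, Submodule.apply_mem_map₂ (TensorProduct.mk k _ _) ha
    (Submodule.mem_top (x := 1)), rfl⟩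

lemma toDeformation_inr_mem (h : Sweedler k) : smashInr k (Free4 k) h ∈ freeSmashFil k 0 :=
  smashGrading_le_fil le_rfl ⟨_, Submodule.apply_mem_map₂ (TensorProduct.mk k _ _)
    freeGrading_isHMultiplicative.one_mem (Submodule.mem_top (x := h)), rfl⟩

/-- The span of the normal words of degree `n` in `k⟨u,v,u',v'⟩`, with coefficients in `T(2)`. -/
def normalWords (k : Type*) [Field k] (n : ℕ) : Submodule k (FreeSmash k) :=
  (tensorSub (monomialSpan k (ι k) n) (⊤ : Submodule k (Sweedler k))).map
    (TwistedTensor.of _).toLinearMap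

lemma monomialSpan_le_freeGrading (n : ℕ) : monomialSpan k (ι k) n ≤ freeGrading k n := by
  refine Submodule.span_le.2 ?_
  rintro _ ⟨a, b, c, d, rfl, rfl⟩
  have hι : ∀ j : Fin 4, ι k j ∈ Submodule.span k (Set.range (ι k (X := Fin 4))) :=
    fun j => Submodule.subset_span ⟨j, rfl⟩
  have hpow : ∀ (j : Fin 4) (a : ℕ), ι k j ^ a ∈ freeGrading k a := fun j a =>
    Submodule.pow_mem_pow _ (hι j) a
  have hm := fun {m n x y} => (freeGrading_isHMultiplicative (k := k)).mul_mem (m := m) (n := n)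
    (x := x) (y := y)
  have := hm (hm (hpow 0 a) (hpow 1 b)) (hm (hpow 2 c) (hpow 3 d))
  rwa [← add_assoc] at this

lemma normalWords_le (n : ℕ) : normalWords k n ≤ smashGrading k (Sweedler k) (freeGrading k) n :=
  Submodule.map_mono (Submodule.map₂_le_map₂_left (monomialSpan_le_freeGrading n))

/-- Straightening inside the deformation with errors in Fₙ₋₁: modulo Fₙ₋₁ every homogeneous element
equals a combination of normal words, with coefficients from T(2) on the right. -/
lemma exists_normalWords (hκ : ∀ i, toDeformation lam κ (smashInr k _ (κ (relElem lam i))) ∈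
      (deformationFiltration lam κ).F 0) {n : ℕ} {z : FreeSmash k}
    (hz : z ∈ smashGrading k (Sweedler k) (freeGrading k) n) :
    ∃ m ∈ normalWords k n, toDeformation lam κ (z - m) ∈ (deformationFiltration lam κ).prev n := by
  set 𝓕 := deformationFiltration lam κ with h𝓕
  set q := toDeformation lam κ with hq
  suffices hle : smashGrading k (Sweedler k) (freeGrading k) n ≤
      normalWords k n ⊔ (𝓕.prev n).comap q.toLinearMap by
    obtain ⟨m, hm, e, he, rfl⟩ := Submodule.mem_sup.1 (hle hz)
    exact ⟨m, hm, by rwa [add_sub_cancel_left]⟩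
  refine Submodule.map_le_iff_le_comap.2 (Submodule.map₂_le.2 fun a ha h _ => ?_)
  rw [Submodule.mem_comap, TensorProduct.mk_apply, LinearEquiv.coe_coe,
    ← TwistedTensor.inl_mul_inr]
  have hlift : FreeAlgebra.lift k (fun j => q (smashInl k _ (ι k j))) =
      q.comp (smashInl k _) := by
    apply FreeAlgebra.hom_ext
    funext j
    simp
  -- The relations qualify as errors of degree 2, because their values κ(rᵢ) lie in F₀ and so in F₁,
  -- which is `prev 2`.
  have key := lift_mem_monomialSpan_sup (F := 𝓕.F) (E := 𝓕.prev) (lam := lam)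
    (y := fun j => q (smashInl k _ (ι k j)))
    (fun j => toDeformation_mem (toDeformation_inl_mem (by
      rw [freeGrading, pow_one]; exact Submodule.subset_span ⟨j, rfl⟩)))
    𝓕.one_mem 𝓕.mul_mem 𝓕.mul_mem_prev_right 𝓕.mul_mem_prev_left (fun i => by
      rw [hlift]
      exact (toDeformation_rel (κ := κ) (relElem lam i)).symm ▸ 𝓕.mono (Nat.zero_le 1) (hκ i)) n ha
  have hmon : monomialSpan k (fun j => q (smashInl k _ (ι k j))) n ≤
      (monomialSpan k (ι k) n).map (q.comp (smashInl k _)).toLinearMap := by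
    refine Submodule.span_le.2 ?_
    rintro _ ⟨a, b, c, d, h, rfl⟩
    exact ⟨_, Submodule.subset_span ⟨a, b, c, d, h, rfl⟩, by simp⟩
  obtain ⟨_, hm', e, he, hsum⟩ := Submodule.mem_sup.1 key
  obtain ⟨m, hm, rfl⟩ := hmon hm'
  rw [hlift] at hsum
  refine Submodule.mem_sup.2 ⟨smashInl k _ m * smashInr k _ h, ?_,
    smashInl k _ a * smashInr k _ h - smashInl k _ m * smashInr k _ h, ?_, by abel⟩
  · rw [TwistedTensor.inl_mul_inr]
    exact ⟨_, Submodule.apply_mem_map₂ (TensorProduct.mk k _ _) hm Submodule.mem_top, rfl⟩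
  · rw [Submodule.mem_comap, AlgHom.toLinearMap_apply, ← sub_mul, map_mul]
    refine 𝓕.mul_mem_prev_left ?_ (toDeformation_mem (toDeformation_inr_mem h))
    rw [map_sub]
    have : q (smashInl k _ a) - q (smashInl k _ m) = e :=
      sub_eq_of_eq_add' hsum.symm
    rwa [this]

lemma freeSmashFil_succ (n : ℕ) : freeSmashFil k (n + 1) =
    smashGrading k (Sweedler k) (freeGrading k) (n + 1) ⊔ freeSmashFil k n := by
  apply le_antisymm
  · refine iSup₂_le fun m hm => ?_
    rcases hm.lt_or_eq with h | rfl
    · exact (smashGrading_le_fil (Nat.lt_succ_iff.1 h)).trans le_sup_right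
    · exact le_sup_left
  · exact sup_le (smashGrading_le_fil le_rfl) (freeSmashFil_mono (Nat.le_succ n))

lemma exists_sub_mem_prev {n : ℕ} {d : Deformation lam κ}
    (hd : d ∈ (deformationFiltration lam κ).F n) :
    ∃ z ∈ smashGrading k (Sweedler k) (freeGrading k) n,
      toDeformation lam κ z - d ∈ (deformationFiltration lam κ).prev n := by
  obtain ⟨y, hy, rfl⟩ := hd
  cases n with
  | zero =>
    -- In degree 0 `prev` is zero, so the preimage must be exact; it is, since nothing lies below
    -- degree 0.
    have : freeSmashFil k 0 ≤ smashGrading k (Sweedler k) (freeGrading k) 0 :=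
      iSup₂_le fun m hm => by rw [Nat.le_zero.1 hm]
    exact ⟨y, this hy, by rw [AlgHom.toLinearMap_apply, sub_self]; exact zero_mem _⟩
  | succ n =>
    rw [freeSmashFil_succ] at hy
    obtain ⟨z, hz, w, hw, rfl⟩ := Submodule.mem_sup.1 hy
    refine ⟨z, hz, ?_⟩
    rw [AlgHom.toLinearMap_apply, map_add, sub_add_cancel_left]
    exact neg_mem (toDeformation_mem hw)

end

variable [NeZero (2 : k)] (lam : k)

lemma toDouble_surjective : Function.Surjective (toDouble lam) := by
  intro w
  obtain ⟨t, rfl⟩ := (normalOrder_doubleGen_bijective lam).2 w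
  refine ⟨normalOrder (ι k) t, ?_⟩
  rw [map_normalOrder]
  simp

lemma toDoubleSmash_surjective : Function.Surjective (toDoubleSmash lam) := by
  intro w
  induction w using TwistedTensor.ind with
  | h0 => exact ⟨0, map_zero _⟩
  | ha x y hx hy =>
    obtain ⟨a, rfl⟩ := hx
    obtain ⟨b, rfl⟩ := hy
    exact ⟨a + b, map_add _ _ _⟩
  | ht a h =>
    obtain ⟨a, rfl⟩ := toDouble_surjective lam a
    exact ⟨_, toDoubleSmash_of lam a h⟩

/-- The projection onto B # T preserves degree. In an arbitrary preimage of a homogeneous element,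
only the component of degree n contributes to its image in degree n. -/
lemma exists_toDoubleSmash_eq {n : ℕ} {w : DoubleSmash lam} (hw : w ∈ doubleSmashGrading lam n) :
    ∃ z ∈ smashGrading k (Sweedler k) (freeGrading k) n, toDoubleSmash lam z = w := by
  set S : Submodule k (FreeSmash k) := ((smashGrading k (Sweedler k) (freeGrading k) n).map
    (toDoubleSmash lam).toLinearMap).comap
      (GradedAlgebra.proj (doubleSmashGrading lam) n ∘ₗ (toDoubleSmash lam).toLinearMap) with hS
  have hle : ∀ m, smashGrading k (Sweedler k) (freeGrading k) m ≤ S := by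
    intro m z hz
    rw [hS, Submodule.mem_comap, LinearMap.comp_apply, AlgHom.toLinearMap_apply]
    by_cases hmn : m = n
    · subst hmn
      rw [proj_of_mem lam (toDoubleSmash_mem lam hz)]
      exact ⟨z, hz, rfl⟩
    · rw [proj_of_mem_ne lam (toDoubleSmash_mem lam hz) hmn]
      exact zero_mem _
  obtain ⟨z, rfl⟩ := toDoubleSmash_surjective lam w
  obtain ⟨m, hm⟩ := freeSmashFil_exhaustive z
  have hz : z ∈ S := (iSup₂_le fun i _ => hle i : freeSmashFil k m ≤ S) hm
  rw [hS, Submodule.mem_comap, LinearMap.comp_apply, AlgHom.toLinearMap_apply,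
    proj_of_mem lam hw] at hz
  exact hz

variable {lam} {κ : relSpace lam →ₗ[k] Sweedler k}

/-- An element of Fₙ₋₁ sends 1 into degrees below n, while `z` sends 1 to its symbol in degree n
plus lower terms. So the symbol is zero: passing to the deformation loses nothing. -/
lemma toDoubleSmash_eq_zero_of_mem_prev {α : k} (h3 : κ (relElem lam 3) = algebraMap k _ α)
    (h0 : ∀ i, i ≠ 3 → κ (relElem lam i) = 0) {n : ℕ} {z : FreeSmash k}
    (hz : z ∈ smashGrading k (Sweedler k) (freeGrading k) n)
    (h : toDeformation lam κ z ∈ (deformationFiltration lam κ).prev n) :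
    toDoubleSmash lam z = 0 := by
  apply eq_zero_of_mem_degreeLT lam (toDoubleSmash_mem lam hz)
  have h1 := deformedAction_one_sub_mem lam α hz
  have h2 : deformedAction lam α z 1 ∈ degreeLT lam n := by
    rw [← deformationAction_toDeformation h3 h0]
    cases n with
    | zero =>
      rw [(Submodule.mem_bot k).1 h, map_zero]
      exact zero_mem _
    | succ n =>
      obtain ⟨y, hy, hyz⟩ := h
      rw [← hyz]
      change deformationAction h3 h0 (toDeformation lam κ y) 1 ∈ _
      rw [deformationAction_toDeformation]
      exact deformedAction_one_mem lam α hy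
  simpa using sub_mem h2 h1

/-- Normal words go to the basis of ordered monomials in the braided product, and tensoring with
T(2) preserves this. -/
lemma eq_zero_of_mem_normalWords {n : ℕ} {z : FreeSmash k} (hz : z ∈ normalWords k n)
    (h : toDoubleSmash lam z = 0) : z = 0 := by
  have hle : normalWords k n ≤ LinearMap.range ((TwistedTensor.of _).toLinearMap ∘ₗ
      (normalOrder (k := k) (ι k)).rTensor (Sweedler k)) := by
    refine Submodule.map_le_iff_le_comap.2 (Submodule.map₂_le.2 fun a ha h _ => ?_)
    obtain ⟨t, rfl⟩ := monomialSpan_le_range (k := k) _ _ ha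
    exact ⟨t ⊗ₜ h, by simp⟩
  obtain ⟨t, rfl⟩ := hle hz
  have e : (toDoubleSmash lam).toLinearMap ∘ₗ (TwistedTensor.of _).toLinearMap ∘ₗ
      (normalOrder (k := k) (ι k)).rTensor (Sweedler k) =
      (TwistedTensor.of _).toLinearMap ∘ₗ
        (LinearEquiv.ofBijective _ (normalOrder_doubleGen_bijective lam)).toLinearMap.rTensor _ := by
    apply TensorProduct.ext'
    intro t h
    simp only [LinearMap.comp_apply, LinearMap.rTensor_tmul, LinearEquiv.coe_coe,
      AlgHom.toLinearMap_apply, toDoubleSmash_of, map_normalOrder, toDouble_ι]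
    rfl
  have e' := congrArg (fun f => f t) e
  have hinj : Function.Injective ((TwistedTensor.of (smashTwist k (Sweedler k) (Double lam))) ∘
      (LinearEquiv.ofBijective _ (normalOrder_doubleGen_bijective lam)).rTensor (Sweedler k)) :=
    (LinearEquiv.injective _).comp (LinearEquiv.injective _)
  have ht : t = 0 := by
    apply hinj
    refine (e'.symm.trans h).trans ?_
    simp
  rw [ht, map_zero]

/-- For the converse, let m be a combination of normal words congruent to `z` modulo Fₙ₋₁. The
direction already known shows that z and m have the same symbol, here zero, so m = 0 and `z` itself
falls into Fₙ₋₁. -/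
lemma toDoubleSmash_eq_zero_iff {α : k} (h3 : κ (relElem lam 3) = algebraMap k _ α)
    (h0 : ∀ i, i ≠ 3 → κ (relElem lam i) = 0) {n : ℕ} {z : FreeSmash k}
    (hz : z ∈ smashGrading k (Sweedler k) (freeGrading k) n) :
    toDoubleSmash lam z = 0 ↔
      toDeformation lam κ z ∈ (deformationFiltration lam κ).prev n := by
  refine ⟨fun h => ?_, toDoubleSmash_eq_zero_of_mem_prev h3 h0 hz⟩
  obtain ⟨m, hm, hzm⟩ := exists_normalWords
    (fun i => toDeformation_mem (toDeformation_inr_mem _)) hz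
  have h1 := toDoubleSmash_eq_zero_of_mem_prev h3 h0 (sub_mem hz (normalWords_le n hm)) hzm
  rw [map_sub, h, zero_sub, neg_eq_zero] at h1
  rwa [eq_zero_of_mem_normalWords hm h1, sub_zero] at hzm

lemma isPBWDeformation_of_eq {α : k} (h3 : κ (relElem lam 3) = algebraMap k _ α)
    (h0 : ∀ i, i ≠ 3 → κ (relElem lam i) = 0) :
    (deformationFiltration lam κ).IsPBWDeformation (doubleSmashGrading lam) :=
  AlgFiltration.isPBWDeformation_of_surjective
    (G := smashGrading k (Sweedler k) (freeGrading k))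
    (smashGrading_one_mem freeGrading_isHMultiplicative)
    (smashGrading_mul_mem freeGrading_isHMultiplicative)
    (toDeformation lam κ) (toDoubleSmash lam)
    (fun hz => toDeformation_mem (smashGrading_le_fil le_rfl hz)) exists_sub_mem_prev
    (toDoubleSmash_mem lam) (exists_toDoubleSmash_eq lam)
    (fun hz => toDoubleSmash_eq_zero_iff h3 h0 hz)

end AssociatedGraded

/-! ### Independence in degrees 0 and 1 determines κ -/

section Consequences

open Coalgebra Sweedler
open FreeAlgebra (ι)

variable {k : Type*} [Field k]

/-- Every relation is an eigenvector of g, with sign given by the parity of the number of letters v,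
v'. The value of κ has to carry the same sign under conjugation by g. -/
lemma freeG_rel (lam : k) (i : Fin 6) :
    freeG k (rel lam i) = (![-1, -1, -1, 1, 1, -1] i : k) • rel lam i := by
  fin_cases i <;> simp [rel] <;> abel

lemma freeX_rel_two (lam : k) : freeX k (rel lam 2) = rel lam 4 := by
  simp [rel]

lemma freeX_rel_three (lam : k) : freeX k (rel lam 3) = rel lam 2 - rel lam 5 := by
  simp [rel]
  abel

lemma comb_eq_zero {a b : k} (h : a • (1 : Sweedler k) + b • g k = 0) : a = 0 ∧ b = 0 := by
  have e1 := congrArg QuaternionAlgebra.re h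
  have e2 := congrArg QuaternionAlgebra.imI h
  simp [g] at e1 e2
  exact ⟨e1, e2⟩

variable {D : Type*} [Ring D] [Algebra k D] {y : Fin 4 → D} {j : Sweedler k →ₐ[k] D}

lemma g_mul_lift (hg : ∀ i, j (g k) * y i = ![y 0, -y 1, y 2, -y 3] i * j (g k))
    (hx : ∀ i, j (x k) * y i = ![0, y 0, 0, y 2] i + ![y 0, -y 1, y 2, -y 3] i * j (x k))
    (a : Free4 k) : j (g k) * FreeAlgebra.lift k y a = FreeAlgebra.lift k y (freeG k a) * j (g k) := by
  have h1 : ∀ a, freeSmashLift y j hg hx (smashInl k _ a) = FreeAlgebra.lift k y a := fun a => by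
    rw [TwistedTensor.inl_apply, freeSmashLift_of, map_one, mul_one]
  have h2 : ∀ h, freeSmashLift y j hg hx (smashInr k _ h) = j h := fun h => by
    rw [TwistedTensor.inr_apply, freeSmashLift_of, map_one, one_mul]
  have := congrArg (freeSmashLift y j hg hx) (smashInr_g_mul a)
  simpa only [map_mul, h1, h2, free_g] using this

lemma x_mul_lift (hg : ∀ i, j (g k) * y i = ![y 0, -y 1, y 2, -y 3] i * j (g k))
    (hx : ∀ i, j (x k) * y i = ![0, y 0, 0, y 2] i + ![y 0, -y 1, y 2, -y 3] i * j (x k))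
    (a : Free4 k) : j (x k) * FreeAlgebra.lift k y a =
      FreeAlgebra.lift k y (freeX k a) + FreeAlgebra.lift k y (freeG k a) * j (x k) := by
  have h1 : ∀ a, freeSmashLift y j hg hx (smashInl k _ a) = FreeAlgebra.lift k y a := fun a => by
    rw [TwistedTensor.inl_apply, freeSmashLift_of, map_one, mul_one]
  have h2 : ∀ h, freeSmashLift y j hg hx (smashInr k _ h) = j h := fun h => by
    rw [TwistedTensor.inr_apply, freeSmashLift_of, map_one, one_mul]
  have := congrArg (freeSmashLift y j hg hx) (smashInr_x_mul a)
  simpa only [map_mul, map_add, h1, h2, free_g, free_x] using this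

variable [NeZero (2 : k)]

/-- Conjugation by g fixes 1 and g and negates x and gx. As 2 is invertible, the two eigenspaces are
separated. -/
lemma eq_of_g_anticomm {h : Sweedler k} (hh : g k * h = -(h * g k)) :
    h = h.imJ • x k + h.imK • (g k * x k) := by
  have h2 : (2 : k) ≠ 0 := NeZero.ne _
  have e1 := congrArg QuaternionAlgebra.re hh
  have e2 := congrArg QuaternionAlgebra.imI hh
  simp [g] at e1 e2
  have r1 : h.imI = 0 := by
    have : 2 * h.imI = 0 := by linear_combination e1
    exact (mul_eq_zero.1 this).resolve_left h2
  have r2 : h.re = 0 := by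
    have : 2 * h.re = 0 := by linear_combination e2
    exact (mul_eq_zero.1 this).resolve_left h2
  conv_lhs => rw [eq_comb h]
  rw [r1, r2]
  simp

lemma eq_of_g_comm {h : Sweedler k} (hh : g k * h = h * g k) :
    h = h.re • 1 + h.imI • g k := by
  have h2 : (2 : k) ≠ 0 := NeZero.ne _
  have e1 := congrArg QuaternionAlgebra.imJ hh
  have e2 := congrArg QuaternionAlgebra.imK hh
  simp [g] at e1 e2
  have r1 : h.imK = 0 := by
    have : 2 * h.imK = 0 := by linear_combination e1
    exact (mul_eq_zero.1 this).resolve_left h2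
  have r2 : h.imJ = 0 := by
    have : 2 * h.imJ = 0 := by linear_combination e2
    exact (mul_eq_zero.1 this).resolve_left h2
  conv_lhs => rw [eq_comb h]
  rw [r1, r2]
  simp

/-- A relation between `v, v'` and the skew-primitive part of `T(2)`, in degree one. -/
lemma eq_zero_of_anticomm
    (hg : ∀ i, j (g k) * y i = ![y 0, -y 1, y 2, -y 3] i * j (g k))
    (hx : ∀ i, j (x k) * y i = ![0, y 0, 0, y 2] i + ![y 0, -y 1, y 2, -y 3] i * j (x k))
    (hind : ∀ h : Fin 4 → Sweedler k, ∑ i, y i * j (h i) = 0 → h = 0) {p q : Sweedler k}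
    (hp : g k * p = -(p * g k)) (hq : g k * q = -(q * g k))
    (h : j p * y 3 + y 3 * j p + (y 1 * j q + j q * y 1) = 0) : p = 0 ∧ q = 0 := by
  have g1 : j (g k) * y 1 = -y 1 * j (g k) := hg 1
  have g3 : j (g k) * y 3 = -y 3 * j (g k) := hg 3
  have g0 : j (g k) * y 0 = y 0 * j (g k) := hg 0
  have g2 : j (g k) * y 2 = y 2 * j (g k) := hg 2
  have x1 : j (x k) * y 1 = y 0 + -y 1 * j (x k) := hx 1
  have x3 : j (x k) * y 3 = y 2 + -y 3 * j (x k) := hx 3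
  have g1' : ∀ w, j (g k) * (y 1 * w) = -(y 1 * (j (g k) * w)) := fun w => by
    rw [← mul_assoc, g1, neg_mul, neg_mul, mul_assoc]
  have g3' : ∀ w, j (g k) * (y 3 * w) = -(y 3 * (j (g k) * w)) := fun w => by
    rw [← mul_assoc, g3, neg_mul, neg_mul, mul_assoc]
  rw [eq_of_g_anticomm hp, eq_of_g_anticomm hq] at h ⊢
  generalize p.imJ = a at *
  generalize p.imK = b at *
  generalize q.imJ = c at *
  generalize q.imK = d at *
  -- Put p = ax + b·gx and q = cx + d·gx. From xv' = u' - v'x one gets pv' + v'p = u'(a + bg) +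
  -- v'(2b·gx), and likewise qv + vq = u(c + dg) + v(2d·gx). The listed entries are these right
  -- coefficients.
  have h0 := hind ![c • 1 + d • g k, (2 * d) • (g k * x k), a • 1 + b • g k,
    (2 * b) • (g k * x k)] (by
    rw [← h, Fin.sum_univ_four]
    simp only [map_add, map_smul, map_mul, map_one, add_mul, smul_mul_assoc, mul_assoc, x1, x3, g0, g2,
      g1', g3', Matrix.cons_val, mul_add, mul_smul_comm, mul_one, neg_mul, mul_neg]
    module)
  obtain ⟨rfl, rfl⟩ := comb_eq_zero (congrFun h0 0)
  obtain ⟨rfl, rfl⟩ := comb_eq_zero (congrFun h0 2)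
  simp

/-- The values of `κ` are forced by the independence of the elements of degree at most one. -/
lemma relation_values_of_independent {lam : k}
    (hg : ∀ i, j (g k) * y i = ![y 0, -y 1, y 2, -y 3] i * j (g k))
    (hx : ∀ i, j (x k) * y i = ![0, y 0, 0, y 2] i + ![y 0, -y 1, y 2, -y 3] i * j (x k))
    (hj : Function.Injective j)
    (hind : ∀ h : Fin 4 → Sweedler k, ∑ i, y i * j (h i) = 0 → h = 0) {c : Fin 6 → Sweedler k}
    (hrel : ∀ i, FreeAlgebra.lift k y (rel lam i) = j (c i)) :
    ∃ α : k, c 3 = algebraMap k (Sweedler k) α ∧ ∀ i, i ≠ 3 → c i = 0 := by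
  have h2 : (2 : k) ≠ 0 := NeZero.ne _
  -- The relations hold in `D` with values `c i`, so moving g past them is an identity between
  -- images of T(2), where `j` is injective.
  have hgc : ∀ i, g k * c i = (![-1, -1, -1, 1, 1, -1] i : k) • (c i * g k) := by
    intro i
    apply hj
    have := g_mul_lift hg hx (rel lam i)
    rwa [freeG_rel, map_smul, hrel, smul_mul_assoc, ← map_mul, ← map_mul, ← map_smul] at this
  have a0 : g k * c 0 = -(c 0 * g k) := by simpa using hgc 0
  have a1 : g k * c 1 = -(c 1 * g k) := by simpa using hgc 1
  have a2 : g k * c 2 = -(c 2 * g k) := by simpa using hgc 2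
  have a3 : g k * c 3 = c 3 * g k := by simpa using hgc 3
  have a5 : g k * c 5 = -(c 5 * g k) := by simpa using hgc 5
  have hx2 : x k * c 2 = c 4 - c 2 * x k := by
    apply hj
    have := x_mul_lift hg hx (rel lam 2)
    rw [freeX_rel_two, freeG_rel, map_smul, hrel, hrel] at this
    rw [map_mul, this, map_sub, map_mul]
    simp [sub_eq_add_neg]
  have hx3 : x k * c 3 = c 2 - c 5 + c 3 * x k := by
    apply hj
    have := x_mul_lift hg hx (rel lam 3)
    rw [freeX_rel_three, freeG_rel, map_smul, map_sub, hrel, hrel, hrel] at this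
    rw [map_mul, this, map_add, map_mul, map_sub]
    simp
  -- κ(r₃) is a combination of x and gx, which x annihilates on both sides. Hence x·r₃ = r₅ forces
  -- the value of r₅ to vanish.
  have c4 : c 4 = 0 := by
    have h := eq_of_g_anticomm a2
    rw [h] at hx2
    simp only [mul_add, add_mul, mul_smul_comm, smul_mul_assoc, x_mul_x, x_mul_g_mul_x, mul_assoc,
      mul_zero, smul_zero, add_zero, sub_zero] at hx2
    exact hx2.symm
  have r0 := hrel 0
  have r1 := hrel 1
  have r2 := hrel 2
  have r3 := hrel 3
  have r4 := hrel 4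
  have r5 := hrel 5
  rw [c4, map_zero] at r4
  simp only [rel, Matrix.cons_val, map_sub, map_add, map_mul, map_smul, FreeAlgebra.lift_ι_apply]
    at r0 r1 r2 r3 r4 r5
  -- κ(r₄) is a combination of 1 and g, so it commutes with the even generators u and u'.
  have comm : ∀ i, j (g k) * y i = y i * j (g k) → y i * j (c 3) - j (c 3) * y i = 0 := by
    intro i hi
    rw [eq_of_g_comm a3]
    simp only [map_add, map_smul, map_one, mul_add, add_mul, mul_smul_comm, smul_mul_assoc, hi,
      mul_one, one_mul, sub_self]
  have m0 := comm 0 (hg 0)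
  have m2 := comm 2 (hg 2)
  -- In the free algebra r₁v' + v'r₁ + vr₃ + r₃v = u(vv' + v'v) - (vv' + v'v)u, which is [u, r₄] +
  -- λu·r₅. The right side has value 0, which leaves an identity of degree one between κ(r₁) and
  -- κ(r₃).
  have e0 : j (c 0) * y 3 + y 3 * j (c 0) + (y 1 * j (c 2) + j (c 2) * y 1) = 0 := by
    have : j (c 0) * y 3 + y 3 * j (c 0) + (y 1 * j (c 2) + j (c 2) * y 1) =
        (y 0 * j (c 3) - j (c 3) * y 0) + lam • (y 0 * (y 0 * y 2 - y 2 * y 0)) := by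
      rw [← r0, ← r2, ← r3]
      simp only [mul_add, add_mul, mul_sub, sub_mul, mul_smul_comm, smul_mul_assoc, mul_assoc]
      module
    rw [this, m0, r4]
    simp
  -- The analogous expansion of [u', r₄]. Since r₆ = vu' - u'v has the opposite orientation to r₁
  -- with u' in place of u, its value enters with a minus sign.
  have e2 : j (-c 5) * y 3 + y 3 * j (-c 5) + (y 1 * j (c 1) + j (c 1) * y 1) = 0 := by
    have : j (-c 5) * y 3 + y 3 * j (-c 5) + (y 1 * j (c 1) + j (c 1) * y 1) =
        (y 2 * j (c 3) - j (c 3) * y 2) - lam • ((y 0 * y 2 - y 2 * y 0) * y 2) := by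
      rw [map_neg, ← r5, ← r1, ← r3]
      simp only [mul_add, add_mul, mul_sub, sub_mul, mul_smul_comm, smul_mul_assoc, mul_assoc,
        mul_neg, neg_mul]
      module
    rw [this, m2, r4]
    simp
  obtain ⟨z0, z2⟩ := eq_zero_of_anticomm hg hx hind a0 a2 e0
  obtain ⟨z5, z1⟩ := eq_zero_of_anticomm hg hx hind (p := -c 5) (by simp [a5]) a1 e2
  rw [neg_eq_zero] at z5
  -- With κ(r₃) = κ(r₆) = 0, x commutes with κ(r₄). As x anticommutes with g, twice the coefficient
  -- of g is zero, and a scalar remains.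
  have z3 : c 3 = algebraMap k _ (c 3).re := by
    have h := eq_of_g_comm a3
    rw [z2, z5, sub_zero, zero_add] at hx3
    have hK := congrArg QuaternionAlgebra.imK hx3
    simp [x] at hK
    have hI : (c 3).imI = 0 := by
      have : 2 * (c 3).imI = 0 := by linear_combination -hK
      exact (mul_eq_zero.1 this).resolve_left h2
    rw [hI, zero_smul, add_zero] at h
    rwa [Algebra.algebraMap_eq_smul_one]
  refine ⟨_, z3, fun i hi => ?_⟩
  fin_cases i
  exacts [z0, z1, z2, absurd rfl hi, c4, z5]

end Consequences

/-! ### The PBW property in degrees 0 and 1, and necessity -/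

section Independence

open Coalgebra Sweedler MvPolynomial
open FreeAlgebra (ι)

variable {k : Type*} [Field k]

/-- In a PBW deformation, elements of degree `n` are as independent modulo `F_{n-1}` as the
corresponding elements of the graded algebra. -/
lemma AlgFiltration.IsPBWDeformation.eq_zero_of_mem_prev {D R M : Type*} [Ring D] [Algebra k D]
    [Ring R] [Algebra k R] [AddCommGroup M] [Module k M] [FiniteDimensional k M]
    {𝓕 : AlgFiltration k D} {𝓡 : ℕ → Submodule k R} [GradedAlgebra 𝓡]
    (h : 𝓕.IsPBWDeformation 𝓡) {n : ℕ} {c : M →ₗ[k] D} (hc : ∀ m, c m ∈ 𝓕.F n)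
    (hc' : ∀ d ∈ 𝓕.F n, ∃ m, c m - d ∈ 𝓕.prev n) {t : M →ₗ[k] R} (ht : ∀ m, t m ∈ 𝓡 n)
    (htinj : Function.Injective t) {m : M} (hm : c m ∈ 𝓕.prev n) : m = 0 := by
  obtain ⟨φ, -, -⟩ := h
  let s : M →ₗ[k] 𝓡 n := (φ n).toLinearMap ∘ₗ 𝓕.cls n ∘ₗ c.codRestrict _ hc
  have hs : Function.Surjective s := by
    refine (φ n).surjective.comp fun d => ?_
    obtain ⟨d, rfl⟩ := 𝓕.cls_surjective n d
    obtain ⟨m, hm⟩ := hc' d d.2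
    refine ⟨m, ?_⟩
    rw [LinearMap.comp_apply, ← sub_eq_zero, ← map_sub, cls_eq_zero_iff]
    exact hm
  have hfin : FiniteDimensional k (𝓡 n) := Module.Finite.of_surjective s hs
  -- `M` embeds into the degree n part of `R` by `t` and surjects onto it through Fₙ/Fₙ₋₁. The
  -- dimensions are therefore equal and the surjection is injective. The isomorphism need not
  -- respect generators.
  have hle := LinearMap.finrank_le_finrank_of_injective (f := t.codRestrict _ ht)
    (fun a b hab => htinj (congrArg Subtype.val hab))
  have hge := LinearMap.finrank_le_finrank_of_surjective hs
  have hinj := (LinearMap.injective_iff_surjective_of_finrank_eq_finrank (le_antisymm hle hge)).2 hs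
  apply hinj
  rw [map_zero]
  have : 𝓕.cls n (c.codRestrict _ hc m) = 0 := (𝓕.cls_eq_zero_iff _).2 hm
  simp [s, this]

lemma normalOrder_one {D : Type*} [Ring D] [Algebra k D] (y : Fin 4 → D) :
    normalOrder (k := k) y (1 ⊗ₜ 1) = 1 := by
  simpa using normalOrder_pow (k := k) y 0 0 0 0

lemma normalOrder_gen {D : Type*} [Ring D] [Algebra k D] (y : Fin 4 → D) (i : Fin 4) :
    normalOrder (k := k) y (![X 0 ⊗ₜ 1, X 1 ⊗ₜ 1, 1 ⊗ₜ X 0, 1 ⊗ₜ X 1] i) = y i := by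
  fin_cases i
  · simpa using normalOrder_pow (k := k) y 1 0 0 0
  · simpa using normalOrder_pow (k := k) y 0 1 0 0
  · simpa using normalOrder_pow (k := k) y 0 0 1 0
  · simpa using normalOrder_pow (k := k) y 0 0 0 1

lemma smashGrading_zero_le : smashGrading k (Sweedler k) (freeGrading k) 0 ≤
    LinearMap.range (smashInr k (Free4 k)).toLinearMap := by
  refine Submodule.map_le_iff_le_comap.2 (Submodule.map₂_le.2 fun a ha h _ => ?_)
  rw [freeGrading, pow_zero] at ha
  obtain ⟨c, rfl⟩ := Submodule.mem_one.1 ha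
  refine ⟨c • h, ?_⟩
  rw [TensorProduct.mk_apply, Algebra.algebraMap_eq_smul_one, TensorProduct.smul_tmul]
  rfl

/-- `(hᵢ) ↦ ∑ yᵢ hᵢ`. -/
def sumGen {D : Type*} [Ring D] [Algebra k D] (y : Fin 4 → D) (j : Sweedler k →ₐ[k] D) :
    (Fin 4 → Sweedler k) →ₗ[k] D :=
  ∑ i, LinearMap.mulLeft k (y i) ∘ₗ j.toLinearMap ∘ₗ LinearMap.proj i

lemma sumGen_apply {D : Type*} [Ring D] [Algebra k D] (y : Fin 4 → D) (j : Sweedler k →ₐ[k] D)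
    (h : Fin 4 → Sweedler k) : sumGen y j h = ∑ i, y i * j (h i) := by
  simp [sumGen]

lemma exists_smashInr_eq {z : FreeSmash k}
    (hz : z ∈ smashGrading k (Sweedler k) (freeGrading k) 0) :
    ∃ h, smashInr k (Free4 k) h = z := smashGrading_zero_le hz

lemma smashGrading_one_le : smashGrading k (Sweedler k) (freeGrading k) 1 ≤
    LinearMap.range (sumGen (fun i => smashInl k (Free4 k) (ι k i)) (smashInr k (Free4 k))) := by
  refine Submodule.map_le_iff_le_comap.2 (Submodule.map₂_le.2 fun a ha h _ => ?_)
  rw [freeGrading, pow_one] at ha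
  refine Submodule.span_induction ?_ ?_ ?_ ?_ ha
  · rintro _ ⟨i, rfl⟩
    refine ⟨Pi.single i h, ?_⟩
    rw [sumGen_apply, Finset.sum_eq_single i]
    · rw [Pi.single_eq_same, TwistedTensor.inl_mul_inr]; rfl
    · intro i' _ hi; simp [Pi.single_eq_of_ne hi]
    · simp
  · simp
  · intro a b _ _ ha hb
    rw [map_add, LinearMap.add_apply]
    exact add_mem ha hb
  · intro c a _ ha
    rw [map_smul, LinearMap.smul_apply]
    exact Submodule.smul_mem _ _ ha

lemma exists_sumGen_eq {z : FreeSmash k}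
    (hz : z ∈ smashGrading k (Sweedler k) (freeGrading k) 1) :
    ∃ h : Fin 4 → Sweedler k, ∑ i, smashInl k (Free4 k) (ι k i) * smashInr k _ (h i) = z := by
  obtain ⟨h, hh⟩ := smashGrading_one_le hz
  exact ⟨h, (sumGen_apply _ _ _).symm.trans hh⟩

lemma exists_inr_sub_mem_prev {lam : k} {κ : relSpace lam →ₗ[k] Sweedler k} {d : Deformation lam κ}
    (hd : d ∈ (deformationFiltration lam κ).F 0) :
    ∃ h, toDeformation lam κ (smashInr k _ h) - d ∈ (deformationFiltration lam κ).prev 0 := by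
  obtain ⟨z, hz, hzd⟩ := exists_sub_mem_prev hd
  obtain ⟨h, hh⟩ := exists_smashInr_eq hz
  exact ⟨h, by rwa [hh]⟩

lemma exists_sum_sub_mem_prev {lam : k} {κ : relSpace lam →ₗ[k] Sweedler k} {d : Deformation lam κ}
    (hd : d ∈ (deformationFiltration lam κ).F 1) :
    ∃ h : Fin 4 → Sweedler k, ∑ i, toDeformation lam κ (smashInl k _ (ι k i)) *
      toDeformation lam κ (smashInr k _ (h i)) - d ∈ (deformationFiltration lam κ).prev 1 := by
  obtain ⟨z, hz, hzd⟩ := exists_sub_mem_prev hd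
  obtain ⟨h, hh⟩ := exists_sumGen_eq hz
  refine ⟨h, ?_⟩
  simp only [← map_mul]
  rwa [← map_sum, hh]

variable [NeZero (2 : k)] (lam : k)

/-- The functional on `A ⊗^c A^{op_c}` reading off the coefficient of a normal monomial. -/
def doubleCoeff (m m' : Fin 2 →₀ ℕ) : Double lam →ₗ[k] k :=
  LinearMap.mul' k k ∘ₗ TensorProduct.map (lcoeff k m) (lcoeff k m') ∘ₗ
    (LinearEquiv.ofBijective _ (normalOrder_doubleGen_bijective lam)).symm.toLinearMap

lemma doubleCoeff_normalOrder (m m' : Fin 2 →₀ ℕ) (p p' : Plane k) :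
    doubleCoeff lam m m' (normalOrder (doubleGen lam) (p ⊗ₜ p')) = coeff m p * coeff m' p' := by
  have : (LinearEquiv.ofBijective _ (normalOrder_doubleGen_bijective lam)).symm
      (normalOrder (doubleGen lam) (p ⊗ₜ p')) = p ⊗ₜ p' := by
    rw [LinearEquiv.symm_apply_eq]; rfl
  simp only [doubleCoeff, LinearMap.comp_apply, LinearEquiv.coe_coe, this]
  simp

/-- The functionals dual to the generators. -/
def genCoeff (i : Fin 4) : Double lam →ₗ[k] k :=
  ![doubleCoeff lam (Finsupp.single 0 1) 0, doubleCoeff lam (Finsupp.single 1 1) 0,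
    doubleCoeff lam 0 (Finsupp.single 0 1), doubleCoeff lam 0 (Finsupp.single 1 1)] i

lemma genCoeff_gen (i j : Fin 4) : genCoeff lam i (doubleGen lam j) = if j = i then 1 else 0 := by
  rw [← normalOrder_gen (k := k) (doubleGen lam) j]
  fin_cases i <;> fin_cases j <;>
    simp [genCoeff, doubleCoeff_normalOrder, coeff_X, coeff_one, Finsupp.single_left_inj]

/-- The functionals dual to the generators, applied to the factor B of B ⊗ T(2), read off each
coefficient. -/
lemma sum_smashGen_injective : Function.Injective (fun h : Fin 4 → Sweedler k =>
    ∑ i, smashGen lam i * smashInr k (Double lam) (h i)) := by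
  intro h h' hh
  funext i
  have key : ∀ h : Fin 4 → Sweedler k, TensorProduct.lid k _ ((genCoeff lam i).rTensor _
      ((TwistedTensor.of (smashTwist k (Sweedler k) (Double lam))).symm
        (∑ i, smashGen lam i * smashInr k (Double lam) (h i)))) = h i := by
    intro h
    simp only [smashGen, TwistedTensor.inl_mul_inr, map_sum, LinearEquiv.symm_apply_apply,
      LinearMap.rTensor_tmul, genCoeff_gen, TensorProduct.lid_tmul]
    simp
  rw [← key h, ← key h']
  exact congrArg (fun w => TensorProduct.lid k _ ((genCoeff lam i).rTensor _
      ((TwistedTensor.of (smashTwist k (Sweedler k) (Double lam))).symm w))) hh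

/-- The coefficient of the monomial 1 in the factor B recovers `h`. -/
lemma smashInr_double_injective : Function.Injective (smashInr k (Double lam)) := by
  intro h h' hh
  have key : ∀ h : Sweedler k, TensorProduct.lid k _ ((doubleCoeff lam 0 0).rTensor _
      ((TwistedTensor.of (smashTwist k (Sweedler k) (Double lam))).symm
        (smashInr k (Double lam) h))) = h := by
    intro h
    rw [TwistedTensor.inr_apply, LinearEquiv.symm_apply_apply, LinearMap.rTensor_tmul,
      ← normalOrder_one (k := k) (doubleGen lam), doubleCoeff_normalOrder]
    simp
  rw [← key h, ← key h', hh]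

variable {lam} {κ : relSpace lam →ₗ[k] Sweedler k}

/-- The PBW property is used only in degrees 0 and 1, through the spaces T(2) and T(2)⁴. In degree 0
it makes T(2) embed, and in degree 1 it makes u, v, u', v' right independent over T(2). The values
of κ are then forced. -/
lemma eq_of_isPBWDeformation
    (hP : (deformationFiltration lam κ).IsPBWDeformation (doubleSmashGrading lam)) :
    ∃ α : k, κ (relElem lam 3) = algebraMap k (Sweedler k) α ∧
      ∀ i, i ≠ 3 → κ (relElem lam i) = 0 := by
  set q := toDeformation lam κ with hq
  set y : Fin 4 → Deformation lam κ := fun i => q (smashInl k _ (ι k i)) with hy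
  set j : Sweedler k →ₐ[k] Deformation lam κ := q.comp (smashInr k _) with hj
  have hlift : FreeAlgebra.lift k y = q.comp (smashInl k _) := by
    apply FreeAlgebra.hom_ext
    funext i
    simp [hy]
  have hg : ∀ i, j (g k) * y i = ![y 0, -y 1, y 2, -y 3] i * j (g k) := by
    intro i
    have := congrArg q (smashInr_g_mul (ι k i))
    rw [map_mul, map_mul, free_g, freeG_ι] at this
    refine this.trans ?_
    fin_cases i <;> simp [hy, hj]
  have hx : ∀ i, j (x k) * y i = ![0, y 0, 0, y 2] i + ![y 0, -y 1, y 2, -y 3] i * j (x k) := by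
    intro i
    have := congrArg q (smashInr_x_mul (ι k i))
    rw [map_mul, map_add, map_mul, free_g, free_x, freeG_ι, freeX_ι] at this
    refine this.trans ?_
    fin_cases i <;> simp [hy, hj]
  have hyF : ∀ i, y i ∈ (deformationFiltration lam κ).F 1 := fun i =>
    toDeformation_mem (toDeformation_inl_mem (by
      rw [freeGrading, pow_one]; exact Submodule.subset_span ⟨i, rfl⟩))
  have hjF : ∀ h, j h ∈ (deformationFiltration lam κ).F 0 := fun h =>
    toDeformation_mem (toDeformation_inr_mem h)
  refine relation_values_of_independent (y := y) (j := j) (lam := lam) hg hx ?_ ?_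
    (c := fun i => κ (relElem lam i)) ?_
  · rw [injective_iff_map_eq_zero]
    intro h hh
    refine hP.eq_zero_of_mem_prev (n := 0) (c := j.toLinearMap) hjF ?_
      (t := (smashInr k (Double lam)).toLinearMap) (smashInr_mem lam)
      (smashInr_double_injective lam) (m := h) ?_
    · intro d hd
      exact exists_inr_sub_mem_prev hd
    · rw [AlgHom.toLinearMap_apply, hh]
      exact zero_mem _
  · intro h hh
    refine hP.eq_zero_of_mem_prev (n := 1) (c := sumGen y j) ?_ ?_
      (t := sumGen (smashGen lam) (smashInr k (Double lam))) ?_ ?_ (m := h) ?_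
    · intro m
      rw [sumGen_apply]
      refine sum_mem fun i _ => ?_
      have := (deformationFiltration lam κ).mul_mem (hyF i) (hjF (m i))
      rwa [add_zero] at this
    · intro d hd
      obtain ⟨m, hm⟩ := exists_sum_sub_mem_prev hd
      refine ⟨m, ?_⟩
      rw [sumGen_apply]
      exact hm
    · intro m
      rw [sumGen_apply]
      refine sum_mem fun i _ => ?_
      have := doubleSmashGrading_mul_mem lam (smashGen_mem lam i) (smashInr_mem lam (m i))
      rwa [add_zero] at this
    · intro m m' hm
      rw [sumGen_apply, sumGen_apply] at hm
      exact sum_smashGen_injective lam hm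
    · rw [sumGen_apply, hh]
      exact zero_mem _
  · intro i
    rw [hlift]
    exact toDeformation_rel (relElem lam i)

end Independence

end SweedlerPBW

end

open SweedlerPBW

theorem proposition4p1 {k : Type*} [Field k] [NeZero (2 : k)] (lam : k) :
    (∃ e : RingQuot (fun a b : Free4 k => (∃ i, a = rel lam i) ∧ b = 0) ≃ₐ[k] Double lam,
      ∀ j : Fin 4, e (RingQuot.mkAlgHom k _ (FreeAlgebra.ι k j)) = doubleGen lam j) ∧
    (∀ κ : relSpace lam →ₗ[k] Sweedler k,
      (deformationFiltration lam κ).IsPBWDeformation (doubleSmashGrading lam) ↔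
        ∃ α : k, κ (relElem lam 3) = algebraMap k (Sweedler k) α ∧
          ∀ i, i ≠ 3 → κ (relElem lam i) = 0) ∧
    (∀ α : k, ∃! κ : relSpace lam →ₗ[k] Sweedler k,
      κ (relElem lam 3) = algebraMap k (Sweedler k) α ∧
        ∀ i, i ≠ 3 → κ (relElem lam i) = 0) :=
  ⟨exists_presentation_equiv lam,
    fun _ => ⟨eq_of_isPBWDeformation, fun ⟨_, h3, h0⟩ => isPBWDeformation_of_eq h3 h0⟩,
    existsUnique_relSpace_map lam⟩
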